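/- All graphs are finite. Let $\mathcal S$ be the set of (isomorphism classes of) trivalent bipartite graphs, multiple edges allowed, with all edges oriented from the vertices of the first part (sources) to the vertices of the second part (sinks); graphs need not be connected, may be empty, and may have additional oriented circle components without vertices. A bigon is a pair of different edges with the same two ends; a quadrilateral is a cycle of length four through four distinct vertices. Let $\mathcal T=\{t_1,t_2,\dots\}\subset\mathcal S$ be the set of connected trivalent bipartite graphs (not circles) that have neither bigons nor quadrilaterals, and let $\mathcal M=\mathbb Z[A,A^{-1}][t_1,t_2,\dots]$ be the algebra of polynomials in the variables $t\in\mathcal T$ over the Laurent polynomials. (1) There exists a unique map $f:\mathcal S\to\mathcal M$ such that $f(t)=t$ for $t\in\mathcal T$, $f(\emptyset)=1$, $f(\Gamma\sqcup\Gamma')=f(\Gamma)f(\Gamma')$, and the Kuperberg relations hold (no planarity being assumed): * (circle) $f(\bigcirc)=A^{6}+1+A^{-6}$; * (bigon) $f(\Gamma)=(A^{3}+A^{-3})f(\Gamma')$ whenever $\Gamma'$ is obtained from $\Gamma$ by deleting the two edges of a bigon and joining the remaining edge at its sink to the remaining edge at its source; * (quadrilateral) $f(\Gamma)=f(\Gamma_1)+f(\Gamma_2)$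 whenever $\Gamma$ has a quadrilateral with sources $a_1,a_2$ and sinks $b_1,b_2$, where $\Gamma_1,\Gamma_2$ are obtained by deleting its four edges and joining the remaining edge at each sink to the remaining edge at a source, in the pairing $b_1a_1,\ b_2a_2$ for $\Gamma_1$ and $b_1a_2,\ b_2a_1$ for $\Gamma_2$. (When edges that are joined coincide, circles arise.) (2) The resulting evaluation gives an invariant of oriented virtual links. For an oriented virtual link diagram $K$, a state $s$ chooses at every classical crossing either the oriented smoothing (each incoming arc is joined to the outgoing arc of the other strand) or the unoriented one (the two incoming arcs end in a new sink, the two outgoing arcs start in a new source, and a new edge runs from the source to the sink), which gives a graph $K_s\in\mathcal S$. A crossing of sign $w=\pm1$ has weight $A^{2w}$ in the first case and $-A^{-w}$ in the second; let $w(s)$ be the product of these weights, $[[K]]=\sum_s w(s)f(K_s)\in\mathcal M$, and let $wr(K)$ be the sum of the signs of the classical crossings. Then $A^{-8\,wr(K)}[[K]]$ depends only on the virtual link represented by $K$, i.e. on the Gauss diagram of $K$ up to (all oriented versions of) the three Reidemeister moves. -/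

import Mathlib

/-- A finite oriented one-dimensional complex all of whose components are oriented trivalent
bipartite graphs (edges running from the first part, the *sources*, to the second part, the
*sinks*) or oriented circles. Multiple edges are allowed. As in any cell structure, an oriented arc
or a circle may carry *pass* vertices, with one incoming and one outgoing edge; they are only
subdivision points (see `Web.Step`). -/
structure Web where
  V : Type
  E : Type
  [finV : Finite V]
  [finE : Finite E]
  src : E → V
  tgt : E → V
  valence : ∀ v : V,
    ({e | src e = v}.ncard = 3 ∧ {e | tgt e = v}.ncard = 0) ∨
    ({e | src e = v}.ncard = 0 ∧ {e | tgt e = v}.ncard = 3) ∨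
    ({e | src e = v}.ncard = 1 ∧ {e | tgt e = v}.ncard = 1)

namespace Web

attribute [instance] Web.finV Web.finE

/-- The number of edges leaving `v`. -/
noncomputable def outDeg (G : Web) (v : G.V) : ℕ := {e | G.src e = v}.ncard

/-- The number of edges entering `v`. -/
noncomputable def inDeg (G : Web) (v : G.V) : ℕ := {e | G.tgt e = v}.ncard

/-- There are no subdivision points: the complex is a trivalent bipartite graph. -/
def IsTrivalent (G : Web) : Prop := ∀ v : G.V, G.outDeg v = 3 ∨ G.inDeg v = 3

/-- Connectedness (of the underlying undirected graph); a connected complex is not empty. -/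
def IsConnected (G : Web) : Prop :=
  (SimpleGraph.fromRel fun u v : G.V => ∃ e, G.src e = u ∧ G.tgt e = v).Connected

/-- An isomorphism of oriented complexes. -/
structure Iso (G H : Web) where
  onV : G.V ≃ H.V
  onE : G.E ≃ H.E
  src_comm : ∀ e, H.src (onE e) = onV (G.src e)
  tgt_comm : ∀ e, H.tgt (onE e) = onV (G.tgt e)

/-! ### Counting lemmas for edges -/

theorem ncard_subtype {α : Type} (p q : α → Prop) :
    {e : {e // p e} | q e}.ncard = {e | p e ∧ q e}.ncard := by
  rw [← Set.ncard_image_of_injective _ (Subtype.val_injective (p := p))]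
  congr 1
  ext e
  simp [and_comm]

theorem ncard_eq_of_equiv {α β : Type} (f : α ≃ β) (s : Set α) (t : Set β)
    (h : ∀ a, a ∈ s ↔ f a ∈ t) : s.ncard = t.ncard := by
  rw [← Set.ncard_image_of_injective s f.injective]
  congr 1
  ext b
  constructor
  · rintro ⟨a, ha, rfl⟩
    exact (h a).1 ha
  · intro hb
    exact ⟨f.symm b, (h _).2 (by simpa using hb), by simp⟩

theorem ncard_sum {α β : Type} [Finite α] [Finite β] (p : α ⊕ β → Prop) :
    {e | p e}.ncard = {a | p (Sum.inl a)}.ncard + {b | p (Sum.inr b)}.ncard := by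
  rw [← Set.ncard_image_of_injective {a | p (Sum.inl a)} (Sum.inl_injective (β := β)),
    ← Set.ncard_image_of_injective {b | p (Sum.inr b)} (Sum.inr_injective (α := α)),
    ← Set.ncard_union_eq]
  · congr 1
    ext (a | b) <;> simp
  · rw [Set.disjoint_left]
    rintro _ ⟨a, _, rfl⟩ ⟨b, _, h⟩
    cases h

theorem ncard_option {α : Type} [Finite α] (p : Option α → Prop) [Decidable (p none)] :
    {e | p e}.ncard = {a | p (some a)}.ncard + if p none then 1 else 0 := by
  rw [← Set.ncard_image_of_injective {a | p (some a)} (Option.some_injective α)]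
  split_ifs with h
  · rw [← Set.ncard_insert_of_notMem (a := none) (by simp)]
    congr 1
    ext (_ | a) <;> simp [h]
  · congr 1
    ext (_ | a) <;> simp [h]

theorem two_le_out {G : Web} {e e' : G.E} (hne : e ≠ e') (h : G.src e' = G.src e) :
    {x | G.src x = G.src e}.ncard = 3 ∧ {x | G.tgt x = G.src e}.ncard = 0 := by
  have h2 : 1 < {x | G.src x = G.src e}.ncard :=
    (Set.one_lt_ncard_iff).2 ⟨e, e', rfl, h, hne⟩
  rcases G.valence (G.src e) with h | h | h <;> first | exact h | omega

theorem two_le_in {G : Web} {e e' : G.E} (hne : e ≠ e') (h : G.tgt e' = G.tgt e) :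
    {x | G.src x = G.tgt e}.ncard = 0 ∧ {x | G.tgt x = G.tgt e}.ncard = 3 := by
  have h2 : 1 < {x | G.tgt x = G.tgt e}.ncard :=
    (Set.one_lt_ncard_iff).2 ⟨e, e', rfl, h, hne⟩
  rcases G.valence (G.tgt e) with h | h | h <;> first | exact h | omega

theorem ncard_sdiff_pair {α : Type} [Finite α] {s : Set α} {x y : α} (hs : s.ncard = 3)
    (hx : x ∈ s) (hy : y ∈ s) (hxy : x ≠ y) : {e | (e ≠ x ∧ e ≠ y) ∧ e ∈ s}.ncard = 1 := by
  have : {e | (e ≠ x ∧ e ≠ y) ∧ e ∈ s} = s \ {x, y} := by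
    ext e
    simp only [Set.mem_ofPred_eq, Set.mem_sdiff, Set.mem_insert_iff, Set.mem_singleton_iff]
    tauto
  rw [this, Set.ncard_sdiff (by intro z; rintro (rfl | rfl) <;> assumption),
    Set.ncard_pair hxy, hs]

/-! ### Empty complex, circle, disjoint union, subdivision -/

/-- The empty complex. -/
def empty : Web where
  V := Empty
  E := Empty
  src := id
  tgt := id
  valence := fun v => v.elim

/-- The oriented circle, with one subdivision point. -/
def circle : Web where
  V := Unit
  E := Unit
  src := id
  tgt := id
  valence := fun v => by simp [Set.ncard_univ]

/-- Disjoint union. -/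
def disjUnion (G H : Web) : Web where
  V := G.V ⊕ H.V
  E := G.E ⊕ H.E
  src := Sum.map G.src H.src
  tgt := Sum.map G.tgt H.tgt
  valence := by
    rintro (v | v)
    · simpa [ncard_sum] using G.valence v
    · simpa [ncard_sum] using H.valence v

open Classical in
/-- Subdivision of the edge `e₀` by a new pass vertex `none`: the edge `some e₀` now ends at the
new vertex, and the new edge `none` leads from it to the old end of `e₀`. -/
noncomputable def subdivide (G : Web) (e₀ : G.E) : Web where
  V := Option G.V
  E := Option G.E
  src := fun e => e.map G.src
  tgt := fun e => e.elim (some (G.tgt e₀)) fun e => if e = e₀ then none else some (G.tgt e)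
  valence := by
    rintro (_ | v)
    · right; right
      simp [ncard_option, Option.elim]
    · have h1 : {e : Option G.E | e.map G.src = some v}.ncard = {e | G.src e = v}.ncard := by
        simp [ncard_option]
      have h2 : {e : Option G.E | (e.elim (some (G.tgt e₀))
          fun e => if e = e₀ then none else some (G.tgt e)) = some v}.ncard
          = {e | G.tgt e = v}.ncard := by
        rw [ncard_option]
        simp only [Option.elim_some, Option.elim_none, Option.some.injEq]
        by_cases h : G.tgt e₀ = v
        · rw [if_pos h]
          have : {e | G.tgt e = v} =
              insert e₀ {a | (if a = e₀ then none else some (G.tgt a)) = some v} := by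
            ext e
            by_cases he : e = e₀ <;> simp [he, h]
          rw [this, Set.ncard_insert_of_notMem (by simp)]
        · rw [if_neg h, add_zero]
          congr 1
          ext e
          by_cases he : e = e₀
          · subst he; simp [h]
          · simp [he]
      rw [h1, h2]
      exact G.valence v

/-- Elementary homeomorphisms of oriented complexes: isomorphisms and subdivisions. -/
inductive Step : Web → Web → Prop
  | iso {G H : Web} (φ : Iso G H) : Step G H
  | subdivide (G : Web) (e : G.E) : Step G (G.subdivide e)

/-! ### Bigons -/

/-- A bigon: two different edges with the same ends. -/
structure Bigon (G : Web) where
  e₁ : G.E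
  e₂ : G.E
  ne : e₁ ≠ e₂
  src_eq : G.src e₂ = G.src e₁
  tgt_eq : G.tgt e₂ = G.tgt e₁

theorem Bigon.src_ne_tgt {G : Web} (B : G.Bigon) : G.src B.e₁ ≠ G.tgt B.e₁ := by
  intro h
  have h1 := (two_le_out B.ne B.src_eq).1
  have h2 := (two_le_in B.ne B.tgt_eq).1
  rw [h] at h1
  omega

open Classical in
/-- The map that identifies the sink of a bigon with its source. -/
noncomputable def Bigon.fuse {G : Web} (B : G.Bigon) (v : G.V) : {v : G.V // v ≠ G.tgt B.e₁} :=
  if h : v = G.tgt B.e₁ then ⟨G.src B.e₁, B.src_ne_tgt⟩ else ⟨v, h⟩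

theorem Bigon.fuse_src {G : Web} (B : G.Bigon) (e : G.E) :
    (B.fuse (G.src e) : G.V) = G.src e := by
  have : G.src e ≠ G.tgt B.e₁ := by
    intro h
    have h0 := (two_le_in B.ne B.tgt_eq).1
    rw [Set.ncard_eq_zero] at h0
    have : e ∈ {x | G.src x = G.tgt B.e₁} := h
    rw [h0] at this
    exact this
  simp [Bigon.fuse, this]

/-- Resolution of a bigon: its two edges are deleted and its two vertices are identified, so that
the third edge at the sink is continued by the third edge at the source (when these are one and the
same edge, it becomes a circle). -/
noncomputable def Bigon.resolve {G : Web} (B : G.Bigon) : Web where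
  V := {v : G.V // v ≠ G.tgt B.e₁}
  E := {e : G.E // e ≠ B.e₁ ∧ e ≠ B.e₂}
  src := fun e => B.fuse (G.src e)
  tgt := fun e => B.fuse (G.tgt e)
  valence := by
    rintro ⟨v, hv⟩
    obtain ⟨ho, ho'⟩ := two_le_out B.ne B.src_eq
    obtain ⟨hi', hi⟩ := two_le_in B.ne B.tgt_eq
    simp only [Subtype.ext_iff, Bigon.fuse_src]
    rw [ncard_subtype (fun e => e ≠ B.e₁ ∧ e ≠ B.e₂) (fun e => G.src e = v),
      ncard_subtype (fun e => e ≠ B.e₁ ∧ e ≠ B.e₂) (fun e => (B.fuse (G.tgt e) : G.V) = v)]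
    by_cases hva : v = G.src B.e₁
    · subst hva
      right; right
      constructor
      · exact ncard_sdiff_pair ho rfl B.src_eq B.ne
      · rw [← ncard_sdiff_pair hi rfl B.tgt_eq B.ne]
        congr 1
        ext e
        rw [Set.ncard_eq_zero] at ho'
        have h0 : G.tgt e ≠ G.src B.e₁ := fun h => by
          have : e ∈ {x | G.tgt x = G.src B.e₁} := h
          rw [ho'] at this
          exact this
        by_cases h : G.tgt e = G.tgt B.e₁ <;> simp [Bigon.fuse, h, h0]
    · have h1 : {e | (e ≠ B.e₁ ∧ e ≠ B.e₂) ∧ G.src e = v} = {e | G.src e = v} := by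
        ext e
        simp only [Set.mem_ofPred_eq, and_iff_right_iff_imp]
        rintro rfl
        exact ⟨fun h => hva (by rw [h]), fun h => hva (by rw [h, B.src_eq])⟩
      have h2 : {e | (e ≠ B.e₁ ∧ e ≠ B.e₂) ∧ (B.fuse (G.tgt e) : G.V) = v}
          = {e | G.tgt e = v} := by
        ext e
        by_cases h : G.tgt e = G.tgt B.e₁
        · simp [Bigon.fuse, h, Ne.symm hva, Ne.symm hv]
        · have h3 : e ≠ B.e₁ := fun h' => h (by rw [h'])
          have h4 : e ≠ B.e₂ := fun h' => h (by rw [h', B.tgt_eq])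
          simp [Bigon.fuse, h, h3, h4]
      rw [h1, h2]
      exact G.valence v

/-! ### Quadrilaterals -/

/-- A quadrilateral: a cycle of length four through four different vertices, the edge `eᵢⱼ`
running from `aᵢ` to `bⱼ`. -/
structure Quad (G : Web) where
  a₁ : G.V
  a₂ : G.V
  b₁ : G.V
  b₂ : G.V
  ne_a : a₁ ≠ a₂
  ne_b : b₁ ≠ b₂
  e₁₁ : G.E
  e₁₂ : G.E
  e₂₁ : G.E
  e₂₂ : G.E
  src₁₁ : G.src e₁₁ = a₁
  tgt₁₁ : G.tgt e₁₁ = b₁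
  src₁₂ : G.src e₁₂ = a₁
  tgt₁₂ : G.tgt e₁₂ = b₂
  src₂₁ : G.src e₂₁ = a₂
  tgt₂₁ : G.tgt e₂₁ = b₁
  src₂₂ : G.src e₂₂ = a₂
  tgt₂₂ : G.tgt e₂₂ = b₂

namespace Quad

variable {G : Web} (Q : G.Quad)

/-- The same quadrilateral, with the names of its two sinks exchanged. -/
def swap : G.Quad where
  a₁ := Q.a₁
  a₂ := Q.a₂
  b₁ := Q.b₂
  b₂ := Q.b₁
  ne_a := Q.ne_a
  ne_b := Q.ne_b.symm
  e₁₁ := Q.e₁₂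
  e₁₂ := Q.e₁₁
  e₂₁ := Q.e₂₂
  e₂₂ := Q.e₂₁
  src₁₁ := Q.src₁₂
  tgt₁₁ := Q.tgt₁₂
  src₁₂ := Q.src₁₁
  tgt₁₂ := Q.tgt₁₁
  src₂₁ := Q.src₂₂
  tgt₂₁ := Q.tgt₂₂
  src₂₂ := Q.src₂₁
  tgt₂₂ := Q.tgt₂₁

/-- The same quadrilateral, with the indices 1 and 2 exchanged throughout. -/
def flip : G.Quad where
  a₁ := Q.a₂
  a₂ := Q.a₁
  b₁ := Q.b₂
  b₂ := Q.b₁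
  ne_a := Q.ne_a.symm
  ne_b := Q.ne_b.symm
  e₁₁ := Q.e₂₂
  e₁₂ := Q.e₂₁
  e₂₁ := Q.e₁₂
  e₂₂ := Q.e₁₁
  src₁₁ := Q.src₂₂
  tgt₁₁ := Q.tgt₂₂
  src₁₂ := Q.src₂₁
  tgt₁₂ := Q.tgt₂₁
  src₂₁ := Q.src₁₂
  tgt₂₁ := Q.tgt₁₂
  src₂₂ := Q.src₁₁
  tgt₂₂ := Q.tgt₁₁

theorem ne_row : Q.e₁₁ ≠ Q.e₁₂ := fun h => Q.ne_b (by rw [← Q.tgt₁₁, h, Q.tgt₁₂])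

theorem ne_col : Q.e₁₁ ≠ Q.e₂₁ := fun h => Q.ne_a (by rw [← Q.src₁₁, h, Q.src₂₁])

theorem deg_a₁ : {x | G.src x = Q.a₁}.ncard = 3 ∧ {x | G.tgt x = Q.a₁}.ncard = 0 := by
  have := two_le_out Q.ne_row (by rw [Q.src₁₁, Q.src₁₂])
  rwa [Q.src₁₁] at this

theorem deg_b₁ : {x | G.src x = Q.b₁}.ncard = 0 ∧ {x | G.tgt x = Q.b₁}.ncard = 3 := by
  have := two_le_in Q.ne_col (by rw [Q.tgt₁₁, Q.tgt₂₁])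
  rwa [Q.tgt₁₁] at this

theorem a_ne_b : Q.a₁ ≠ Q.b₁ := fun h => by
  have h1 := Q.deg_a₁.1
  have h2 := Q.deg_b₁.1
  rw [h] at h1
  omega

theorem src_ne (e : G.E) : G.src e ≠ Q.b₁ := fun h => by
  have h0 := Q.deg_b₁.1
  rw [Set.ncard_eq_zero] at h0
  have : e ∈ {x | G.src x = Q.b₁} := h
  rw [h0] at this
  exact this

theorem tgt_ne (e : G.E) : G.tgt e ≠ Q.a₁ := fun h => by
  have h0 := Q.deg_a₁.2
  rw [Set.ncard_eq_zero] at h0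
  have : e ∈ {x | G.tgt x = Q.a₁} := h
  rw [h0] at this
  exact this

/-- `e` is not one of the four sides. -/
def Off (e : G.E) : Prop := e ≠ Q.e₁₁ ∧ e ≠ Q.e₁₂ ∧ e ≠ Q.e₂₁ ∧ e ≠ Q.e₂₂

open Classical in
/-- The map that identifies the sink `b₁` with the source `a₁`, and `b₂` with `a₂`. -/
noncomputable def fuse (v : G.V) : {v : G.V // v ≠ Q.b₁ ∧ v ≠ Q.b₂} :=
  if h₁ : v = Q.b₁ then ⟨Q.a₁, Q.a_ne_b, Q.swap.a_ne_b⟩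
  else if h₂ : v = Q.b₂ then ⟨Q.a₂, Q.flip.swap.a_ne_b, Q.flip.a_ne_b⟩
  else ⟨v, h₁, h₂⟩

theorem fuse_src (e : G.E) : (Q.fuse (G.src e) : G.V) = G.src e := by
  have h1 : G.src e ≠ Q.b₁ := Q.src_ne e
  have h2 : G.src e ≠ Q.b₂ := Q.flip.src_ne e
  simp [fuse, h1, h2]

theorem fuse_flip (v : G.V) : (Q.flip.fuse v : G.V) = Q.fuse v := by
  have h := Q.ne_b
  by_cases h1 : v = Q.b₁
  · subst h1; simp [fuse, flip, h]
  · by_cases h2 : v = Q.b₂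
    · subst h2; simp [fuse, flip, h.symm]
    · simp [fuse, flip, h1, h2]

theorem off_flip (e : G.E) : Q.flip.Off e ↔ Q.Off e := by
  simp only [Off, flip]
  tauto

theorem out_a₁ : {e | Q.Off e ∧ G.src e = Q.a₁}.ncard = 1 := by
  rw [← ncard_sdiff_pair Q.deg_a₁.1 (x := Q.e₁₁) (y := Q.e₁₂) Q.src₁₁ Q.src₁₂ Q.ne_row]
  congr 1
  ext e
  simp only [Off, Set.mem_ofPred_eq]
  constructor
  · tauto
  · rintro ⟨⟨h1, h2⟩, h3⟩
    exact ⟨⟨h1, h2, fun h => Q.ne_a (by rw [← h3, h, Q.src₂₁]),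
      fun h => Q.ne_a (by rw [← h3, h, Q.src₂₂])⟩, h3⟩

theorem in_a₁ : {e | Q.Off e ∧ (Q.fuse (G.tgt e) : G.V) = Q.a₁}.ncard = 1 := by
  rw [← ncard_sdiff_pair Q.deg_b₁.2 (x := Q.e₁₁) (y := Q.e₂₁) Q.tgt₁₁ Q.tgt₂₁ Q.ne_col]
  congr 1
  ext e
  have hb : G.tgt e = Q.b₁ → e ≠ Q.e₁₂ ∧ e ≠ Q.e₂₂ := fun h3 =>
    ⟨fun h => Q.ne_b (by rw [← h3, h, Q.tgt₁₂]), fun h => Q.ne_b (by rw [← h3, h, Q.tgt₂₂])⟩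
  have hf : (Q.fuse (G.tgt e) : G.V) = Q.a₁ ↔ G.tgt e = Q.b₁ := by
    have ha := Q.tgt_ne e
    have hne := Q.ne_a.symm
    by_cases h1 : G.tgt e = Q.b₁
    · simp [fuse, h1]
    · by_cases h2 : G.tgt e = Q.b₂
      · simp [fuse, h2, hne, Q.ne_b.symm]
      · simp [fuse, h1, h2, ha]
  simp only [Off, Set.mem_ofPred_eq, hf]
  tauto

/-- A resolution of a quadrilateral: its four edges are deleted, `b₁` is identified with `a₁` and
`b₂` with `a₂`, so that the remaining edge at `bᵢ` is continued by the remaining edge at `aᵢ`. The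
other resolution is that of `Q.swap`. -/
noncomputable def resolve : Web where
  V := {v : G.V // v ≠ Q.b₁ ∧ v ≠ Q.b₂}
  E := {e : G.E // Q.Off e}
  src := fun e => Q.fuse (G.src e)
  tgt := fun e => Q.fuse (G.tgt e)
  valence := by
    rintro ⟨v, hv1, hv2⟩
    simp only [Subtype.ext_iff, fuse_src]
    rw [ncard_subtype Q.Off (fun e => G.src e = v),
      ncard_subtype Q.Off (fun e => (Q.fuse (G.tgt e) : G.V) = v)]
    by_cases hva : v = Q.a₁
    · subst hva
      exact Or.inr (Or.inr ⟨Q.out_a₁, Q.in_a₁⟩)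
    by_cases hva' : v = Q.a₂
    · subst hva'
      have h1 := Q.flip.out_a₁
      have h2 := Q.flip.in_a₁
      simp only [off_flip, fuse_flip] at h1 h2
      exact Or.inr (Or.inr ⟨h1, h2⟩)
    have h1 : {e | Q.Off e ∧ G.src e = v} = {e | G.src e = v} := by
      ext e
      simp only [Set.mem_ofPred_eq, and_iff_right_iff_imp]
      rintro rfl
      exact ⟨fun h => hva (by rw [h, Q.src₁₁]), fun h => hva (by rw [h, Q.src₁₂]),
        fun h => hva' (by rw [h, Q.src₂₁]), fun h => hva' (by rw [h, Q.src₂₂])⟩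
    have h2 : {e | Q.Off e ∧ (Q.fuse (G.tgt e) : G.V) = v} = {e | G.tgt e = v} := by
      ext e
      by_cases hb : G.tgt e = Q.b₁
      · simp [fuse, hb, Ne.symm hva, Ne.symm hv1]
      · by_cases hb' : G.tgt e = Q.b₂
        · simp [fuse, hb', Q.ne_b.symm, Ne.symm hva', Ne.symm hv2]
        · have h3 : Q.Off e :=
            ⟨fun h => hb (by rw [h, Q.tgt₁₁]), fun h => hb' (by rw [h, Q.tgt₁₂]),
              fun h => hb (by rw [h, Q.tgt₂₁]), fun h => hb' (by rw [h, Q.tgt₂₂])⟩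
          simp [fuse, hb, hb', h3]
    rw [h1, h2]
    exact G.valence v

end Quad

end Web

/-! ### The set of graphs and the ring of values -/

/-- The set of finite oriented trivalent bipartite graphs (circle components allowed): oriented
complexes up to homeomorphism, that is, up to isomorphism and subdivision. -/
def TriGraph : Type 1 := Quot Web.Step

/-- The element of `TriGraph` represented by a complex. -/
def Web.toGraph (G : Web) : TriGraph := Quot.mk _ G

/-- Irreducible graphs: the connected trivalent bipartite graphs that have neither bigons nor
quadrilaterals. -/
def TriGraph.IsIrreducible (t : TriGraph) : Prop :=
  ∃ G : Web, G.toGraph = t ∧ G.IsTrivalent ∧ G.IsConnected ∧ IsEmpty G.Bigon ∧ IsEmpty G.Quad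

/-- The polynomial algebra over the Laurent polynomials in `A` whose variables are the irreducible
graphs. -/
abbrev GraphPoly : Type 1 :=
  MvPolynomial {t : TriGraph // t.IsIrreducible} (LaurentPolynomial ℤ)

/-- The power `A ^ n` as an element of `GraphPoly`. -/
noncomputable def powA (n : ℤ) : GraphPoly := MvPolynomial.C (LaurentPolynomial.T n)

/-- A map on graphs satisfies the Kuperberg relations. The first three fields express that
irreducible graphs stand for themselves and that disjoint unions are products; the last three are
circle evaluation, bigon reduction and quadrilateral reduction. -/
structure IsKuperberg (f : TriGraph → GraphPoly) : Prop where
  irreducible : ∀ t : {t : TriGraph // t.IsIrreducible}, f t = MvPolynomial.X t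
  empty : f Web.empty.toGraph = 1
  disjUnion : ∀ G H : Web, f (G.disjUnion H).toGraph = f G.toGraph * f H.toGraph
  circle : f Web.circle.toGraph = powA 6 + 1 + powA (-6)
  bigon : ∀ (G : Web) (B : G.Bigon), f G.toGraph = (powA 3 + powA (-3)) * f B.resolve.toGraph
  quad : ∀ (G : Web) (Q : G.Quad),
    f G.toGraph = f Q.resolve.toGraph + f Q.swap.resolve.toGraph

/-! ### Virtual links -/

/-- An oriented Gauss diagram, that is, an oriented virtual link diagram. The points of `P` lie on
a disjoint union of oriented circles, `next` being the next point along the orientation.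
A classical crossing `x` has an overpass `pt (x, true)` and an underpass `pt (x, false)`.
The points that are not in the range of `pt` are mere subdivision points of the circles; in
particular a circle component without classical crossings carries at least one such point. -/
structure GaussDiagram where
  P : Type
  X : Type
  [finP : Finite P]
  [fintypeX : Fintype X]
  next : Equiv.Perm P
  pt : X × Bool → P
  pt_inj : Function.Injective pt
  sign : X → ℤˣ

namespace GaussDiagram

attribute [instance] GaussDiagram.finP GaussDiagram.fintypeX

/-- The writhe: the sum of the signs of the classical crossings. -/
def writhe (K : GaussDiagram) : ℤ := ∑ x : K.X, (K.sign x : ℤ)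

/-! A state `s` chooses for each crossing `x` the oriented (`s x = true`) or the unoriented
(`s x = false`) local state. In the oriented one, each incoming arc is continued by the outgoing arc
of the other strand. In the unoriented one, the two incoming arcs end in a sink, the two outgoing
arcs start in a source, and a new edge leads from the source to the sink. The vertices of the state
graph are the points of the diagram; it has one edge (arc) for each point `p`, which runs from `p`
to the next point, and one new edge for each crossing in the unoriented local state. -/

/-- The vertex of the state graph at which the arc that leaves the point `p` starts. -/
noncomputable def exit (K : GaussDiagram) (s : K.X → Bool) : K.P → K.P :=
  Function.extend K.pt (fun y => K.pt (y.1, if s y.1 then !y.2 else true)) id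

/-- The vertex of the state graph at which the arc that arrives at the point `p` ends. -/
noncomputable def entry (K : GaussDiagram) (s : K.X → Bool) : K.P → K.P :=
  Function.extend K.pt (fun y => K.pt (y.1, if s y.1 then y.2 else false)) id

variable (K : GaussDiagram) (s : K.X → Bool)

theorem exit_pt (x : K.X) (b : Bool) :
    K.exit s (K.pt (x, b)) = K.pt (x, if s x then !b else true) :=
  K.pt_inj.extend_apply _ _ _

theorem entry_pt (x : K.X) (b : Bool) :
    K.entry s (K.pt (x, b)) = K.pt (x, if s x then b else false) :=
  K.pt_inj.extend_apply _ _ _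

theorem exit_mark {p : K.P} (hp : p ∉ Set.range K.pt) : K.exit s p = p :=
  Function.extend_apply' _ _ _ hp

theorem entry_mark {p : K.P} (hp : p ∉ Set.range K.pt) : K.entry s p = p :=
  Function.extend_apply' _ _ _ hp

/-- How many arcs start, resp. end, at the two vertices of a crossing and at a mark. -/
theorem arcs_pt (g : K.P → K.P) (h : Bool → Bool → Bool)
    (hpt : ∀ x b, g (K.pt (x, b)) = K.pt (x, h (s x) b))
    (hmark : ∀ p, p ∉ Set.range K.pt → g p = p) (x : K.X) (b : Bool) :
    {p | g p = K.pt (x, b)}.ncard = {c | h (s x) c = b}.ncard := by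
  have hinj : Function.Injective fun c : Bool => K.pt (x, c) := fun c c' hc => by
    have := K.pt_inj hc
    simpa using this
  rw [← Set.ncard_image_of_injective {c | h (s x) c = b} hinj]
  congr 1
  ext p
  simp only [Set.mem_ofPred_eq, Set.mem_image]
  constructor
  · intro hp
    by_cases hr : p ∈ Set.range K.pt
    · obtain ⟨⟨y, c⟩, rfl⟩ := hr
      rw [hpt] at hp
      have := K.pt_inj hp
      simp only [Prod.mk.injEq] at this
      obtain ⟨rfl, h2⟩ := this
      exact ⟨c, h2, rfl⟩
    · rw [hmark p hr] at hp
      exact absurd ⟨_, hp.symm⟩ hr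
  · rintro ⟨c, hc, rfl⟩
    rw [hpt, hc]

theorem arcs_mark (g : K.P → K.P) (h : Bool → Bool → Bool)
    (hpt : ∀ x b, g (K.pt (x, b)) = K.pt (x, h (s x) b))
    (hmark : ∀ p, p ∉ Set.range K.pt → g p = p) {q : K.P} (hq : q ∉ Set.range K.pt) :
    {p | g p = q}.ncard = 1 := by
  rw [Set.ncard_eq_one]
  refine ⟨q, ?_⟩
  ext p
  simp only [Set.mem_ofPred_eq, Set.mem_singleton_iff]
  constructor
  · intro hp
    by_cases hr : p ∈ Set.range K.pt
    · obtain ⟨⟨y, c⟩, rfl⟩ := hr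
      rw [hpt] at hp
      exact absurd ⟨_, hp⟩ hq
    · rwa [hmark p hr] at hp
  · rintro rfl
    exact hmark _ hq

/-- The graph of the state `s`. -/
noncomputable def stateGraph : Web where
  V := K.P
  E := K.P ⊕ {x : K.X // s x = false}
  src := Sum.elim (K.exit s) fun x => K.pt (x, true)
  tgt := Sum.elim (fun p => K.entry s (K.next p)) fun x => K.pt (x, false)
  valence := by
    intro v
    have hnext : {p | K.entry s (K.next p) = v}.ncard = {p | K.entry s p = v}.ncard :=
      Web.ncard_eq_of_equiv K.next _ _ fun _ => Iff.rfl
    simp only [Web.ncard_sum, Sum.elim_inl, Sum.elim_inr, hnext]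
    by_cases hv : v ∈ Set.range K.pt
    · obtain ⟨⟨x, b⟩, rfl⟩ := hv
      rw [K.arcs_pt s (K.exit s) (fun t b => if t then !b else true) (K.exit_pt s)
          (fun _ => K.exit_mark s),
        K.arcs_pt s (K.entry s) (fun t b => if t then b else false) (K.entry_pt s)
          (fun _ => K.entry_mark s)]
      have key : ∀ c : Bool, {y : {x : K.X // s x = false} | K.pt (y, c) = K.pt (x, b)}.ncard
          = if s x = false ∧ c = b then 1 else 0 := by
        intro c
        split_ifs with h
        · rw [Set.ncard_eq_one]
          refine ⟨⟨x, h.1⟩, ?_⟩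
          ext ⟨y, hy⟩
          simp [K.pt_inj.eq_iff, h.2]
        · rw [Set.ncard_eq_zero]
          ext ⟨y, hy⟩
          simp only [Set.mem_ofPred_eq, K.pt_inj.eq_iff, Prod.mk.injEq, Set.mem_empty_iff_false,
            iff_false]
          rintro ⟨rfl, h2⟩
          exact h ⟨hy, h2⟩
      rw [key, key]
      cases hs : s x <;> cases b <;> simp [Set.ncard_eq_toFinset_card']
    · have key : ∀ c : Bool, {y : {x : K.X // s x = false} | K.pt (y, c) = v}.ncard = 0 := by
        intro c
        rw [Set.ncard_eq_zero]
        ext y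
        simp only [Set.mem_ofPred_eq, Set.mem_empty_iff_false, iff_false]
        exact fun h => hv ⟨_, h⟩
      rw [K.arcs_mark s (K.exit s) (fun t b => if t then !b else true) (K.exit_pt s)
          (fun _ => K.exit_mark s) hv,
        K.arcs_mark s (K.entry s) (fun t b => if t then b else false) (K.entry_pt s)
          (fun _ => K.entry_mark s) hv, key, key]
      simp

/-- The weight of a state: a crossing of sign `w` contributes `A ^ (2 * w)` in the oriented local
state and `-A ^ (-w)` in the unoriented one. -/
noncomputable def weight : GraphPoly :=
  ∏ x : K.X, if s x then powA (2 * K.sign x) else -powA (-(K.sign x : ℤ))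

open Classical in
/-- The bracket: the weighted sum of the values of `f` over all state graphs. -/
noncomputable def bracket (f : TriGraph → GraphPoly) : GraphPoly :=
  ∑ s : K.X → Bool, K.weight s * f (K.stateGraph s).toGraph

/-- The normalized bracket. -/
noncomputable def normBracket (f : TriGraph → GraphPoly) : GraphPoly :=
  powA (-8 * K.writhe) * K.bracket f

/-! ### Reidemeister moves -/

/-- An isomorphism of Gauss diagrams. -/
structure Iso (K L : GaussDiagram) where
  onP : K.P ≃ L.P
  onX : K.X ≃ L.X
  next_comm : ∀ p, L.next (onP p) = onP (K.next p)
  pt_comm : ∀ x b, L.pt (onX x, b) = onP (K.pt (x, b))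
  sign_comm : ∀ x, L.sign (onX x) = K.sign x

open Classical in
/-- Insertion of a subdivision point `none` directly after the point `p`. -/
noncomputable def subdivide (p : K.P) : GaussDiagram where
  P := Option K.P
  X := K.X
  next := Equiv.swap none (some p) |>.trans (Equiv.optionCongr K.next)
  pt := fun y => some (K.pt y)
  pt_inj := (Option.some_injective _).comp K.pt_inj
  sign := K.sign

/-- A subdivision point. -/
def IsMark (p : K.P) : Prop := p ∉ Set.range K.pt

/-- Two subdivision points `o` and `u` become the overpass and the underpass of a new crossing
`none` of sign `ε`. -/
def addCrossing (o u : K.P) (ho : K.IsMark o) (hu : K.IsMark u) (hne : o ≠ u) (ε : ℤˣ) :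
    GaussDiagram where
  P := K.P
  X := Option K.X
  next := K.next
  pt := fun y => y.1.elim (if y.2 then o else u) fun x => K.pt (x, y.2)
  pt_inj := by
    rintro ⟨_ | x, b⟩ ⟨_ | y, c⟩ h
    · cases b <;> cases c <;> simp_all
    · exfalso
      cases b
      · exact hu ⟨_, h.symm⟩
      · exact ho ⟨_, h.symm⟩
    · exfalso
      cases c
      · exact hu ⟨_, h⟩
      · exact ho ⟨_, h⟩
    · have := K.pt_inj h
      simp_all
  sign := fun x => x.elim ε K.sign

theorem isMark_addCrossing {o u : K.P} {ho : K.IsMark o} {hu : K.IsMark u} {hne : o ≠ u} {ε : ℤˣ}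
    {p : K.P} (hp : K.IsMark p) (hpo : p ≠ o) (hpu : p ≠ u) :
    (K.addCrossing o u ho hu hne ε).IsMark p := by
  rintro ⟨⟨_ | x, b⟩, h⟩
  · cases b
    · exact hpu h.symm
    · exact hpo h.symm
  · exact hp ⟨_, h⟩

/-- The points `p` and `q` are consecutive, in this order if `ε = 1` and in the opposite order if
`ε = -1`. -/
def Follows (ε : ℤˣ) (p q : K.P) : Prop :=
  (ε = 1 ∧ K.next p = q) ∨ (ε = -1 ∧ K.next q = p)

open Classical in
/-- The Gauss diagram in which the places of the points `p₁` and `q₁`, of `p₂` and `q₂`, and of `p₃`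
and `q₃` on the circles are exchanged. -/
noncomputable def exchange (p₁ q₁ p₂ q₂ p₃ q₃ : K.P) : GaussDiagram where
  P := K.P
  X := K.X
  next :=
    let π := Equiv.swap p₁ q₁ * Equiv.swap p₂ q₂ * Equiv.swap p₃ q₃
    π * K.next * π⁻¹
  pt := K.pt
  pt_inj := K.pt_inj
  sign := K.sign

/-- Reidemeister moves on Gauss diagrams, with all choices of orientations and signs.

* `reid1`: two adjacent points become a crossing.
* `reid2`: a strand `o, o'` becomes the upper strand of two new crossings with a strand that
  passes through `u` and `u'` in either order; the new crossings have opposite signs.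
* `reid3`: a top, a middle and a bottom strand cross pairwise, `x` being the crossing of top and
  middle, `y` that of top and bottom, `z` that of middle and bottom. Each of the three strands passes
  its two crossings consecutively, and these change places. For three oriented lines in
  the plane, the orders `t`, `m`, `b` in which they pass the crossings and the orientation `o` of the
  triangle determine the signs of the crossings as stated. -/
inductive Move : GaussDiagram → GaussDiagram → Prop
  | iso {K L : GaussDiagram} (φ : Iso K L) : Move K L
  | subdivide (K : GaussDiagram) (p : K.P) : Move K (K.subdivide p)
  | reid1 (K : GaussDiagram) (o u : K.P) (ho : K.IsMark o) (hu : K.IsMark u) (hne : o ≠ u)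
      (ε : ℤˣ) (h : K.next o = u ∨ K.next u = o) : Move K (K.addCrossing o u ho hu hne ε)
  | reid2 (K : GaussDiagram) (o u o' u' : K.P) (ho : K.IsMark o) (hu : K.IsMark u)
      (ho' : K.IsMark o') (hu' : K.IsMark u') (hne : o ≠ u) (hne' : o' ≠ u')
      (h₁ : o' ≠ o) (h₂ : o' ≠ u) (h₃ : u' ≠ o) (h₄ : u' ≠ u) (ε : ℤˣ)
      (ho_next : K.next o = o') (hu_next : K.next u = u' ∨ K.next u' = u) :
      Move K ((K.addCrossing o u ho hu hne ε).addCrossing o' u'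
        (K.isMark_addCrossing ho' h₁ h₂) (K.isMark_addCrossing hu' h₃ h₄) hne' (-ε))
  | reid3 (K : GaussDiagram) (x y z : K.X) (hxy : x ≠ y) (hxz : x ≠ z) (hyz : y ≠ z)
      (t m b o : ℤˣ)
      (top : K.Follows t (K.pt (x, true)) (K.pt (y, true)))
      (mid : K.Follows m (K.pt (x, false)) (K.pt (z, true)))
      (bot : K.Follows b (K.pt (y, false)) (K.pt (z, false)))
      (sign_x : K.sign x = o * t * m) (sign_y : K.sign y = o * t * b)
      (sign_z : K.sign z = o * m * b) :
      Move K (K.exchange (K.pt (x, true)) (K.pt (y, true)) (K.pt (x, false)) (K.pt (z, true))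
        (K.pt (y, false)) (K.pt (z, false)))

/-- Two Gauss diagrams represent the same oriented virtual link. -/
def VirtuallyIsotopic : GaussDiagram → GaussDiagram → Prop := Relation.EqvGen Move

end GaussDiagram

/-! Part (1) is a diamond lemma for a rewriting system on graphs. Part (2) is then a finite
computation with linear combinations of local pictures.

Words. Give the edges of a graph different labels and record at every vertex which labels come in
and which go out. The graph becomes a multiset of vertices, which determines it up to isomorphism
(`Web.iso_of_word_eq`, `Web.word_ofWord`). The surroundings of a local picture become an arbitrary
summand `W`. Each relation becomes the replacement of a sub-multiset (`Word.Rule`): absorb a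
subdivision point, delete a circle, resolve a bigon, resolve a quadrilateral.
`Web.Bigon.word_resolve` and `Web.Quad.word_resolve` match the last two with the operations on
graphs. A choice of labels is harmless because every function considered is invariant under
permutations of the labels.

Existence. Every rule lowers the number of vertices, so rewriting ends. By induction on that number
it suffices that any two rules applicable to the same word give the same value, provided that all
smaller words have well-defined values already (`Word.Skein.ev_unique`). Rules with disjoint left
sides commute. The overlaps that matter are these. - Bigon and bigon: either the resolutions
coincide, or three edges join the same two vertices and both results contain the same circle factor.
- Bigon and quadrilateral: the quadrilateral has a doubled side. Bigons give δ₂², the quadrilateral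
gives δ₃ + 1, and these agree because (A³ + A⁻³)² = (A⁶ + 1 + A⁻⁶) + 1. - Quadrilateral and
quadrilateral: as quadrilaterals are arbitrary 4-cycles and not faces, the union may have the same
four vertices, be a K₂,₃, or be a ladder of two squares. In each case both results are the same
symmetric expression (`Word.Skein.quad_quad_of_eq`).

A word without applicable rule gets the product of the variables of its components. Since the left
side of a rule is connected, the resulting value is multiplicative (`Word.value_add`).

Uniqueness. The values on words of a solution satisfy the rules (`IsKuperberg.skein`). By the same
induction they are determined: a word is reducible, empty, a sum of two smaller valid words, or an
irreducible connected graph, whose value is prescribed.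

Invariance. Only the crossings that take part in a move are expanded. Let p, q be the weights of the
two local states. For the first move, pδ₃ + qδ₂ = A^(±8), which the writhe compensates. For the
second, all states but one cancel, both for parallel and for antiparallel strands
(`Word.Skein.parallel`, `Word.Skein.antiparallel`). For the third, the eight orientations reduce to
a braid-like and a cyclic triangle. The braid-like sum becomes symmetric under exchange of the first
and the third strand (`Word.Skein.braid_move`). In the cyclic one, the unwanted term vanishes and
what remains is three smoothings and a hexagon, which are the same on both sides
(`Word.Skein.cyclic_move`). -/

/-! ### Words: graphs in abstract index notation -/

/-- A vertex, given by the labels of its incoming and of its outgoing edges. -/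
@[ext]
structure Atom where
  ins : Multiset ℕ
  outs : Multiset ℕ

namespace Word

/-- A source with the three outgoing edges `a`, `b`, `c`. -/
def src (a b c : ℕ) : Atom := ⟨0, {a, b, c}⟩

/-- A sink with the three incoming edges `a`, `b`, `c`. -/
def snk (a b c : ℕ) : Atom := ⟨{a, b, c}, 0⟩

/-- A subdivision point with incoming edge `a` and outgoing edge `b`. -/
def strand (a b : ℕ) : Atom := ⟨{a}, {b}⟩

/-- The labels of the edges that arrive somewhere. -/
def ins (W : Multiset Atom) : Multiset ℕ := W.bind Atom.ins

/-- The labels of the edges that start somewhere. -/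
def outs (W : Multiset Atom) : Multiset ℕ := W.bind Atom.outs

noncomputable instance : DecidableEq Atom := Classical.decEq _

@[simp] theorem ins_zero : ins 0 = 0 := rfl
@[simp] theorem outs_zero : outs 0 = 0 := rfl
@[simp] theorem ins_cons (a : Atom) (W : Multiset Atom) : ins (a ::ₘ W) = a.1 + ins W :=
  Multiset.cons_bind _ _ _
@[simp] theorem outs_cons (a : Atom) (W : Multiset Atom) : outs (a ::ₘ W) = a.2 + outs W :=
  Multiset.cons_bind _ _ _
@[simp] theorem ins_singleton (a : Atom) : ins {a} = a.1 := Multiset.singleton_bind _ _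
@[simp] theorem outs_singleton (a : Atom) : outs {a} = a.2 := Multiset.singleton_bind _ _
@[simp] theorem ins_add (V W : Multiset Atom) : ins (V + W) = ins V + ins W := Multiset.add_bind _ _ _
@[simp] theorem outs_add (V W : Multiset Atom) : outs (V + W) = outs V + outs W := Multiset.add_bind _ _ _
theorem mem_ins {W : Multiset Atom} {n : ℕ} : n ∈ ins W ↔ ∃ a ∈ W, n ∈ a.1 := Multiset.mem_bind
theorem mem_outs {W : Multiset Atom} {n : ℕ} : n ∈ outs W ↔ ∃ a ∈ W, n ∈ a.2 := Multiset.mem_bind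

/-- The valence condition for a vertex. -/
def Shape (a : Atom) : Prop :=
  (a.1.card = 0 ∧ a.2.card = 3) ∨ (a.1.card = 3 ∧ a.2.card = 0) ∨ (a.1.card = 1 ∧ a.2.card = 1)

theorem shape_src (a b c : ℕ) : Shape (src a b c) := by simp [Shape, src]
theorem shape_strand (a b : ℕ) : Shape (strand a b) := by simp [Shape, strand]

/-- A word describes a complex if every label occurs once as incoming and once as outgoing edge, or
does not occur at all. -/
structure Valid (W : Multiset Atom) : Prop where
  bal : ins W = outs W
  nodup : (ins W).Nodup
  shape : ∀ a ∈ W, Shape a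

namespace Valid

variable {V W : Multiset Atom}

theorem nodup' (h : Valid W) : (outs W).Nodup := h.bal ▸ h.nodup

theorem eq_of_mem_out (h : Valid W) {a b : Atom} (ha : a ∈ W) (hb : b ∈ W) {x : ℕ} (hxa : x ∈ a.2)
    (hxb : x ∈ b.2) : a = b := by
  by_contra hne
  obtain ⟨U, rfl⟩ := Multiset.exists_cons_of_mem ha
  obtain ⟨U', rfl⟩ := Multiset.exists_cons_of_mem ((Multiset.mem_cons.1 hb).resolve_left (Ne.symm hne))
  have := h.nodup'
  simp only [outs_cons, Multiset.nodup_add] at this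
  exact Multiset.disjoint_left.1 this.2.2 hxa (by simp [hxb])

theorem eq_of_mem_in (h : Valid W) {a b : Atom} (ha : a ∈ W) (hb : b ∈ W) {x : ℕ} (hxa : x ∈ a.1)
    (hxb : x ∈ b.1) : a = b := by
  by_contra hne
  obtain ⟨U, rfl⟩ := Multiset.exists_cons_of_mem ha
  obtain ⟨U', rfl⟩ := Multiset.exists_cons_of_mem ((Multiset.mem_cons.1 hb).resolve_left (Ne.symm hne))
  have := h.nodup
  simp only [ins_cons, Multiset.nodup_add] at this
  exact Multiset.disjoint_left.1 this.2.2 hxa (by simp [hxb])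

/-- A repeated vertex would share all its labels with its copy, although labels do not repeat. It
would thus have no labels at all, against `Shape`. -/
theorem word_nodup (h : Valid W) : W.Nodup := by
  rw [Multiset.nodup_iff_ne_cons_cons]
  rintro a U rfl
  have h1 := h.nodup
  have h2 := h.nodup'
  simp only [ins_cons, outs_cons, Multiset.nodup_add, Multiset.disjoint_add_right] at h1 h2
  have h3 : a.1 = 0 := disjoint_self.1 h1.2.2.1
  have h4 : a.2 = 0 := disjoint_self.1 h2.2.2.1
  rcases h.shape a (by simp) with h | h | h <;> simp [h3, h4] at h

/-- Replacing a part of a valid word, where the labels `k` are no longer used. -/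
theorem replace {S T : Multiset Atom} (h : Valid (S + W)) (k : Multiset ℕ) (hi : ins S = ins T + k)
    (ho : outs S = outs T + k) (hs : ∀ a ∈ T, Shape a) : Valid (T + W) := by
  refine ⟨?_, ?_, fun a ha => ?_⟩
  · have := h.bal
    simp only [ins_add, outs_add, hi, ho] at this ⊢
    have h2 : k + (ins T + ins W) = k + (outs T + outs W) := by
      calc _ = ins T + k + ins W := by abel
        _ = _ := this
        _ = _ := by abel
    exact add_left_cancel h2
  · refine Multiset.nodup_of_le ?_ h.nodup
    simp only [ins_add, hi]
    gcongr
    exact Multiset.le_add_right _ _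
  · rcases Multiset.mem_add.1 ha with ha | ha
    · exact hs a ha
    · exact h.shape a (Multiset.mem_add.2 (Or.inr ha))

/-- A part of a valid word that contains with a vertex also its neighbours is valid. -/
theorem of_le (h : Valid W) (hV : V ≤ W)
    (hcl : ∀ a ∈ V, ∀ b ∈ W, ∀ n, n ∈ a.1 ∧ n ∈ b.2 ∨ n ∈ a.2 ∧ n ∈ b.1 → b ∈ V) : Valid V := by
  obtain ⟨U, rfl⟩ := Multiset.le_iff_exists_add.1 hV
  have hn := h.nodup
  have hn' := h.nodup'
  have hb := h.bal
  simp only [ins_add, outs_add, Multiset.nodup_add] at hn hn' hb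
  refine ⟨?_, hn.1, fun a ha => h.shape a (by simp [ha])⟩
  rw [Multiset.Nodup.ext hn.1 hn'.1]
  intro n
  constructor
  · intro hni
    have : n ∈ outs (V + U) := by rw [← h.bal]; simp [hni]
    obtain ⟨a, ha, hna⟩ := mem_ins.1 hni
    obtain ⟨b, hb, hnb⟩ := mem_outs.1 this
    exact mem_outs.2 ⟨b, hcl a ha b hb n (Or.inl ⟨hna, hnb⟩), hnb⟩
  · intro hno
    have : n ∈ ins (V + U) := by rw [h.bal]; simp [hno]
    obtain ⟨a, ha, hna⟩ := mem_outs.1 hno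
    obtain ⟨b, hb, hnb⟩ := mem_ins.1 this
    exact mem_ins.2 ⟨b, hcl a ha b hb n (Or.inr ⟨hna, hnb⟩), hnb⟩

/-- A label has only one end of each kind in `W`, and `V` is balanced, so `V` contains both ends of
every edge of which it contains one. -/
theorem closed (h : Valid W) (hV : Valid V) (hle : V ≤ W) {a b : Atom} (ha : a ∈ V) (hb : b ∈ W)
    {n : ℕ} (hn : n ∈ a.1 ∧ n ∈ b.2 ∨ n ∈ a.2 ∧ n ∈ b.1) : b ∈ V := by
  rcases hn with ⟨hna, hnb⟩ | ⟨hna, hnb⟩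
  · have : n ∈ outs V := by rw [← hV.bal]; exact mem_ins.2 ⟨a, ha, hna⟩
    obtain ⟨c, hc, hnc⟩ := mem_outs.1 this
    rwa [h.eq_of_mem_out hb (Multiset.mem_of_le hle hc) hnb hnc]
  · have : n ∈ ins V := by rw [hV.bal]; exact mem_outs.2 ⟨a, ha, hna⟩
    obtain ⟨c, hc, hnc⟩ := mem_ins.1 this
    rwa [h.eq_of_mem_in hb (Multiset.mem_of_le hle hc) hnb hnc]

theorem of_add_right {V W : Multiset Atom} (h : Valid (V + W)) (hV : Valid V) : Valid W := by
  have hb := h.bal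
  have hn := h.nodup
  simp only [ins_add, outs_add, hV.bal, Multiset.nodup_add] at hb hn
  exact ⟨add_left_cancel hb, hn.2.1, fun a ha => h.shape a (by simp [ha])⟩

end Valid

/-! ### Relabelling -/

/-- Application of a map to all labels of a vertex. -/
def relabelAtom (σ : ℕ → ℕ) (a : Atom) : Atom := ⟨a.1.map σ, a.2.map σ⟩

/-- Application of a map to all labels. -/
def relabel (σ : ℕ → ℕ) (W : Multiset Atom) : Multiset Atom := W.map (relabelAtom σ)

@[simp] theorem relabel_zero (σ : ℕ → ℕ) : relabel σ 0 = 0 := rfl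
@[simp] theorem relabel_cons (σ : ℕ → ℕ) (a : Atom) (W : Multiset Atom) :
    relabel σ (a ::ₘ W) = relabelAtom σ a ::ₘ relabel σ W := Multiset.map_cons _ _ _
@[simp] theorem relabel_singleton (σ : ℕ → ℕ) (a : Atom) :
    relabel σ {a} = {relabelAtom σ a} := Multiset.map_singleton _ _
@[simp] theorem relabel_add (σ : ℕ → ℕ) (V W : Multiset Atom) :
    relabel σ (V + W) = relabel σ V + relabel σ W := Multiset.map_add _ _ _
@[simp] theorem card_relabel (σ : ℕ → ℕ) (W : Multiset Atom) : (relabel σ W).card = W.card :=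
  Multiset.card_map _ _
@[simp] theorem relabelAtom_src (σ : ℕ → ℕ) (a b c : ℕ) :
    relabelAtom σ (src a b c) = src (σ a) (σ b) (σ c) := by simp [relabelAtom, src]
@[simp] theorem relabelAtom_snk (σ : ℕ → ℕ) (a b c : ℕ) :
    relabelAtom σ (snk a b c) = snk (σ a) (σ b) (σ c) := by simp [relabelAtom, snk]
@[simp] theorem relabelAtom_strand (σ : ℕ → ℕ) (a b : ℕ) :
    relabelAtom σ (strand a b) = strand (σ a) (σ b) := by simp [relabelAtom, strand]

theorem ins_relabel (σ : ℕ → ℕ) (W : Multiset Atom) : ins (relabel σ W) = (ins W).map σ := by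
  induction W using Multiset.induction with
  | empty => rfl
  | cons a W ih => simp [ih, relabelAtom]

theorem outs_relabel (σ : ℕ → ℕ) (W : Multiset Atom) : outs (relabel σ W) = (outs W).map σ := by
  induction W using Multiset.induction with
  | empty => rfl
  | cons a W ih => simp [ih, relabelAtom]

theorem relabel_congr {σ τ : ℕ → ℕ} {W : Multiset Atom} (h : ∀ n, n ∈ ins W ∨ n ∈ outs W → σ n = τ n) :
    relabel σ W = relabel τ W := by
  refine Multiset.map_congr rfl fun a ha => Atom.ext ?_ ?_
  · exact Multiset.map_congr rfl fun n hn => h n (Or.inl (mem_ins.2 ⟨a, ha, hn⟩))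
  · exact Multiset.map_congr rfl fun n hn => h n (Or.inr (mem_outs.2 ⟨a, ha, hn⟩))

theorem relabel_id (W : Multiset Atom) : relabel id W = W := by
  unfold relabel relabelAtom
  simp

theorem relabel_relabel (σ τ : ℕ → ℕ) (W : Multiset Atom) :
    relabel σ (relabel τ W) = relabel (σ ∘ τ) W := by
  unfold relabel relabelAtom
  simp [Multiset.map_map]

theorem relabel_swap_of_notMem {W : Multiset Atom} {x y : ℕ} (hW : ins W = outs W ∨ (x ∉ outs W ∧ y ∉ outs W))
    (hx : x ∉ ins W) (hy : y ∉ ins W) : relabel (Equiv.swap x y) W = W := by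
  have h : x ∉ outs W ∧ y ∉ outs W := by
    rcases hW with h | h
    · exact ⟨h ▸ hx, h ▸ hy⟩
    · exact h
  conv_rhs => rw [← relabel_id W]
  refine relabel_congr fun n hn => ?_
  have h1 : n ≠ x := by rintro rfl; exact hn.elim hx h.1
  have h2 : n ≠ y := by rintro rfl; exact hn.elim hy h.2
  exact Equiv.swap_apply_of_ne_of_ne h1 h2

theorem Valid.relabel {W : Multiset Atom} (h : Valid W) {σ : ℕ → ℕ} (hσ : Function.Injective σ) :
    Valid (relabel σ W) := by
  refine ⟨by rw [ins_relabel, outs_relabel, h.bal], ?_, ?_⟩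
  · rw [ins_relabel]
    exact h.nodup.map hσ
  · intro a ha
    obtain ⟨b, hb, rfl⟩ := Multiset.mem_map.1 ha
    simpa [Shape, relabelAtom] using h.shape b hb

theorem relabel_symm (σ : Equiv.Perm ℕ) (W : Multiset Atom) : Word.relabel σ.symm (Word.relabel σ W) = W := by
  rw [relabel_relabel]
  simp [relabel_id]

/-! ### Local rules -/

/-- The four vertices of a quadrilateral; the edge `xᵢⱼ` runs from the `i`-th source to the `j`-th
sink, `oᵢ` leaves the `i`-th source, and `iⱼ` enters the `j`-th sink. -/
def quadWord (x₁₁ x₁₂ x₂₁ x₂₂ o₁ o₂ i₁ i₂ : ℕ) : Multiset Atom :=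
  {src x₁₁ x₁₂ o₁, src x₂₁ x₂₂ o₂, snk x₁₁ x₂₁ i₁, snk x₁₂ x₂₂ i₂}

variable {R : Type*} [CommRing R]

/-- `Rule δ₂ δ₃ S L`: the part `S` of a word may be replaced by the linear combination `L`. -/
inductive Rule (δ₂ δ₃ : R) : Multiset Atom → List (R × Multiset Atom) → Prop
  | join (i o : ℕ) (I O : Multiset ℕ) :
      Rule δ₂ δ₃ {strand i o, (Atom.mk (o ::ₘ I) O)} [(1, {Atom.mk (i ::ₘ I) O})]
  | circle (i : ℕ) : Rule δ₂ δ₃ {strand i i} [(δ₃, 0)]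
  | bigon (x y o i : ℕ) : Rule δ₂ δ₃ {src x y o, snk x y i} [(δ₂, {strand i o})]
  | quad (x₁₁ x₁₂ x₂₁ x₂₂ o₁ o₂ i₁ i₂ : ℕ) :
      Rule δ₂ δ₃ (quadWord x₁₁ x₁₂ x₂₁ x₂₂ o₁ o₂ i₁ i₂)
        [(1, {strand i₁ o₁, strand i₂ o₂}), (1, {strand i₁ o₂, strand i₂ o₁})]

/-- The value of a linear combination of words, each of them completed by `W`. -/
def ev (F : Multiset Atom → R) (L : List (R × Multiset Atom)) (W : Multiset Atom) : R :=
  (L.map fun p => p.1 * F (p.2 + W)).sum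

theorem ev_congr {F G : Multiset Atom → R} {L : List (R × Multiset Atom)} {W : Multiset Atom}
    (h : ∀ p ∈ L, F (p.2 + W) = G (p.2 + W)) : ev F L W = ev G L W := by
  unfold ev
  congr 1
  exact List.map_congr_left fun p hp => by rw [h p hp]

theorem shape_join {i o : ℕ} {I O : Multiset ℕ} (h : Shape (Atom.mk (o ::ₘ I) O)) : Shape (Atom.mk (i ::ₘ I) O) := by
  simpa [Shape] using h

/-- Compared with each right side, the left side only has additional inner labels, each used once as
incoming and once as outgoing; dropping them keeps the balance. -/
theorem Rule.valid {δ₂ δ₃ : R} {S : Multiset Atom} {L : List (R × Multiset Atom)} (h : Rule δ₂ δ₃ S L) {W : Multiset Atom}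
    (hv : Valid (S + W)) {p : R × Multiset Atom} (hp : p ∈ L) : Valid (p.2 + W) := by
  cases h with
  | join i o I O =>
    simp only [List.mem_singleton] at hp
    subst hp
    refine hv.replace {o} ?_ ?_ ?_
    · simp only [strand, Multiset.insert_eq_cons, ← Multiset.singleton_add, ins_add, ins_singleton]
      abel
    · simp only [strand, Multiset.insert_eq_cons, ← Multiset.singleton_add, outs_add,
        outs_singleton]
      abel
    · have := shape_join (i := i) (hv.shape (Atom.mk (o ::ₘ I) O) (by simp))
      simpa using this
  | circle i =>
    simp only [List.mem_singleton] at hp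
    subst hp
    exact hv.replace {i} (by simp [strand]) (by simp [strand]) (by simp)
  | bigon x y o i =>
    simp only [List.mem_singleton] at hp
    subst hp
    refine hv.replace {x, y} ?_ ?_ (by simp [shape_strand])
    · simp only [src, snk, strand, Multiset.insert_eq_cons, ← Multiset.singleton_add, ins_add,
        ins_singleton, zero_add]
      abel
    · simp only [src, snk, strand, Multiset.insert_eq_cons, ← Multiset.singleton_add, outs_add,
        outs_singleton, add_zero]
      abel
  | quad x₁₁ x₁₂ x₂₁ x₂₂ o₁ o₂ i₁ i₂ =>
    simp only [List.mem_cons, List.not_mem_nil, or_false] at hp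
    rcases hp with rfl | rfl <;> refine hv.replace {x₁₁, x₁₂, x₂₁, x₂₂} ?_ ?_ (by simp [shape_strand])
    all_goals
      simp only [quadWord, src, snk, strand, Multiset.insert_eq_cons, ← Multiset.singleton_add,
        ins_add, ins_singleton, outs_add, outs_singleton, zero_add, add_zero]
      abel

/-- This strict decrease is the termination argument behind `value`, confluence and uniqueness. -/
theorem Rule.card_lt {δ₂ δ₃ : R} {S : Multiset Atom} {L : List (R × Multiset Atom)} (h : Rule δ₂ δ₃ S L)
    {p : R × Multiset Atom} (hp : p ∈ L) : p.2.card < S.card := by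
  cases h with
  | join i o I O => simp at hp; subst hp; simp
  | circle i => simp at hp; subst hp; simp
  | bigon x y o i => simp at hp; subst hp; simp
  | quad => simp at hp; rcases hp with rfl | rfl <;> simp [quadWord]

theorem Rule.relabel {δ₂ δ₃ : R} {S : Multiset Atom} {L : List (R × Multiset Atom)} (h : Rule δ₂ δ₃ S L)
    (σ : ℕ → ℕ) : Rule δ₂ δ₃ (relabel σ S) (L.map fun p => (p.1, Word.relabel σ p.2)) := by
  cases h with
  | join i o I O =>
    simpa [relabelAtom, strand] using
      Rule.join (δ₂ := δ₂) (δ₃ := δ₃) (σ i) (σ o) (I.map σ) (O.map σ)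
  | circle i => simpa using Rule.circle (δ₂ := δ₂) (δ₃ := δ₃) (σ i)
  | bigon x y o i => simpa using Rule.bigon (δ₂ := δ₂) (δ₃ := δ₃) (σ x) (σ y) (σ o) (σ i)
  | quad x₁₁ x₁₂ x₂₁ x₂₂ o₁ o₂ i₁ i₂ =>
    simpa [quadWord] using Rule.quad (δ₂ := δ₂) (δ₃ := δ₃) (σ x₁₁) (σ x₁₂) (σ x₂₁) (σ x₂₂) (σ o₁)
      (σ o₂) (σ i₁) (σ i₂)

/-- The words on which rules are considered: valid and with fewer than `n` vertices. -/
def Below (n : ℕ∞) (W : Multiset Atom) : Prop := Valid W ∧ (W.card : ℕ∞) < n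

/-- `F` satisfies all local rules on the valid words with fewer than `n` vertices. -/
structure Skein (δ₂ δ₃ : R) (n : ℕ∞) (F : Multiset Atom → R) : Prop where
  relabel : ∀ W, Below n W → ∀ σ : Equiv.Perm ℕ, F (relabel σ W) = F W
  rule : ∀ S L W, Rule δ₂ δ₃ S L → Below n (S + W) → F (S + W) = ev F L W

end Word

/-! ### The rules as equations for a function on words -/

namespace Word

variable {R : Type*} [CommRing R] {δ₂ δ₃ : R} {n : ℕ∞} {F : Multiset Atom → R}

theorem Rule.below {S : Multiset Atom} {L : List (R × Multiset Atom)} (h : Rule δ₂ δ₃ S L) {W : Multiset Atom}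
    (hb : Below n (S + W)) {p : R × Multiset Atom} (hp : p ∈ L) : Below n (p.2 + W) := by
  refine ⟨h.valid hb.1 hp, lt_of_le_of_lt ?_ hb.2⟩
  have := h.card_lt hp
  simp only [Multiset.card_add]
  exact_mod_cast by omega

namespace Skein

variable (S : Skein δ₂ δ₃ n F)
include S

theorem join {i o : ℕ} {I O : Multiset ℕ} {V W : Multiset Atom} (hV : V = {strand i o, (Atom.mk (o ::ₘ I) O)} + W)
    (hb : Below n V) : F V = F ({Atom.mk (i ::ₘ I) O} + W) ∧ Below n ({Atom.mk (i ::ₘ I) O} + W) := by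
  subst hV
  have hr := Rule.join (δ₂ := δ₂) (δ₃ := δ₃) i o I O
  exact ⟨by simpa [ev] using S.rule _ _ _ hr hb, hr.below hb (p := (1, {Atom.mk (i ::ₘ I) O})) (by simp)⟩

theorem join_snk {i o b c : ℕ} {V W : Multiset Atom} (hV : V = {strand i o, snk o b c} + W)
    (hb : Below n V) : F V = F ({snk i b c} + W) ∧ Below n ({snk i b c} + W) :=
  S.join (I := {b, c}) (O := 0) hV hb

theorem join_strand {i o b : ℕ} {V W : Multiset Atom} (hV : V = {strand i o, strand o b} + W)
    (hb : Below n V) : F V = F ({strand i b} + W) ∧ Below n ({strand i b} + W) :=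
  S.join (I := 0) (O := {b}) hV hb

theorem circle {i : ℕ} {V W : Multiset Atom} (hV : V = {strand i i} + W) (hb : Below n V) :
    F V = δ₃ * F W ∧ Below n W := by
  subst hV
  have hr := Rule.circle (δ₂ := δ₂) (δ₃ := δ₃) i
  refine ⟨by simpa [ev] using S.rule _ _ _ hr hb, ?_⟩
  simpa using hr.below hb (p := (δ₃, 0)) (by simp)

theorem bigon {x y o i : ℕ} {V W : Multiset Atom} (hV : V = {src x y o, snk x y i} + W) (hb : Below n V) :
    F V = δ₂ * F ({strand i o} + W) ∧ Below n ({strand i o} + W) := by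
  subst hV
  have hr := Rule.bigon (δ₂ := δ₂) (δ₃ := δ₃) x y o i
  exact ⟨by simpa [ev] using S.rule _ _ _ hr hb, hr.below hb (p := (δ₂, {strand i o})) (by simp)⟩

theorem quad {x₁₁ x₁₂ x₂₁ x₂₂ o₁ o₂ i₁ i₂ : ℕ} {V W : Multiset Atom}
    (hV : V = {src x₁₁ x₁₂ o₁, src x₂₁ x₂₂ o₂, snk x₁₁ x₂₁ i₁, snk x₁₂ x₂₂ i₂} + W)
    (hb : Below n V) :
    F V = F ({strand i₁ o₁, strand i₂ o₂} + W) + F ({strand i₁ o₂, strand i₂ o₁} + W) ∧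
      Below n ({strand i₁ o₁, strand i₂ o₂} + W) ∧ Below n ({strand i₁ o₂, strand i₂ o₁} + W) := by
  subst hV
  have hr := Rule.quad (δ₂ := δ₂) (δ₃ := δ₃) x₁₁ x₁₂ x₂₁ x₂₂ o₁ o₂ i₁ i₂
  exact ⟨by simpa [ev, quadWord] using S.rule _ _ _ hr hb,
    hr.below hb (p := (1, {strand i₁ o₁, strand i₂ o₂})) (by simp),
    hr.below hb (p := (1, {strand i₁ o₂, strand i₂ o₁})) (by simp)⟩

/-- The rule `join` absorbs a strand only into the vertex at its outgoing end. To absorb it into the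
source at the other end, join it at the vertex where `o` arrives and then exchange the names `i` and
`o`. -/
theorem join_src {i o b c : ℕ} {V W : Multiset Atom} (hV : V = {strand i o, src i b c} + W)
    (hb : Below n V) : F V = F ({src o b c} + W) ∧ Below n ({src o b c} + W) := by
  subst hV
  have hB : Below n ({src o b c} + W) := by
    refine ⟨hb.1.replace {i} ?_ ?_ (by simp [shape_src]), lt_of_le_of_lt ?_ hb.2⟩
    · simp [strand, src]
    · simp only [strand, src, Multiset.insert_eq_cons, ← Multiset.singleton_add, outs_add,
        outs_singleton]
      abel
    · simp only [Multiset.card_add]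
      exact_mod_cast by simp
  refine ⟨?_, hB⟩
  have ho : o ∈ ins ({strand i o, src i b c} + W) := by
    rw [hb.1.bal]
    simp [strand]
  have hni := hb.1.nodup
  have hno := hb.1.nodup'
  have hio : i ≠ o := by
    rintro rfl
    simp [strand, src] at hno
  -- The vertex at which `o` arrives lies in `W`: the strand receives `i ≠ o`, and the source
  -- receives nothing.
  obtain ⟨⟨I, O⟩, ha, hoa⟩ := mem_ins.1 ho
  have ha' : Atom.mk I O ∈ W := by
    simp only [Multiset.insert_eq_cons, Multiset.cons_add, Multiset.singleton_add,
      Multiset.mem_cons] at ha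
    rcases ha with ha | ha | ha
    · simp [strand] at ha
      simp [ha] at hoa
      exact absurd hoa.symm hio
    · simp [src] at ha
      simp [ha] at hoa
    · exact ha
  obtain ⟨I, rfl⟩ := Multiset.exists_cons_of_mem hoa
  obtain ⟨U, rfl⟩ := Multiset.exists_cons_of_mem ha'
  obtain ⟨h1, h1'⟩ := S.join (i := i) (o := o) (I := I) (O := O) (W := {src i b c} + U)
    (V := {strand i o, src i b c} + (Atom.mk (o ::ₘ I) O) ::ₘ U)
    (by simp only [Multiset.insert_eq_cons, ← Multiset.singleton_add]; abel) hb
  rw [h1, ← S.relabel _ hB (Equiv.swap i o)]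
  simp [strand, src] at hni hno
  have key : ∀ M : Multiset ℕ, i ∉ M → o ∉ M → M.map (Equiv.swap i o) = M := by
    intro M hi ho
    conv_rhs => rw [← Multiset.map_id M]
    refine Multiset.map_congr rfl fun n hn => Equiv.swap_apply_of_ne_of_ne ?_ ?_ <;>
      rintro rfl <;> contradiction
  have h2 : Word.relabel (Equiv.swap i o) U = U := by
    apply relabel_swap_of_notMem (Or.inr ⟨?_, ?_⟩) <;> tauto
  have h3 : relabelAtom (Equiv.swap i o) (Atom.mk (o ::ₘ I) O) = (Atom.mk (i ::ₘ I) O) := by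
    unfold relabelAtom
    rw [key O (by tauto) (by tauto)]
    simp only [Multiset.map_cons, Equiv.swap_apply_right]
    rw [key I (by tauto) (by tauto)]
  have h4 : relabelAtom (Equiv.swap i o) (src o b c) = src i b c := by
    have hb1 : b ≠ i := by tauto
    have hb2 : b ≠ o := by tauto
    have hc1 : c ≠ i := by tauto
    have hc2 : c ≠ o := by tauto
    rw [relabelAtom_src, Equiv.swap_apply_right, Equiv.swap_apply_of_ne_of_ne hb1 hb2,
      Equiv.swap_apply_of_ne_of_ne hc1 hc2]
  rw [relabel_add, relabel_singleton, relabel_cons, h2, h3, h4]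
  congr 1
  simp only [← Multiset.singleton_add]
  abel

end Skein

end Word

/-- Two multisets, for instance words, that are written with the same elements in different orders
agree. -/
theorem Word.perm {α : Type*} {V W : Multiset α}
    (h : V = W := by
      simp only [Word.quadWord, Word.src, Word.snk, Word.strand, Multiset.insert_eq_cons,
        ← Multiset.singleton_add, add_zero, zero_add] <;> ac_rfl) : V = W :=
  h

/-! ### Confluence: disjoint rules, and overlaps with `join` -/

namespace Word

variable {R : Type*} [CommRing R] {δ₂ δ₃ : R} {n : ℕ∞} {F : Multiset Atom → R}

theorem cons_eq_cons_of_ne {a b : Atom} {V W : Multiset Atom} (h : a ::ₘ V = b ::ₘ W) (hab : a ≠ b) :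
    ∃ U, V = b ::ₘ U ∧ W = a ::ₘ U := by
  rcases Multiset.cons_eq_cons.1 h with h | h
  exacts [absurd h.1 hab, h.2]

theorem add_eq_add_of_disjoint {S₁ S₂ W₁ W₂ : Multiset Atom} (h : S₁ + W₁ = S₂ + W₂)
    (hd : Disjoint S₁ S₂) : ∃ U, W₁ = S₂ + U ∧ W₂ = S₁ + U := by
  have hle : S₂ ≤ W₁ := by
    rw [Multiset.le_iff_count]
    intro a
    by_cases ha : a ∈ S₂
    · have h1 : a ∉ S₁ := fun h => Multiset.disjoint_left.1 hd h ha
      have h2 := congrArg (Multiset.count a) h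
      simp only [Multiset.count_add, Multiset.count_eq_zero_of_notMem h1] at h2
      omega
    · simp [Multiset.count_eq_zero_of_notMem ha]
  obtain ⟨U, rfl⟩ := Multiset.le_iff_exists_add.1 hle
  refine ⟨U, rfl, ?_⟩
  have : S₂ + W₂ = S₂ + (S₁ + U) := by rw [← h]; abel
  exact add_left_cancel this

theorem Rule.below_of_card_le {S : Multiset Atom} {L : List (R × Multiset Atom)} (h : Rule δ₂ δ₃ S L) {W : Multiset Atom}
    (hv : Valid (S + W)) (hc : ((S + W).card : ℕ∞) ≤ n) {p : R × Multiset Atom} (hp : p ∈ L) :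
    Below n (p.2 + W) := by
  refine ⟨h.valid hv hp, lt_of_lt_of_le ?_ hc⟩
  have := h.card_lt hp
  simp only [Multiset.card_add]
  exact_mod_cast by omega

/-- Both sides are the same double sum over pairs of terms; this is why disjoint rules commute. -/
theorem ev_ev_comm (L₁ L₂ : List (R × Multiset Atom)) (U : Multiset Atom) :
    (L₁.map fun p => p.1 * ev F L₂ (p.2 + U)).sum =
      (L₂.map fun q => q.1 * ev F L₁ (q.2 + U)).sum := by
  simp only [ev, ← Multiset.sum_coe, ← Multiset.map_coe, ← Multiset.sum_map_mul_left]
  rw [Multiset.sum_map_sum_map]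
  refine congrArg Multiset.sum (Multiset.map_congr rfl fun q _ => ?_)
  refine congrArg Multiset.sum (Multiset.map_congr rfl fun p _ => ?_)
  rw [show q.2 + (p.2 + U) = p.2 + (q.2 + U) by abel]
  ring

namespace Skein

variable (S : Skein δ₂ δ₃ n F)
include S

/-- Rules that are applied to disjoint parts of a word commute. -/
theorem ev_eq_of_disjoint {S₁ S₂ W₁ W₂ : Multiset Atom} {L₁ L₂ : List (R × Multiset Atom)}
    (h₁ : Rule δ₂ δ₃ S₁ L₁) (h₂ : Rule δ₂ δ₃ S₂ L₂) (h : S₁ + W₁ = S₂ + W₂) (hv : Valid (S₁ + W₁))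
    (hc : ((S₁ + W₁).card : ℕ∞) ≤ n) (hd : Disjoint S₁ S₂) : ev F L₁ W₁ = ev F L₂ W₂ := by
  obtain ⟨U, rfl, rfl⟩ := add_eq_add_of_disjoint h hd
  calc ev F L₁ (S₂ + U) = (L₁.map fun p => p.1 * ev F L₂ (p.2 + U)).sum := by
        unfold ev
        refine congrArg List.sum (List.map_congr_left fun p hp => ?_)
        have hb := h₁.below_of_card_le hv hc hp
        have he : p.2 + (S₂ + U) = S₂ + (p.2 + U) := by abel
        rw [he] at hb ⊢
        rw [S.rule _ _ _ h₂ hb, ev]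
    _ = _ := ev_ev_comm _ _ _
    _ = ev F L₂ (S₁ + U) := by
        rw [h] at hv hc
        unfold ev
        refine congrArg List.sum (List.map_congr_left fun p hp => ?_)
        have hb := h₂.below_of_card_le hv hc hp
        have he : p.2 + (S₁ + U) = S₁ + (p.2 + U) := by abel
        rw [he] at hb ⊢
        rw [S.rule _ _ _ h₁ hb, ev]

/-- If the strands overlap, they coincide, follow one another, close up to a circle, or enter the
same vertex. In the last three cases one more `join` or `circle` on each side gives the same result.
-/
theorem join_join {i o i' o' : ℕ} {I O I' O' : Multiset ℕ} {W W' : Multiset Atom}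
    (h : {strand i o, (Atom.mk (o ::ₘ I) O)} + W = {strand i' o', (Atom.mk (o' ::ₘ I') O')} + W')
    (hv : Valid ({strand i o, (Atom.mk (o ::ₘ I) O)} + W))
    (hc : (({strand i o, (Atom.mk (o ::ₘ I) O)} + W : Multiset Atom).card : ℕ∞) ≤ n) :
    F ({Atom.mk (i ::ₘ I) O} + W) = F ({Atom.mk (i' ::ₘ I') O'} + W') := by
  have h₁ := Rule.join (δ₂ := δ₂) (δ₃ := δ₃) i o I O
  have h₂ := Rule.join (δ₂ := δ₂) (δ₃ := δ₃) i' o' I' O'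
  have hb₁ : Below n ({Atom.mk (i ::ₘ I) O} + W) :=
    h₁.below_of_card_le hv hc (p := (1, {Atom.mk (i ::ₘ I) O})) (by simp)
  have hb₂ : Below n ({Atom.mk (i' ::ₘ I') O'} + W') :=
    h₂.below_of_card_le (h ▸ hv) (h ▸ hc) (p := (1, {Atom.mk (i' ::ₘ I') O'})) (by simp)
  have m1 : strand i o ∈ ({strand i o, (Atom.mk (o ::ₘ I) O)} + W : Multiset Atom) := by simp
  have m2 : (Atom.mk (o ::ₘ I) O) ∈ ({strand i o, (Atom.mk (o ::ₘ I) O)} + W : Multiset Atom) := by simp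
  have m3 : strand i' o' ∈ ({strand i o, (Atom.mk (o ::ₘ I) O)} + W : Multiset Atom) := by rw [h]; simp
  have m4 : (Atom.mk (o' ::ₘ I') O') ∈ ({strand i o, (Atom.mk (o ::ₘ I) O)} + W : Multiset Atom) := by rw [h]; simp
  simp only [Multiset.insert_eq_cons, Multiset.cons_add, Multiset.singleton_add] at h
  by_cases hs : strand i o = strand i' o'
  · simp only [strand, Atom.mk.injEq, Multiset.singleton_inj] at hs
    obtain ⟨rfl, rfl⟩ := hs
    have ht := hv.eq_of_mem_in m2 m4 (x := o) (by simp) (by simp)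
    rw [ht, Multiset.cons_inj_right, Multiset.cons_inj_right] at h
    simp only [Atom.mk.injEq, Multiset.cons_inj_right] at ht
    rw [h, ht.1, ht.2]
  have hoo : o ≠ o' := fun hoo => hs (hv.eq_of_mem_out m1 m3 (x := o) (by simp [strand])
    (by simp [strand, hoo]))
  -- The first strand leads into the second one, but the second does not lead back.
  have two : ∀ {i o i' o' : ℕ} {I O I' O' : Multiset ℕ} {W W' : Multiset Atom},
      strand i o ::ₘ (Atom.mk (o ::ₘ I) O) ::ₘ W = strand i' o' ::ₘ (Atom.mk (o' ::ₘ I') O') ::ₘ W' →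
      Below n ({Atom.mk (i ::ₘ I) O} + W) → Below n ({Atom.mk (i' ::ₘ I') O'} + W') →
      (Atom.mk (o ::ₘ I) O) = strand i' o' → (Atom.mk (o' ::ₘ I') O') ≠ strand i o →
      F ({Atom.mk (i ::ₘ I) O} + W) = F ({Atom.mk (i' ::ₘ I') O'} + W') := by
    intro i o i' o' I O I' O' W W' h hb₁ hb₂ ht ht'
    rw [ht, Multiset.cons_swap, Multiset.cons_inj_right] at h
    obtain ⟨U, rfl, rfl⟩ := cons_eq_cons_of_ne h (Ne.symm ht')
    simp only [strand, Atom.mk.injEq, eq_comm (b := ({i'} : Multiset ℕ)),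
      Multiset.singleton_eq_cons_iff] at ht
    obtain ⟨⟨rfl, rfl⟩, rfl⟩ := ht
    rw [(S.join (i := i) (o := o') (I := I') (O := O') (W := U) Word.perm hb₁).1,
      (S.join (i := i) (o := i') (I := I') (O := O') (W := U) Word.perm hb₂).1]
  by_cases ht : (Atom.mk (o ::ₘ I) O) = strand i' o'
  · by_cases ht' : (Atom.mk (o' ::ₘ I') O') = strand i o
    -- Each strand leads into the other one: either joining leaves a circle.
    · rw [ht, ht', Multiset.cons_swap, Multiset.cons_inj_right, Multiset.cons_inj_right] at h
      subst h
      simp only [strand, Atom.mk.injEq, eq_comm (b := ({i'} : Multiset ℕ)),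
        eq_comm (b := ({i} : Multiset ℕ)), Multiset.singleton_eq_cons_iff] at ht ht'
      obtain ⟨⟨rfl, rfl⟩, rfl⟩ := ht
      obtain ⟨⟨rfl, rfl⟩, rfl⟩ := ht'
      rw [(S.circle (W := W) Word.perm hb₁).1, (S.circle (W := W) Word.perm hb₂).1]
    · exact two h hb₁ hb₂ ht ht'
  by_cases ht' : (Atom.mk (o' ::ₘ I') O') = strand i o
  · exact (two h.symm hb₂ hb₁ ht' ht).symm
  by_cases hcc : (Atom.mk (o ::ₘ I) O) = (Atom.mk (o' ::ₘ I') O')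
  -- Two different strands enter the same vertex; on each side the other strand is absorbed as well.
  · rw [hcc, Multiset.cons_swap, Multiset.cons_swap (strand i' o'), Multiset.cons_inj_right] at h
    obtain ⟨U, rfl, rfl⟩ := cons_eq_cons_of_ne h hs
    simp only [Atom.mk.injEq] at hcc
    obtain ⟨hI, rfl⟩ := hcc
    rcases Multiset.cons_eq_cons.1 hI with hI | ⟨-, J, rfl, rfl⟩
    · exact absurd hI.1 hoo
    rw [(S.join (i := i') (o := o') (I := i ::ₘ J) (O := O) (W := U) Word.perm hb₁).1,
      (S.join (i := i) (o := o) (I := i' ::ₘ J) (O := O) (W := U) Word.perm hb₂).1,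
      Multiset.cons_swap]
  · have := S.ev_eq_of_disjoint h₁ h₂ (W₁ := W) (W₂ := W')
      (by simpa using h) hv hc (by
        simp only [Multiset.disjoint_left, Multiset.insert_eq_cons, Multiset.mem_cons,
          Multiset.mem_singleton]
        rintro a (rfl | rfl) (h | h)
        exacts [hs h, ht' h.symm, ht h, hcc h])
    simpa [ev] using this

-- A loop strand is a whole component. As the strand of a `join` its label would arrive twice; as
-- the target of a `join` it would be left on the same label as the strand leading into it, hence
-- equal that strand.
omit S in
theorem disjoint_circle_join {i o j : ℕ} {I O : Multiset ℕ} {W W' : Multiset Atom}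
    (h : {strand j j} + W = {strand i o, (Atom.mk (o ::ₘ I) O)} + W') (hv : Valid ({strand j j} + W)) :
    Disjoint ({strand j j} : Multiset Atom) {strand i o, (Atom.mk (o ::ₘ I) O)} := by
  have key : strand j j ≠ strand i o := by
    intro hs
    simp only [strand, Atom.mk.injEq, Multiset.singleton_inj] at hs
    obtain ⟨rfl, rfl⟩ := hs
    have := (h ▸ hv).nodup
    simp [strand] at this
  simp only [Multiset.disjoint_left, Multiset.insert_eq_cons, Multiset.mem_cons,
    Multiset.mem_singleton]
  rintro a rfl (h1 | h1)
  · exact key h1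
  · refine key (hv.eq_of_mem_out (by simp) (by rw [h]; simp) (x := j) (by simp [strand]) ?_)
    simp only [strand, Atom.mk.injEq] at h1
    have : o ∈ ({j} : Multiset ℕ) := by rw [h1.1]; simp
    simp at this
    simp [strand, this]

/-- A strand can lead into a bigon only at the sink, and only along its third edge, because the two
others start at the source. Both orders of resolution then end with the strand from `i` to `w`. -/
theorem join_bigon {i o x y w z : ℕ} {I O : Multiset ℕ} {W W' : Multiset Atom}
    (h : {strand i o, (Atom.mk (o ::ₘ I) O)} + W = {src x y w, snk x y z} + W')
    (hv : Valid ({strand i o, (Atom.mk (o ::ₘ I) O)} + W))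
    (hc : (({strand i o, (Atom.mk (o ::ₘ I) O)} + W : Multiset Atom).card : ℕ∞) ≤ n) :
    F ({Atom.mk (i ::ₘ I) O} + W) = δ₂ * F ({strand z w} + W') := by
  have h₁ := Rule.join (δ₂ := δ₂) (δ₃ := δ₃) i o I O
  have h₂ := Rule.bigon (δ₂ := δ₂) (δ₃ := δ₃) x y w z
  by_cases hs : (Atom.mk (o ::ₘ I) O) = snk x y z
  · have hb₁ : Below n ({Atom.mk (i ::ₘ I) O} + W) :=
      h₁.below_of_card_le hv hc (p := (1, {Atom.mk (i ::ₘ I) O})) (by simp)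
    have hb₂ : Below n ({strand z w} + W') :=
      h₂.below_of_card_le (h ▸ hv) (h ▸ hc) (p := (δ₂, {strand z w})) (by simp)
    have m1 : strand i o ∈ ({strand i o, (Atom.mk (o ::ₘ I) O)} + W : Multiset Atom) := by simp
    have m2 : src x y w ∈ ({strand i o, (Atom.mk (o ::ₘ I) O)} + W : Multiset Atom) := by rw [h]; simp
    have ne : ∀ u, u ∈ (src x y w).2 → o ≠ u := by
      rintro u hu rfl
      have := hv.eq_of_mem_out m1 m2 (x := o) (by simp [strand]) hu
      simp [strand, src] at this
    simp only [Multiset.insert_eq_cons, Multiset.cons_add, Multiset.singleton_add] at h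
    rw [hs, Multiset.cons_swap, Multiset.cons_swap (src x y w), Multiset.cons_inj_right] at h
    obtain ⟨U, rfl, rfl⟩ := cons_eq_cons_of_ne h (by simp [strand, src])
    simp only [snk, Atom.mk.injEq] at hs
    have hoz : o = z := by
      have : o ∈ ({x, y, z} : Multiset ℕ) := by rw [← hs.1]; simp
      simpa [ne x (by simp [src]), ne y (by simp [src])] using this
    subst hoz
    obtain ⟨hI, rfl⟩ := hs
    have : I = {x, y} := by
      have : ({x, y, o} : Multiset ℕ) = o ::ₘ {x, y} := Word.perm
      rwa [this, Multiset.cons_inj_right] at hI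
    subst this
    rw [(S.bigon (x := x) (y := y) (o := w) (i := i) (W := U) Word.perm hb₁).1,
      (S.join_strand (i := i) (o := o) (b := w) (W := U) Word.perm hb₂).1]
  · have := S.ev_eq_of_disjoint h₁ h₂ (W₁ := W) (W₂ := W') h hv hc (by
        simp only [Multiset.disjoint_left, Multiset.insert_eq_cons, Multiset.mem_cons,
          Multiset.mem_singleton]
        rintro a (rfl | rfl) (h | h)
        · simp [strand, src] at h
        · simp [strand, snk] at h
        · simp [src] at h
        · exact hs h)
    simpa [ev] using this

/-- As for bigons: an overlap means that the strand enters one of the two sinks along its outer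
edge, and it is absorbed afterwards in both terms of the resolution. The case of the second sink
follows by exchanging the names of the sinks. -/
theorem join_quad {i o x₁₁ x₁₂ x₂₁ x₂₂ o₁ o₂ i₁ i₂ : ℕ} {I O : Multiset ℕ} {W W' : Multiset Atom}
    (h : {strand i o, (Atom.mk (o ::ₘ I) O)} + W = quadWord x₁₁ x₁₂ x₂₁ x₂₂ o₁ o₂ i₁ i₂ + W')
    (hv : Valid ({strand i o, (Atom.mk (o ::ₘ I) O)} + W))
    (hc : (({strand i o, (Atom.mk (o ::ₘ I) O)} + W : Multiset Atom).card : ℕ∞) ≤ n) :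
    F ({Atom.mk (i ::ₘ I) O} + W) =
      F ({strand i₁ o₁, strand i₂ o₂} + W') + F ({strand i₁ o₂, strand i₂ o₁} + W') := by
  have h₁ := Rule.join (δ₂ := δ₂) (δ₃ := δ₃) i o I O
  have key : ∀ {x₁₁ x₁₂ x₂₁ x₂₂ o₁ o₂ i₁ i₂ : ℕ},
      {strand i o, (Atom.mk (o ::ₘ I) O)} + W = quadWord x₁₁ x₁₂ x₂₁ x₂₂ o₁ o₂ i₁ i₂ + W' →
      (Atom.mk (o ::ₘ I) O) = snk x₁₁ x₂₁ i₁ → F ({Atom.mk (i ::ₘ I) O} + W) =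
      F ({strand i₁ o₁, strand i₂ o₂} + W') + F ({strand i₁ o₂, strand i₂ o₁} + W') := by
    intro x₁₁ x₁₂ x₂₁ x₂₂ o₁ o₂ i₁ i₂ h hs
    have h₂ := Rule.quad (δ₂ := δ₂) (δ₃ := δ₃) x₁₁ x₁₂ x₂₁ x₂₂ o₁ o₂ i₁ i₂
    have hb₁ : Below n ({Atom.mk (i ::ₘ I) O} + W) :=
      h₁.below_of_card_le hv hc (p := (1, {Atom.mk (i ::ₘ I) O})) (by simp)
    have hb₂ : Below n ({strand i₁ o₁, strand i₂ o₂} + W') :=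
      h₂.below_of_card_le (h ▸ hv) (h ▸ hc) (p := (1, {strand i₁ o₁, strand i₂ o₂})) (by simp)
    have hb₃ : Below n ({strand i₁ o₂, strand i₂ o₁} + W') :=
      h₂.below_of_card_le (h ▸ hv) (h ▸ hc) (p := (1, {strand i₁ o₂, strand i₂ o₁})) (by simp)
    have m1 : strand i o ∈ ({strand i o, (Atom.mk (o ::ₘ I) O)} + W : Multiset Atom) := by simp
    have m2 : src x₁₁ x₁₂ o₁ ∈ ({strand i o, (Atom.mk (o ::ₘ I) O)} + W : Multiset Atom) := by rw [h]; simp [quadWord]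
    have m3 : src x₂₁ x₂₂ o₂ ∈ ({strand i o, (Atom.mk (o ::ₘ I) O)} + W : Multiset Atom) := by rw [h]; simp [quadWord]
    have ne : o ≠ x₁₁ := by
      rintro rfl
      have := hv.eq_of_mem_out m1 m2 (x := o) (by simp [strand]) (by simp [src])
      simp [strand, src] at this
    have ne' : o ≠ x₂₁ := by
      rintro rfl
      have := hv.eq_of_mem_out m1 m3 (x := o) (by simp [strand]) (by simp [src])
      simp [strand, src] at this
    have h' : snk x₁₁ x₂₁ i₁ ::ₘ strand i o ::ₘ W = snk x₁₁ x₂₁ i₁ ::ₘ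
        ({src x₁₁ x₁₂ o₁, src x₂₁ x₂₂ o₂, snk x₁₂ x₂₂ i₂} + W') := by
      rw [hs] at h
      calc _ = {strand i o, snk x₁₁ x₂₁ i₁} + W := Word.perm
        _ = _ := h
        _ = _ := Word.perm
    rw [Multiset.cons_inj_right] at h'
    obtain ⟨U, rfl, rfl⟩ : ∃ U, W = {src x₁₁ x₁₂ o₁, src x₂₁ x₂₂ o₂, snk x₁₂ x₂₂ i₂} + U ∧
        W' = {strand i o} + U := by
      refine add_eq_add_of_disjoint (S₁ := {strand i o}) (by simpa using h') ?_
      simp [strand, src, snk]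
    simp only [snk, Atom.mk.injEq] at hs
    have hoz : o = i₁ := by
      have : o ∈ ({x₁₁, x₂₁, i₁} : Multiset ℕ) := by rw [← hs.1]; simp
      simpa [ne, ne'] using this
    subst hoz
    obtain ⟨hI, rfl⟩ := hs
    have : I = {x₁₁, x₂₁} := by
      have : ({x₁₁, x₂₁, o} : Multiset ℕ) = o ::ₘ {x₁₁, x₂₁} := Word.perm
      rwa [this, Multiset.cons_inj_right] at hI
    subst this
    rw [(S.quad (x₁₁ := x₁₁) (x₁₂ := x₁₂) (x₂₁ := x₂₁) (x₂₂ := x₂₂) (o₁ := o₁) (o₂ := o₂)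
        (i₁ := i) (i₂ := i₂) (W := U) Word.perm hb₁).1,
      (S.join_strand (i := i) (o := o) (b := o₁) (W := {strand i₂ o₂} + U) Word.perm hb₂).1,
      (S.join_strand (i := i) (o := o) (b := o₂) (W := {strand i₂ o₁} + U) Word.perm hb₃).1]
    congr 2 <;> exact Word.perm
  by_cases hs : (Atom.mk (o ::ₘ I) O) = snk x₁₁ x₂₁ i₁
  · exact key h hs
  by_cases hs' : (Atom.mk (o ::ₘ I) O) = snk x₁₂ x₂₂ i₂
  · have := key (x₁₁ := x₁₂) (x₁₂ := x₁₁) (x₂₁ := x₂₂) (x₂₂ := x₂₁) (o₁ := o₁) (o₂ := o₂)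
      (i₁ := i₂) (i₂ := i₁) (h.trans Word.perm) hs'
    rw [this, add_comm]
    congr 2 <;> exact congrArg (· + W') Word.perm
  have h₂ := Rule.quad (δ₂ := δ₂) (δ₃ := δ₃) x₁₁ x₁₂ x₂₁ x₂₂ o₁ o₂ i₁ i₂
  have := S.ev_eq_of_disjoint h₁ h₂ (W₁ := W) (W₂ := W') h hv hc (by
        simp only [quadWord, Multiset.disjoint_left, Multiset.insert_eq_cons, Multiset.mem_cons,
          Multiset.mem_singleton]
        rintro a (rfl | rfl) (h | h | h | h)
        · simp [strand, src] at h
        · simp [strand, src] at h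
        · simp [strand, snk] at h
        · simp [strand, snk] at h
        · simp [src] at h
        · simp [src] at h
        · exact hs h
        · exact hs' h)
  simpa [ev] using this

end Skein

end Word

/-! ### Confluence: overlaps with bigons -/

namespace Word

variable {R : Type*} [CommRing R] {δ₂ δ₃ : R} {n : ℕ∞} {F : Multiset Atom → R}

theorem eq_or_eq_of_triple {a b b' c c' : ℕ} (h : ({a, b, c} : Multiset ℕ) = {a, b', c'}) :
    b = b' ∧ c = c' ∨ b = c' ∧ c = b' := by
  have h' : ({b, c} : Multiset ℕ) = {b', c'} := by
    simpa [Multiset.insert_eq_cons] using h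
  simp only [Multiset.insert_eq_cons, Multiset.cons_eq_cons, Multiset.singleton_inj] at h'
  rcases h' with h' | ⟨-, cs, h1, h2⟩
  · exact Or.inl h'
  · rw [Multiset.singleton_eq_cons_iff] at h1 h2
    exact Or.inr ⟨h2.1.symm, h1.1⟩

/-- Two pairs in a set of three labels meet. Contrapositively, bigons and quadrilaterals without a
common side have no common vertex, so that their rules are disjoint. -/
theorem overlap_of_triple_eq {a b c a' b' c' : ℕ} (h : ({a, b, c} : Multiset ℕ) = {a', b', c'})
    (hab : a ≠ b) : a = a' ∨ a = b' ∨ b = a' ∨ b = b' := by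
  have ha : a ∈ ({a', b', c'} : Multiset ℕ) := by rw [← h]; simp
  have hb : b ∈ ({a', b', c'} : Multiset ℕ) := by rw [← h]; simp
  simp only [Multiset.insert_eq_cons, Multiset.mem_cons, Multiset.mem_singleton] at ha hb
  rcases ha with h1 | h1 | rfl <;> rcases hb with h2 | h2 | rfl <;> tauto

namespace Skein

variable (S : Skein δ₂ δ₃ n F)
include S

/-- Two bigons with a common vertex share an edge there, hence both vertices. Either the third edges
agree, and so do the results, or the two vertices are joined by three edges and both results are a
circle. -/
theorem bigon_bigon {x y w z x' y' w' z' : ℕ} {W W' : Multiset Atom}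
    (h : {src x y w, snk x y z} + W = {src x' y' w', snk x' y' z'} + W')
    (hv : Valid ({src x y w, snk x y z} + W))
    (hc : (({src x y w, snk x y z} + W : Multiset Atom).card : ℕ∞) ≤ n) :
    δ₂ * F ({strand z w} + W) = δ₂ * F ({strand z' w'} + W') := by
  have h₁ := Rule.bigon (δ₂ := δ₂) (δ₃ := δ₃) x y w z
  have h₂ := Rule.bigon (δ₂ := δ₂) (δ₃ := δ₃) x' y' w' z'
  have hb₁ : Below n ({strand z w} + W) :=
    h₁.below_of_card_le hv hc (p := (δ₂, {strand z w})) (by simp)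
  have hb₂ : Below n ({strand z' w'} + W') :=
    h₂.below_of_card_le (h ▸ hv) (h ▸ hc) (p := (δ₂, {strand z' w'})) (by simp)
  have m1 : src x y w ∈ ({src x y w, snk x y z} + W : Multiset Atom) := by simp
  have m2 : snk x y z ∈ ({src x y w, snk x y z} + W : Multiset Atom) := by simp
  have m3 : src x' y' w' ∈ ({src x y w, snk x y z} + W : Multiset Atom) := by rw [h]; simp
  have m4 : snk x' y' z' ∈ ({src x y w, snk x y z} + W : Multiset Atom) := by rw [h]; simp
  by_cases hd : src x y w = src x' y' w' ∨ snk x y z = snk x' y' z'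
  · have both : src x y w = src x' y' w' ∧ snk x y z = snk x' y' z' := by
      have hni := hv.nodup
      have hno := hv.nodup'
      simp [src, snk] at hni hno
      rcases hd with hd | hd
      · refine ⟨hd, ?_⟩
        have hd' : ({x, y, w} : Multiset ℕ) = {x', y', w'} := by simpa [src] using hd
        have hx : x ∈ ({x', y', w'} : Multiset ℕ) := by rw [← hd']; simp
        have hy : y ∈ ({x', y', w'} : Multiset ℕ) := by rw [← hd']; simp
        simp only [Multiset.insert_eq_cons, Multiset.mem_cons, Multiset.mem_singleton] at hx hy
        rcases hx with hx | hx | hx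
        · exact hv.eq_of_mem_in m2 m4 (x := x) (by simp [snk]) (by simp [snk, hx])
        · exact hv.eq_of_mem_in m2 m4 (x := x) (by simp [snk]) (by simp [snk, hx])
        rcases hy with hy | hy | hy
        · exact hv.eq_of_mem_in m2 m4 (x := y) (by simp [snk]) (by simp [snk, hy])
        · exact hv.eq_of_mem_in m2 m4 (x := y) (by simp [snk]) (by simp [snk, hy])
        · exact absurd (hx.trans hy.symm) (by tauto)
      · refine ⟨?_, hd⟩
        have hd' : ({x, y, z} : Multiset ℕ) = {x', y', z'} := by simpa [snk] using hd
        have hx : x ∈ ({x', y', z'} : Multiset ℕ) := by rw [← hd']; simp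
        have hy : y ∈ ({x', y', z'} : Multiset ℕ) := by rw [← hd']; simp
        simp only [Multiset.insert_eq_cons, Multiset.mem_cons, Multiset.mem_singleton] at hx hy
        rcases hx with hx | hx | hx
        · exact hv.eq_of_mem_out m1 m3 (x := x) (by simp [src]) (by simp [src, hx])
        · exact hv.eq_of_mem_out m1 m3 (x := x) (by simp [src]) (by simp [src, hx])
        rcases hy with hy | hy | hy
        · exact hv.eq_of_mem_out m1 m3 (x := y) (by simp [src]) (by simp [src, hy])
        · exact hv.eq_of_mem_out m1 m3 (x := y) (by simp [src]) (by simp [src, hy])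
        · exact absurd (hx.trans hy.symm) (by tauto)
    rw [both.1, both.2] at h
    have hW := add_left_cancel h
    subst hW
    have hni := hv.nodup
    have hno := hv.nodup'
    simp [src, snk] at hni hno
    have h1 : ({x, y, w} : Multiset ℕ) = {x', y', w'} := by simpa [src] using both.1
    have h2 : ({x, y, z} : Multiset ℕ) = {x', y', z'} := by simpa [snk] using both.2
    by_cases hww : w = w'
    · subst hww
      have h3 : ({x, y} : Multiset ℕ) = {x', y'} := by
        have : w ::ₘ {x, y} = w ::ₘ ({x', y'} : Multiset ℕ) := by
          calc _ = ({x, y, w} : Multiset ℕ) := Word.perm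
            _ = _ := h1
            _ = _ := Word.perm
        rwa [Multiset.cons_inj_right] at this
      have h4 : ({x, y} : Multiset ℕ) + {z} = {x, y} + {z'} := by
        calc _ = ({x, y, z} : Multiset ℕ) := Word.perm
          _ = {x', y', z'} := h2
          _ = {x', y'} + {z'} := Word.perm
          _ = _ := by rw [h3]
      have h5 := Multiset.singleton_inj.1 (add_left_cancel h4)
      rw [h5]
    -- Different pairs of edges were chosen: the edge left over by one choice is a side for the
    -- other one, so it also arrives at the sink.
    · have hw' : w' ∈ ({x, y, w} : Multiset ℕ) := by rw [h1]; simp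
      have hw : w ∈ ({x', y', w'} : Multiset ℕ) := by rw [← h1]; simp
      have hwz : w ∈ ({x, y, z} : Multiset ℕ) := by
        rw [h2]
        simp [hww] at hw
        rcases hw with hw | hw <;> simp [hw]
      have hwz : w = z := by
        simp only [Multiset.insert_eq_cons, Multiset.mem_cons, Multiset.mem_singleton] at hwz
        rcases hwz with rfl | rfl | h <;> tauto
      have hwz' : w' ∈ ({x', y', z'} : Multiset ℕ) := by
        rw [← h2]
        simp [Ne.symm hww] at hw'
        rcases hw' with hw | hw <;> simp [hw]
      have hwz' : w' = z' := by
        rw [both.1, both.2] at hv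
        have hno' := hv.nodup'
        simp [src] at hno'
        simp only [Multiset.insert_eq_cons, Multiset.mem_cons, Multiset.mem_singleton] at hwz'
        rcases hwz' with rfl | rfl | h7 <;> tauto
      rw [← hwz] at hb₁ ⊢
      rw [← hwz'] at hb₂ ⊢
      rw [(S.circle (W := W) Word.perm hb₁).1, (S.circle (W := W) Word.perm hb₂).1]
  · push Not at hd
    have := S.ev_eq_of_disjoint h₁ h₂ (W₁ := W) (W₂ := W') h hv hc (by
        simp only [Multiset.disjoint_left, Multiset.insert_eq_cons, Multiset.mem_cons,
          Multiset.mem_singleton]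
        rintro a (rfl | rfl) (h | h)
        · exact hd.1 h
        · simp [src, snk] at h
        · simp [src, snk] at h
        · exact hd.2 h)
    simpa [ev] using this

/-- The second edge `y` of the bigon doubles the side `x`, so `y = o₁ = i₁`. Resolving the bigon
creates another bigon, which gives δ₂². The two resolutions of the quadrilateral give a circle
beside a strand, and the strand alone, hence δ₃ + 1. This is the only place where local confluence
restricts the parameters. -/
theorem bigon_quad_of_eq (hδ : δ₂ * δ₂ = δ₃ + 1) {y w z x x₁₂ x₂₁ x₂₂ o₁ o₂ i₁ i₂ : ℕ}
    {W W' : Multiset Atom}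
    (h : {src x y w, snk x y z} + W = quadWord x x₁₂ x₂₁ x₂₂ o₁ o₂ i₁ i₂ + W')
    (hv : Valid ({src x y w, snk x y z} + W))
    (hc : (({src x y w, snk x y z} + W : Multiset Atom).card : ℕ∞) ≤ n) :
    δ₂ * F ({strand z w} + W) =
      F ({strand i₁ o₁, strand i₂ o₂} + W') + F ({strand i₁ o₂, strand i₂ o₁} + W') := by
  have h₁ := Rule.bigon (δ₂ := δ₂) (δ₃ := δ₃) x y w z
  have h₂ := Rule.quad (δ₂ := δ₂) (δ₃ := δ₃) x x₁₂ x₂₁ x₂₂ o₁ o₂ i₁ i₂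
  have hb₁ : Below n ({strand z w} + W) :=
    h₁.below_of_card_le hv hc (p := (δ₂, {strand z w})) (by simp)
  have hb₂ : Below n ({strand i₁ o₁, strand i₂ o₂} + W') :=
    h₂.below_of_card_le (h ▸ hv) (h ▸ hc) (p := (1, {strand i₁ o₁, strand i₂ o₂})) (by simp)
  have hb₃ : Below n ({strand i₁ o₂, strand i₂ o₁} + W') :=
    h₂.below_of_card_le (h ▸ hv) (h ▸ hc) (p := (1, {strand i₁ o₂, strand i₂ o₁})) (by simp)
  have m1 : src x y w ∈ ({src x y w, snk x y z} + W : Multiset Atom) := by simp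
  have m2 : snk x y z ∈ ({src x y w, snk x y z} + W : Multiset Atom) := by simp
  have m3 : src x x₁₂ o₁ ∈ ({src x y w, snk x y z} + W : Multiset Atom) := by
    rw [h]; simp [quadWord]
  have m4 : snk x x₂₁ i₁ ∈ ({src x y w, snk x y z} + W : Multiset Atom) := by
    rw [h]; simp [quadWord]
  have m5 : snk x₁₂ x₂₂ i₂ ∈ ({src x y w, snk x y z} + W : Multiset Atom) := by
    rw [h]; simp [quadWord]
  have e1 := hv.eq_of_mem_out m1 m3 (x := x) (by simp [src]) (by simp [src])
  have e2 := hv.eq_of_mem_in m2 m4 (x := x) (by simp [snk]) (by simp [snk])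
  have hni := (h ▸ hv).nodup
  have hno := (h ▸ hv).nodup'
  simp [src, snk, quadWord] at hni hno
  have e1' : ({x, y, w} : Multiset ℕ) = {x, x₁₂, o₁} := by simpa [src] using e1
  have e2' : ({x, y, z} : Multiset ℕ) = {x, x₂₁, i₁} := by simpa [snk] using e2
  have hW : W = {src x₂₁ x₂₂ o₂, snk x₁₂ x₂₂ i₂} + W' := by
    rw [e1, e2] at h
    refine add_left_cancel (a := {src x x₁₂ o₁, snk x x₂₁ i₁}) ?_
    exact h.trans Word.perm
  subst hW
  obtain ⟨rfl, rfl⟩ | ⟨rfl, rfl⟩ := eq_or_eq_of_triple e1'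
  -- If `y` were the adjacent side at the source, it would arrive at both sinks, which are
  -- different.
  · exfalso
    have := hv.eq_of_mem_in m2 m5 (x := y) (by simp [snk]) (by simp [snk])
    have hx : x ∈ ({y, x₂₂, i₂} : Multiset ℕ) := by
      have : ({x, y, z} : Multiset ℕ) = {y, x₂₂, i₂} := by simpa [snk] using this
      rw [← this]; simp
    simp at hx
    tauto
  obtain ⟨rfl, rfl⟩ | ⟨rfl, rfl⟩ := eq_or_eq_of_triple e2'
  -- If `y` were the adjacent side at the sink, it would start at both sources.
  · tauto
  rw [(S.circle (i := y) (W := {strand i₂ o₂} + W') Word.perm hb₂).1,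
    (S.join_strand (i := i₂) (o := y) (b := o₂) (W := W') Word.perm hb₃).1]
  obtain ⟨h6, hb₄⟩ := S.join_src (i := z) (o := w) (b := x₂₂) (c := o₂)
    (W := {snk w x₂₂ i₂} + W') Word.perm hb₁
  rw [h6, (S.bigon (x := w) (y := x₂₂) (o := o₂) (i := i₂) (W := W') Word.perm hb₄).1]
  linear_combination (F ({strand i₂ o₂} + W')) * hδ

omit S in
theorem quadWord_swap_sinks (x₁₁ x₁₂ x₂₁ x₂₂ o₁ o₂ i₁ i₂ : ℕ) :
    quadWord x₁₂ x₁₁ x₂₂ x₂₁ o₁ o₂ i₂ i₁ = quadWord x₁₁ x₁₂ x₂₁ x₂₂ o₁ o₂ i₁ i₂ := Word.perm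

omit S in
theorem quadWord_swap_sources (x₁₁ x₁₂ x₂₁ x₂₂ o₁ o₂ i₁ i₂ : ℕ) :
    quadWord x₂₁ x₂₂ x₁₁ x₁₂ o₂ o₁ i₁ i₂ = quadWord x₁₁ x₁₂ x₂₁ x₂₂ o₁ o₂ i₁ i₂ := Word.perm

end Skein

/-- The value of the resolution of a quadrilateral. -/
def quadValue (F : Multiset Atom → R) (o₁ o₂ i₁ i₂ : ℕ) (W : Multiset Atom) : R :=
  F ({strand i₁ o₁, strand i₂ o₂} + W) + F ({strand i₁ o₂, strand i₂ o₁} + W)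

theorem quadValue_swap_sinks (o₁ o₂ i₁ i₂ : ℕ) (W : Multiset Atom) :
    quadValue F o₁ o₂ i₂ i₁ W = quadValue F o₁ o₂ i₁ i₂ W := by
  unfold quadValue
  rw [add_comm, Multiset.pair_comm (strand i₂ o₂), Multiset.pair_comm (strand i₂ o₁)]

theorem quadValue_swap_sources (o₁ o₂ i₁ i₂ : ℕ) (W : Multiset Atom) :
    quadValue F o₂ o₁ i₁ i₂ W = quadValue F o₁ o₂ i₁ i₂ W := by
  unfold quadValue
  rw [add_comm]

/-- Up to the symmetries of the quadrilateral, any of its sides may be assumed to be the first. -/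
theorem quadWord_first_side {x x₁₁ x₁₂ x₂₁ x₂₂ o₁ o₂ i₁ i₂ : ℕ}
    (hx : x = x₁₁ ∨ x = x₁₂ ∨ x = x₂₁ ∨ x = x₂₂) : ∃ y₁₂ y₂₁ y₂₂ p₁ p₂ j₁ j₂,
      quadWord x₁₁ x₁₂ x₂₁ x₂₂ o₁ o₂ i₁ i₂ = quadWord x y₁₂ y₂₁ y₂₂ p₁ p₂ j₁ j₂ ∧
      ∀ F : Multiset Atom → R, quadValue F o₁ o₂ i₁ i₂ = quadValue F p₁ p₂ j₁ j₂ := by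
  rcases hx with rfl | rfl | rfl | rfl
  · exact ⟨_, _, _, _, _, _, _, rfl, fun F => rfl⟩
  · exact ⟨_, _, _, _, _, _, _, (Skein.quadWord_swap_sinks _ _ _ _ _ _ _ _).symm,
      fun F => funext fun W => (quadValue_swap_sinks _ _ _ _ _).symm⟩
  · exact ⟨_, _, _, _, _, _, _, (Skein.quadWord_swap_sources _ _ _ _ _ _ _ _).symm,
      fun F => funext fun W => (quadValue_swap_sources _ _ _ _ _).symm⟩
  · exact ⟨_, _, _, _, _, _, _, (Skein.quadWord_swap_sources _ _ _ _ _ _ _ _).symm.trans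
      (Skein.quadWord_swap_sinks _ _ _ _ _ _ _ _).symm,
      fun F => funext fun W => (quadValue_swap_sources _ _ _ _ _).symm.trans
        (quadValue_swap_sinks _ _ _ _ _).symm⟩

namespace Skein

variable (S : Skein δ₂ δ₃ n F)
include S

theorem bigon_quad (hδ : δ₂ * δ₂ = δ₃ + 1) {x y w z x₁₁ x₁₂ x₂₁ x₂₂ o₁ o₂ i₁ i₂ : ℕ}
    {W W' : Multiset Atom}
    (h : {src x y w, snk x y z} + W = quadWord x₁₁ x₁₂ x₂₁ x₂₂ o₁ o₂ i₁ i₂ + W')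
    (hv : Valid ({src x y w, snk x y z} + W))
    (hc : (({src x y w, snk x y z} + W : Multiset Atom).card : ℕ∞) ≤ n) :
    δ₂ * F ({strand z w} + W) = quadValue F o₁ o₂ i₁ i₂ W' := by
  have h₁ := Rule.bigon (δ₂ := δ₂) (δ₃ := δ₃) x y w z
  have h₂ := Rule.quad (δ₂ := δ₂) (δ₃ := δ₃) x₁₁ x₁₂ x₂₁ x₂₂ o₁ o₂ i₁ i₂
  by_cases hx : x = x₁₁ ∨ x = x₁₂ ∨ x = x₂₁ ∨ x = x₂₂
  · obtain ⟨y₁₂, y₂₁, y₂₂, p₁, p₂, j₁, j₂, hq, hq'⟩ :=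
      quadWord_first_side (R := R) (o₁ := o₁) (o₂ := o₂) (i₁ := i₁) (i₂ := i₂) hx
    rw [hq] at h
    rw [hq' F]
    exact S.bigon_quad_of_eq hδ h hv hc
  by_cases hy : y = x₁₁ ∨ y = x₁₂ ∨ y = x₂₁ ∨ y = x₂₂
  · obtain ⟨y₁₂, y₂₁, y₂₂, p₁, p₂, j₁, j₂, hq, hq'⟩ :=
      quadWord_first_side (R := R) (o₁ := o₁) (o₂ := o₂) (i₁ := i₁) (i₂ := i₂) hy
    have hxy : ({src x y w, snk x y z} : Multiset Atom) = {src y x w, snk y x z} := Word.perm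
    rw [hxy] at h hv hc
    rw [hq] at h
    rw [hq' F]
    exact S.bigon_quad_of_eq hδ h hv hc
  have hxy : x ≠ y := by
    have := hv.nodup
    simp [src, snk] at this
    tauto
  have := S.ev_eq_of_disjoint h₁ h₂ (W₁ := W) (W₂ := W') h hv hc (by
    simp only [quadWord, Multiset.disjoint_left, Multiset.insert_eq_cons, Multiset.mem_cons,
      Multiset.mem_singleton]
    rintro a (rfl | rfl) (h | h | h | h)
    · have := overlap_of_triple_eq (by simpa [src] using h) hxy; tauto
    · have := overlap_of_triple_eq (by simpa [src] using h) hxy; tauto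
    · simp [src, snk] at h
    · simp [src, snk] at h
    · simp [src, snk] at h
    · simp [src, snk] at h
    · have := overlap_of_triple_eq (by simpa [snk] using h) hxy; tauto
    · have := overlap_of_triple_eq (by simpa [snk] using h) hxy; tauto)
  simpa [ev, quadValue] using this

end Skein
end Word

/-! ### Confluence: two quadrilaterals -/

namespace Word

variable {R : Type*} [CommRing R] {δ₂ δ₃ : R} {n : ℕ∞} {F : Multiset Atom → R}

namespace Skein

variable (S : Skein δ₂ δ₃ n F)
include S

/-- The resolution of a quadrilateral one of whose sides is parallel to another edge. -/
theorem quadValue_self {o i c : ℕ} {W : Multiset Atom} (h₁ : Below n ({strand i o, strand c c} + W))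
    (h₂ : Below n ({strand i c, strand c o} + W)) :
    quadValue F o c i c W = (δ₃ + 1) * F ({strand i o} + W) := by
  unfold quadValue
  rw [(S.circle (i := c) (W := {strand i o} + W) Word.perm h₁).1,
    (S.join_strand (i := i) (o := c) (b := o) (W := W) Word.perm h₂).1]
  ring

/-- Both quadrilaterals contain the two ends of the side `x`. At each end the second quadrilateral
continues either along the same edge as the first one or along the third edge; this makes four
cases. In each of them the value is either visibly the same or an expression symmetric in the two
quadrilaterals. -/
theorem quad_quad_of_eq {x x₁₂ x₂₁ x₂₂ o₁ o₂ i₁ i₂ y₁₂ y₂₁ y₂₂ p₁ p₂ j₁ j₂ : ℕ}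
    {W W' : Multiset Atom}
    (h : quadWord x x₁₂ x₂₁ x₂₂ o₁ o₂ i₁ i₂ + W = quadWord x y₁₂ y₂₁ y₂₂ p₁ p₂ j₁ j₂ + W')
    (hv : Valid (quadWord x x₁₂ x₂₁ x₂₂ o₁ o₂ i₁ i₂ + W))
    (hc : ((quadWord x x₁₂ x₂₁ x₂₂ o₁ o₂ i₁ i₂ + W).card : ℕ∞) ≤ n) :
    quadValue F o₁ o₂ i₁ i₂ W = quadValue F p₁ p₂ j₁ j₂ W' := by
  have h₁ := Rule.quad (δ₂ := δ₂) (δ₃ := δ₃) x x₁₂ x₂₁ x₂₂ o₁ o₂ i₁ i₂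
  have h₂ := Rule.quad (δ₂ := δ₂) (δ₃ := δ₃) x y₁₂ y₂₁ y₂₂ p₁ p₂ j₁ j₂
  have hb₁ : Below n ({strand i₁ o₁, strand i₂ o₂} + W) :=
    h₁.below_of_card_le hv hc (p := (1, {strand i₁ o₁, strand i₂ o₂})) (by simp)
  have hb₂ : Below n ({strand i₁ o₂, strand i₂ o₁} + W) :=
    h₁.below_of_card_le hv hc (p := (1, {strand i₁ o₂, strand i₂ o₁})) (by simp)
  have hb₃ : Below n ({strand j₁ p₁, strand j₂ p₂} + W') :=
    h₂.below_of_card_le (h ▸ hv) (h ▸ hc) (p := (1, {strand j₁ p₁, strand j₂ p₂})) (by simp)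
  have hb₄ : Below n ({strand j₁ p₂, strand j₂ p₁} + W') :=
    h₂.below_of_card_le (h ▸ hv) (h ▸ hc) (p := (1, {strand j₁ p₂, strand j₂ p₁})) (by simp)
  have hni := hv.nodup
  have hno := hv.nodup'
  have hni' := (h ▸ hv).nodup
  have hno' := (h ▸ hv).nodup'
  have m1 : src x x₁₂ o₁ ∈ quadWord x x₁₂ x₂₁ x₂₂ o₁ o₂ i₁ i₂ + W := by simp [quadWord]
  have m2 : src x₂₁ x₂₂ o₂ ∈ quadWord x x₁₂ x₂₁ x₂₂ o₁ o₂ i₁ i₂ + W := by simp [quadWord]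
  have m3 : snk x x₂₁ i₁ ∈ quadWord x x₁₂ x₂₁ x₂₂ o₁ o₂ i₁ i₂ + W := by simp [quadWord]
  have m4 : snk x₁₂ x₂₂ i₂ ∈ quadWord x x₁₂ x₂₁ x₂₂ o₁ o₂ i₁ i₂ + W := by simp [quadWord]
  have m5 : src x y₁₂ p₁ ∈ quadWord x x₁₂ x₂₁ x₂₂ o₁ o₂ i₁ i₂ + W := by rw [h]; simp [quadWord]
  have m6 : src y₂₁ y₂₂ p₂ ∈ quadWord x x₁₂ x₂₁ x₂₂ o₁ o₂ i₁ i₂ + W := by rw [h]; simp [quadWord]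
  have m7 : snk x y₂₁ j₁ ∈ quadWord x x₁₂ x₂₁ x₂₂ o₁ o₂ i₁ i₂ + W := by rw [h]; simp [quadWord]
  have m8 : snk y₁₂ y₂₂ j₂ ∈ quadWord x x₁₂ x₂₁ x₂₂ o₁ o₂ i₁ i₂ + W := by rw [h]; simp [quadWord]
  have inj_src : ∀ {a b c a' b' c' : ℕ}, src a b c = src a' b' c' →
      ({a, b, c} : Multiset ℕ) = {a', b', c'} := fun h => by simpa [src] using h
  have inj_snk : ∀ {a b c a' b' c' : ℕ}, snk a b c = snk a' b' c' →
      ({a, b, c} : Multiset ℕ) = {a', b', c'} := fun h => by simpa [snk] using h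
  have mid : ∀ {a b c a' c' : ℕ}, ({a, b, c} : Multiset ℕ) = {a', b, c'} →
      a = a' ∧ c = c' ∨ a = c' ∧ c = a' := by
    intro a b c a' c' h
    have : ({b, a, c} : Multiset ℕ) = {b, a', c'} := by
      simpa only [Multiset.insert_eq_cons, Multiset.cons_swap b] using h
    exact eq_or_eq_of_triple this
  have e1 := hv.eq_of_mem_out m1 m5 (x := x) (by simp [src]) (by simp [src])
  have e2 := hv.eq_of_mem_in m3 m7 (x := x) (by simp [snk]) (by simp [snk])
  have same : src x₂₁ x₂₂ o₂ = src y₂₁ y₂₂ p₂ → snk x₁₂ x₂₂ i₂ = snk y₁₂ y₂₂ j₂ → W = W' := by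
    intro e3 e4
    unfold quadWord at h
    rw [e1, e2, e3, e4] at h
    exact add_left_cancel h
  obtain ⟨rfl, rfl⟩ | ⟨rfl, rfl⟩ := eq_or_eq_of_triple (inj_src e1) <;>
    obtain ⟨rfl, rfl⟩ | ⟨rfl, rfl⟩ := eq_or_eq_of_triple (inj_snk e2)
  -- The same continuation at both ends: three common sides, hence the same four vertices.
  · have e3 := hv.eq_of_mem_out m2 m6 (x := x₂₁) (by simp [src]) (by simp [src])
    have e4 := hv.eq_of_mem_in m4 m8 (x := x₁₂) (by simp [snk]) (by simp [snk])
    obtain rfl := same e3 e4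
    obtain ⟨rfl, rfl⟩ | ⟨rfl, rfl⟩ := eq_or_eq_of_triple (inj_src e3) <;>
      obtain ⟨h5, h6⟩ | ⟨h5, h6⟩ := eq_or_eq_of_triple (inj_snk e4)
    · rw [h6]
    · rw [h6, h5]
    · rw [h6, h5]
    -- The fourth sides are two parallel edges; each choice gives (δ₃ + 1) times the remaining
    -- strand.
    · subst h5 h6
      rw [S.quadValue_self hb₁ hb₂, S.quadValue_self hb₃ hb₄]
  -- The quadrilaterals agree at the source of `x` and separate at its sink; both sinks are common.
  · have e4 := hv.eq_of_mem_in m4 m8 (x := x₁₂) (by simp [snk]) (by simp [snk])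
    obtain ⟨rfl, rfl⟩ | ⟨rfl, rfl⟩ := eq_or_eq_of_triple (inj_snk e4)
    · have e3 := hv.eq_of_mem_out m2 m6 (x := x₂₂) (by simp [src]) (by simp [src])
      obtain rfl := same e3 e4
      obtain ⟨h5, h6⟩ | ⟨rfl, rfl⟩ := mid (inj_src e3)
      · rw [h6, h5]
      · rw [← quadValue_swap_sinks, ← quadValue_swap_sinks (F := F) o₁ x₂₁]
        rw [S.quadValue_self (Multiset.pair_comm _ _ ▸ hb₂) (Multiset.pair_comm _ _ ▸ hb₁), S.quadValue_self (Multiset.pair_comm _ _ ▸ hb₄) (Multiset.pair_comm _ _ ▸ hb₃)]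
    -- The two sinks are joined to three sources (K₂,₃). Every resolution of either quadrilateral
    -- leaves one source with the outer edges `o₁`, `o₂`, `p₂`, so both values are twice that word.
    · by_cases e3 : src x₂₁ x₂₂ o₂ = src i₁ i₂ p₂
      · exfalso
        simp [quadWord, src, snk] at hni
        have h5 : i₁ ∈ ({x₂₁, x₂₂, o₂} : Multiset ℕ) := by rw [inj_src e3]; simp
        have h6 : i₂ ∈ ({x₂₁, x₂₂, o₂} : Multiset ℕ) := by rw [inj_src e3]; simp
        simp only [Multiset.insert_eq_cons, Multiset.mem_cons, Multiset.mem_singleton] at h5 h6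
        rcases h5 with rfl | rfl | rfl <;> rcases h6 with rfl | rfl | rfl <;> grind
      obtain ⟨U, rfl, rfl⟩ : ∃ U, W = {src i₁ i₂ p₂} + U ∧ W' = {src x₂₁ x₂₂ o₂} + U := by
        refine add_eq_add_of_disjoint (add_left_cancel (a := {src x x₁₂ o₁, snk x x₂₁ i₁,
          snk x₁₂ x₂₂ i₂}) (Eq.trans Word.perm (h.trans Word.perm))) ?_
        simpa using Ne.symm e3
      unfold quadValue
      obtain ⟨q1, c1⟩ := S.join_src (i := i₁) (o := o₁) (b := i₂) (c := p₂)
        (W := {strand i₂ o₂} + U) Word.perm hb₁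
      obtain ⟨q2, -⟩ := S.join_src (i := i₂) (o := o₂) (b := o₁) (c := p₂) (W := U) Word.perm c1
      obtain ⟨q3, c3⟩ := S.join_src (i := i₁) (o := o₂) (b := i₂) (c := p₂)
        (W := {strand i₂ o₁} + U) Word.perm hb₂
      obtain ⟨q4, -⟩ := S.join_src (i := i₂) (o := o₁) (b := o₂) (c := p₂) (W := U) Word.perm c3
      obtain ⟨q5, c5⟩ := S.join_src (i := x₂₁) (o := o₁) (b := x₂₂) (c := o₂)
        (W := {strand x₂₂ p₂} + U) Word.perm hb₃
      obtain ⟨q6, -⟩ := S.join_src (i := x₂₂) (o := p₂) (b := o₁) (c := o₂) (W := U) Word.perm c5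
      obtain ⟨q7, c7⟩ := S.join_src (i := x₂₁) (o := p₂) (b := x₂₂) (c := o₂)
        (W := {strand x₂₂ o₁} + U) Word.perm hb₄
      obtain ⟨q8, -⟩ := S.join_src (i := x₂₂) (o := o₁) (b := p₂) (c := o₂) (W := U) Word.perm c7
      rw [q1, q2, q3, q4, q5, q6, q7, q8]
      congr 2 <;> exact Word.perm
  -- The mirror case: separation at the source of `x`, both sources in common, possibly three sinks.
  · have e3 := hv.eq_of_mem_out m2 m6 (x := x₂₁) (by simp [src]) (by simp [src])
    obtain ⟨rfl, rfl⟩ | ⟨rfl, rfl⟩ := eq_or_eq_of_triple (inj_src e3)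
    · have e4 := hv.eq_of_mem_in m4 m8 (x := x₂₂) (by simp [snk]) (by simp [snk])
      obtain rfl := same e3 e4
      obtain ⟨h5, h6⟩ | ⟨rfl, rfl⟩ := mid (inj_snk e4)
      · rw [h6, h5]
      · rw [← quadValue_swap_sources, ← quadValue_swap_sources (F := F) x₁₂]
        rw [S.quadValue_self hb₂ hb₁, S.quadValue_self hb₄ hb₃]
    · by_cases e4 : snk x₁₂ x₂₂ i₂ = snk o₁ o₂ j₂
      · exfalso
        simp [quadWord, src, snk] at hno
        have h5 : o₁ ∈ ({x₁₂, x₂₂, i₂} : Multiset ℕ) := by rw [inj_snk e4]; simp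
        have h6 : o₂ ∈ ({x₁₂, x₂₂, i₂} : Multiset ℕ) := by rw [inj_snk e4]; simp
        simp only [Multiset.insert_eq_cons, Multiset.mem_cons, Multiset.mem_singleton] at h5 h6
        rcases h5 with rfl | rfl | rfl <;> rcases h6 with rfl | rfl | rfl <;> grind
      obtain ⟨U, rfl, rfl⟩ : ∃ U, W = {snk o₁ o₂ j₂} + U ∧ W' = {snk x₁₂ x₂₂ i₂} + U := by
        refine add_eq_add_of_disjoint (add_left_cancel (a := {src x x₁₂ o₁, snk x x₂₁ i₁,
          src x₂₁ x₂₂ o₂}) (Eq.trans Word.perm (h.trans Word.perm))) ?_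
        simpa using Ne.symm e4
      unfold quadValue
      obtain ⟨q1, c1⟩ := S.join_snk (i := i₁) (o := o₁) (b := o₂) (c := j₂)
        (W := {strand i₂ o₂} + U) Word.perm hb₁
      obtain ⟨q2, -⟩ := S.join_snk (i := i₂) (o := o₂) (b := i₁) (c := j₂) (W := U) Word.perm c1
      obtain ⟨q3, c3⟩ := S.join_snk (i := i₁) (o := o₂) (b := o₁) (c := j₂)
        (W := {strand i₂ o₁} + U) Word.perm hb₂
      obtain ⟨q4, -⟩ := S.join_snk (i := i₂) (o := o₁) (b := i₁) (c := j₂) (W := U) Word.perm c3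
      obtain ⟨q5, c5⟩ := S.join_snk (i := i₁) (o := x₁₂) (b := x₂₂) (c := i₂)
        (W := {strand j₂ x₂₂} + U) Word.perm hb₃
      obtain ⟨q6, -⟩ := S.join_snk (i := j₂) (o := x₂₂) (b := i₁) (c := i₂) (W := U) Word.perm c5
      obtain ⟨q7, c7⟩ := S.join_snk (i := i₁) (o := x₂₂) (b := x₁₂) (c := i₂)
        (W := {strand j₂ x₁₂} + U) Word.perm hb₄
      obtain ⟨q8, -⟩ := S.join_snk (i := j₂) (o := x₁₂) (b := i₁) (c := i₂) (W := U) Word.perm c7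
      rw [q1, q2, q3, q4, q5, q6, q7, q8]
      congr 2 <;> exact Word.perm
  -- Separation at both ends. If nevertheless the far sinks agree, the four vertices form a closed
  -- component, a 4-cycle with two opposite sides doubled, and both values are δ₃ + δ₃² times the
  -- rest.
  · by_cases e4 : snk x₁₂ x₂₂ i₂ = snk o₁ y₂₂ j₂
    · simp [quadWord, src, snk] at hno hni hno' hni'
      have h5 : o₁ ∈ ({x₁₂, x₂₂, i₂} : Multiset ℕ) := by rw [inj_snk e4]; simp
      have g5 : i₂ = o₁ := by
        simp only [Multiset.insert_eq_cons, Multiset.mem_cons, Multiset.mem_singleton] at h5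
        rcases h5 with h5 | h5 | h5
        exacts [by grind, by grind, h5.symm]
      have h6 : x₁₂ ∈ ({o₁, y₂₂, j₂} : Multiset ℕ) := by rw [← inj_snk e4]; simp
      have g6 : j₂ = x₁₂ := by
        simp only [Multiset.insert_eq_cons, Multiset.mem_cons, Multiset.mem_singleton] at h6
        rcases h6 with h6 | h6 | h6
        exacts [by grind, by grind, h6.symm]
      subst g5 g6
      have h7 : x₂₂ = y₂₂ := by
        have : ({j₂, x₂₂, i₂} : Multiset ℕ) = {j₂, y₂₂, i₂} := (inj_snk e4).trans Word.perm
        rcases eq_or_eq_of_triple this with h | h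
        exacts [h.1, h.1.trans h.2]
      subst h7
      have e3 := hv.eq_of_mem_out m2 m6 (x := x₂₂) (by simp [src]) (by simp [src])
      obtain rfl := same e3 e4
      obtain ⟨h7, -⟩ | ⟨rfl, rfl⟩ := mid (inj_src e3)
      · grind
      unfold quadValue
      obtain ⟨q1, c1⟩ := S.join_strand (i := i₂) (o := o₂) (b := i₂) (W := W) Word.perm hb₁
      obtain ⟨q2, -⟩ := S.circle (i := i₂) (W := W) Word.perm c1
      obtain ⟨q3, c3⟩ := S.circle (i := o₂) (W := {strand i₂ i₂} + W) Word.perm hb₂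
      obtain ⟨q4, -⟩ := S.circle (i := i₂) (W := W) Word.perm c3
      obtain ⟨q5, c5⟩ := S.join_strand (i := j₂) (o := x₂₁) (b := j₂) (W := W) Word.perm hb₃
      obtain ⟨q6, -⟩ := S.circle (i := j₂) (W := W) Word.perm c5
      obtain ⟨q7, c7⟩ := S.circle (i := x₂₁) (W := {strand j₂ j₂} + W) Word.perm hb₄
      obtain ⟨q8, -⟩ := S.circle (i := j₂) (W := W) Word.perm c7
      rw [q1, q2, q3, q4, q5, q6, q7, q8]
    -- Equality of the far sources would force equality of the far sinks, which is excluded by now.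
    by_cases e3 : src x₂₁ x₂₂ o₂ = src i₁ y₂₂ p₂
    · exfalso
      refine e4 ?_
      simp [quadWord, src, snk] at hno hni hno' hni'
      have h5 : i₁ ∈ ({x₂₁, x₂₂, o₂} : Multiset ℕ) := by rw [inj_src e3]; simp
      have g5 : o₂ = i₁ := by
        simp only [Multiset.insert_eq_cons, Multiset.mem_cons, Multiset.mem_singleton] at h5
        rcases h5 with h5 | h5 | h5
        exacts [by grind, by grind, h5.symm]
      have h6 : x₂₁ ∈ ({i₁, y₂₂, p₂} : Multiset ℕ) := by rw [← inj_src e3]; simp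
      have g6 : p₂ = x₂₁ := by
        simp only [Multiset.insert_eq_cons, Multiset.mem_cons, Multiset.mem_singleton] at h6
        rcases h6 with h6 | h6 | h6
        exacts [by grind, by grind, h6.symm]
      subst g5 g6
      have h7 : x₂₂ = y₂₂ := by
        have : ({p₂, x₂₂, o₂} : Multiset ℕ) = {p₂, y₂₂, o₂} := (inj_src e3).trans Word.perm
        rcases eq_or_eq_of_triple this with h | h
        exacts [h.1, h.1.trans h.2]
      subst h7
      exact hv.eq_of_mem_in m4 m8 (x := x₂₂) (by simp [snk]) (by simp [snk])
    obtain ⟨U, rfl, rfl⟩ : ∃ U, W = {src i₁ y₂₂ p₂, snk o₁ y₂₂ j₂} + U ∧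
        W' = {src x₂₁ x₂₂ o₂, snk x₁₂ x₂₂ i₂} + U := by
      refine add_eq_add_of_disjoint (add_left_cancel (a := {src x x₁₂ o₁, snk x x₂₁ i₁})
        (Eq.trans Word.perm (h.trans Word.perm))) ?_
      simp only [Multiset.disjoint_left, Multiset.insert_eq_cons, Multiset.mem_cons,
        Multiset.mem_singleton]
      rintro a (rfl | rfl) (h | h)
      exacts [e3 h, by simp [src, snk] at h, by simp [src, snk] at h, e4 h]
    -- A ladder: two squares with the single common side `x`. Resolving either square turns the
    -- other one into a bigon in one term, and into a single edge between a source and a sink in the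
    -- other term. The results differ only in the name of this edge, `x₂₂` or `y₂₂`.
    unfold quadValue
    obtain ⟨q1, c1⟩ := S.join_snk (i := i₁) (o := o₁) (b := y₂₂) (c := j₂)
      (W := {strand i₂ o₂, src i₁ y₂₂ p₂} + U) Word.perm hb₁
    obtain ⟨q2, -⟩ := S.bigon (x := i₁) (y := y₂₂) (o := p₂) (i := j₂) (W := {strand i₂ o₂} + U)
      Word.perm c1
    obtain ⟨q3, c3⟩ := S.join_src (i := i₁) (o := o₂) (b := y₂₂) (c := p₂)
      (W := {strand i₂ o₁, snk o₁ y₂₂ j₂} + U) Word.perm hb₂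
    obtain ⟨q4, -⟩ := S.join_snk (i := i₂) (o := o₁) (b := y₂₂) (c := j₂)
      (W := {src o₂ y₂₂ p₂} + U) Word.perm c3
    obtain ⟨q5, c5⟩ := S.join_snk (i := x₂₁) (o := x₁₂) (b := x₂₂) (c := i₂)
      (W := {strand j₂ p₂, src x₂₁ x₂₂ o₂} + U) Word.perm hb₃
    obtain ⟨q6, -⟩ := S.bigon (x := x₂₁) (y := x₂₂) (o := o₂) (i := i₂) (W := {strand j₂ p₂} + U)
      Word.perm c5
    obtain ⟨q7, c7⟩ := S.join_src (i := x₂₁) (o := p₂) (b := x₂₂) (c := o₂)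
      (W := {strand j₂ x₁₂, snk x₁₂ x₂₂ i₂} + U) Word.perm hb₄
    obtain ⟨q8, c8⟩ := S.join_snk (i := j₂) (o := x₁₂) (b := x₂₂) (c := i₂)
      (W := {src p₂ x₂₂ o₂} + U) Word.perm c7
    rw [q1, q2, q3, q4, q5, q6, q7, q8, ← S.relabel _ c8 (Equiv.swap x₂₂ y₂₂)]
    congr 1
    · congr 2
      exact Word.perm
    · simp [quadWord, src, snk] at hno hni
      have hU : Word.relabel (Equiv.swap x₂₂ y₂₂) U = U := by
        apply relabel_swap_of_notMem (Or.inr ⟨?_, ?_⟩) <;> grind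
      have hs : ∀ {a : ℕ}, ¬ a = x₂₂ → ¬ a = y₂₂ → Equiv.swap x₂₂ y₂₂ a = a :=
        fun h1 h2 => Equiv.swap_apply_of_ne_of_ne h1 h2
      simp only [relabel_add, relabel_singleton, hU, relabelAtom_snk, relabelAtom_src,
        Equiv.swap_apply_left]
      rw [hs (a := j₂) (by grind) (by grind), hs (a := i₂) (by grind) (by grind),
        hs (a := p₂) (by grind) (by grind), hs (a := o₂) (by grind) (by grind)]
      exact congrArg F Word.perm

/-- A common side can be moved to the first place of both quadrilaterals by symmetry. Without a
common side there is no common vertex, as two of the three edges at a vertex are sides, and the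
rules are disjoint. -/
theorem quad_quad {x₁₁ x₁₂ x₂₁ x₂₂ o₁ o₂ i₁ i₂ y₁₁ y₁₂ y₂₁ y₂₂ p₁ p₂ j₁ j₂ : ℕ}
    {W W' : Multiset Atom}
    (h : quadWord x₁₁ x₁₂ x₂₁ x₂₂ o₁ o₂ i₁ i₂ + W = quadWord y₁₁ y₁₂ y₂₁ y₂₂ p₁ p₂ j₁ j₂ + W')
    (hv : Valid (quadWord x₁₁ x₁₂ x₂₁ x₂₂ o₁ o₂ i₁ i₂ + W))
    (hc : ((quadWord x₁₁ x₁₂ x₂₁ x₂₂ o₁ o₂ i₁ i₂ + W).card : ℕ∞) ≤ n) :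
    quadValue F o₁ o₂ i₁ i₂ W = quadValue F p₁ p₂ j₁ j₂ W' := by
  have h₁ := Rule.quad (δ₂ := δ₂) (δ₃ := δ₃) x₁₁ x₁₂ x₂₁ x₂₂ o₁ o₂ i₁ i₂
  have h₂ := Rule.quad (δ₂ := δ₂) (δ₃ := δ₃) y₁₁ y₁₂ y₂₁ y₂₂ p₁ p₂ j₁ j₂
  by_cases hx : ∃ x, (x = x₁₁ ∨ x = x₁₂ ∨ x = x₂₁ ∨ x = x₂₂) ∧
      (x = y₁₁ ∨ x = y₁₂ ∨ x = y₂₁ ∨ x = y₂₂)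
  · obtain ⟨x, hx, hy⟩ := hx
    obtain ⟨_, _, _, _, _, _, _, hq, hq'⟩ :=
      quadWord_first_side (R := R) (o₁ := o₁) (o₂ := o₂) (i₁ := i₁) (i₂ := i₂) hx
    obtain ⟨_, _, _, _, _, _, _, hr, hr'⟩ :=
      quadWord_first_side (R := R) (o₁ := p₁) (o₂ := p₂) (i₁ := j₁) (i₂ := j₂) hy
    rw [hq] at h hv hc
    rw [hr] at h
    rw [hq' F, hr' F]
    exact S.quad_quad_of_eq h hv hc
  push Not at hx
  have hn := hv.nodup
  simp [quadWord, src, snk] at hn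
  have n1 : x₁₁ ≠ x₁₂ := by tauto
  have n2 : x₂₁ ≠ x₂₂ := by tauto
  have n3 : x₁₁ ≠ x₂₁ := by tauto
  have n4 : x₁₂ ≠ x₂₂ := by tauto
  have g1 := hx x₁₁ (by simp)
  have g2 := hx x₁₂ (by simp)
  have g3 := hx x₂₁ (by simp)
  have g4 := hx x₂₂ (by simp)
  have := S.ev_eq_of_disjoint h₁ h₂ (W₁ := W) (W₂ := W') h hv hc (by
    simp only [quadWord, Multiset.disjoint_left, Multiset.insert_eq_cons, Multiset.mem_cons,
      Multiset.mem_singleton]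
    rintro a (rfl | rfl | rfl | rfl) (h | h | h | h)
    · have := overlap_of_triple_eq (by simpa [src] using h) n1; tauto
    · have := overlap_of_triple_eq (by simpa [src] using h) n1; tauto
    · simp [src, snk] at h
    · simp [src, snk] at h
    · have := overlap_of_triple_eq (by simpa [src] using h) n2; tauto
    · have := overlap_of_triple_eq (by simpa [src] using h) n2; tauto
    · simp [src, snk] at h
    · simp [src, snk] at h
    · simp [src, snk] at h
    · simp [src, snk] at h
    · have := overlap_of_triple_eq (by simpa [snk] using h) n3; tauto
    · have := overlap_of_triple_eq (by simpa [snk] using h) n3; tauto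
    · simp [src, snk] at h
    · simp [src, snk] at h
    · have := overlap_of_triple_eq (by simpa [snk] using h) n4; tauto
    · have := overlap_of_triple_eq (by simpa [snk] using h) n4; tauto)
  simpa [ev, quadValue] using this

end Skein
end Word

/-! ### Local confluence and the value function -/

namespace Word

variable {R : Type*} [CommRing R] {δ₂ δ₃ : R} {n : ℕ∞} {F : Multiset Atom → R}

/-- Local confluence: any two ways of applying a rule to a word give the same value. -/
theorem Skein.ev_unique (S : Skein δ₂ δ₃ n F) (hδ : δ₂ * δ₂ = δ₃ + 1) {S₁ S₂ W₁ W₂ : Multiset Atom}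
    {L₁ L₂ : List (R × Multiset Atom)} (h₁ : Rule δ₂ δ₃ S₁ L₁) (h₂ : Rule δ₂ δ₃ S₂ L₂)
    (h : S₁ + W₁ = S₂ + W₂) (hv : Valid (S₁ + W₁)) (hc : ((S₁ + W₁).card : ℕ∞) ≤ n) :
    ev F L₁ W₁ = ev F L₂ W₂ := by
  -- A circle is a component by itself, so it overlaps with no other rule than its own deletion.
  have circ : ∀ {j : ℕ} {S₂ W₁ W₂ : Multiset Atom} {L₂ : List (R × Multiset Atom)},
      Rule δ₂ δ₃ S₂ L₂ → {strand j j} + W₁ = S₂ + W₂ → Valid ({strand j j} + W₁) →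
      ((({strand j j} : Multiset Atom) + W₁).card : ℕ∞) ≤ n →
      ev F [(δ₃, 0)] W₁ = ev F L₂ W₂ := by
    intro j S₂ W₁ W₂ L₂ h₂ h hv hc
    have h₁ := Rule.circle (δ₂ := δ₂) (δ₃ := δ₃) j
    cases h₂ with
    | join i o I O =>
      exact S.ev_eq_of_disjoint h₁ (Rule.join i o I O) h hv hc (disjoint_circle_join h hv)
    | circle i =>
      by_cases hs : strand j j = strand i i
      · rw [hs] at h
        rw [add_left_cancel h]
      · exact S.ev_eq_of_disjoint h₁ (Rule.circle i) h hv hc (by simpa using Ne.symm hs)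
    | bigon x y o i =>
      exact S.ev_eq_of_disjoint h₁ (Rule.bigon x y o i) h hv hc (by simp [strand, src, snk])
    | quad x₁₁ x₁₂ x₂₁ x₂₂ o₁ o₂ i₁ i₂ =>
      exact S.ev_eq_of_disjoint h₁ (Rule.quad x₁₁ x₁₂ x₂₁ x₂₂ o₁ o₂ i₁ i₂) h hv hc
        (by simp [quadWord, strand, src, snk])
  have hv' := h ▸ hv
  have hc' := h ▸ hc
  cases h₁ with
  | circle j => exact circ h₂ h hv hc
  | join i o I O =>
    cases h₂ with
    | circle j => exact (circ (Rule.join i o I O) h.symm hv' hc').symm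
    | join => simpa [ev] using S.join_join h hv hc
    | bigon => simpa [ev] using S.join_bigon h hv hc
    | quad => simpa [ev] using S.join_quad h hv hc
  | bigon x y o i =>
    cases h₂ with
    | circle j => exact (circ (Rule.bigon x y o i) h.symm hv' hc').symm
    | join => simpa [ev] using (S.join_bigon h.symm hv' hc').symm
    | bigon => simpa [ev] using S.bigon_bigon h hv hc
    | quad => simpa [ev, quadValue] using S.bigon_quad hδ h hv hc
  | quad x₁₁ x₁₂ x₂₁ x₂₂ o₁ o₂ i₁ i₂ =>
    cases h₂ with
    | circle j =>
      exact (circ (Rule.quad x₁₁ x₁₂ x₂₁ x₂₂ o₁ o₂ i₁ i₂) h.symm hv' hc').symm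
    | join => simpa [ev] using (S.join_quad h.symm hv' hc').symm
    | bigon => simpa [ev, quadValue] using (S.bigon_quad hδ h.symm hv' hc').symm
    | quad => simpa [ev, quadValue] using S.quad_quad h hv hc

/-! ### The value of a word -/

/-- Some rule applies to the word. -/
def Reducible (δ₂ δ₃ : R) (W : Multiset Atom) : Prop :=
  ∃ S L U, Rule δ₂ δ₃ S L ∧ W = S + U

theorem Reducible.relabel {W : Multiset Atom} (h : Reducible δ₂ δ₃ W) (σ : ℕ → ℕ) :
    Reducible δ₂ δ₃ (relabel σ W) := by
  obtain ⟨S, L, U, hr, rfl⟩ := h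
  exact ⟨_, _, Word.relabel σ U, hr.relabel σ, relabel_add _ _ _⟩

open Classical in
/-- The value of a word: rules are applied as long as possible, and the words to which no rule
applies have the value `base`. -/
noncomputable def value (δ₂ δ₃ : R) (base : Multiset Atom → R) (W : Multiset Atom) : R :=
  -- The result `r` of an arbitrary rule application is part of the existential, so that `choose`
  -- returns it. The guard on `V.card` serves the termination check; its default `0` is never
  -- reached, by `Rule.card_lt`.
  if h : ∃ r S L U, Rule δ₂ δ₃ S L ∧ W = S + U ∧
      r = ev (fun V => if _h : V.card < W.card then value δ₂ δ₃ base V else 0) L U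
  then h.choose else base W
termination_by W.card

variable {base : Multiset Atom → R}

theorem exists_value_eq {W : Multiset Atom} (h : Reducible δ₂ δ₃ W) :
    ∃ S L U, Rule δ₂ δ₃ S L ∧ W = S + U ∧ value δ₂ δ₃ base W = ev (value δ₂ δ₃ base) L U := by
  have h' : ∃ r S L U, Rule δ₂ δ₃ S L ∧ W = S + U ∧
      r = ev (fun V => if _h : V.card < W.card then value δ₂ δ₃ base V else 0) L U := by
    obtain ⟨S, L, U, hr, hW⟩ := h
    exact ⟨_, S, L, U, hr, hW, rfl⟩
  obtain ⟨S, L, U, hr, hW, he⟩ := h'.choose_spec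
  refine ⟨S, L, U, hr, hW, ?_⟩
  rw [value, dif_pos h', he]
  refine ev_congr fun p hp => ?_
  have := hr.card_lt hp
  rw [dif_pos (by rw [hW, Multiset.card_add, Multiset.card_add]; omega)]

theorem value_of_not_reducible {W : Multiset Atom} (h : ¬ Reducible δ₂ δ₃ W) :
    value δ₂ δ₃ base W = base W := by
  rw [value, dif_neg]
  rintro ⟨r, S, L, U, hr, hW, -⟩
  exact h ⟨S, L, U, hr, hW⟩

/-- Induction on a bound for the number of vertices. The value was computed with some rule; local
confluence, available because all smaller words already obey the rules, exchanges it for any other.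
Relabelling carries a rule application to one of the relabelled word. -/
theorem skein_value (hδ : δ₂ * δ₂ = δ₃ + 1)
    (hbase : ∀ W, Valid W → ∀ σ : Equiv.Perm ℕ, base (relabel σ W) = base W) :
    Skein δ₂ δ₃ ⊤ (value δ₂ δ₃ base) := by
  have key : ∀ n : ℕ, Skein δ₂ δ₃ n (value δ₂ δ₃ base) := by
    intro n
    induction n with
    | zero => exact ⟨fun W h => by simpa using h.2, fun S L W _ h => by simpa using h.2⟩
    | succ n ih =>
      have hrule : ∀ S L W, Rule δ₂ δ₃ S L → Below ((n + 1 : ℕ) : ℕ∞) (S + W) →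
          value δ₂ δ₃ base (S + W) = ev (value δ₂ δ₃ base) L W := by
        intro S L W hr hb
        obtain ⟨S', L', U, hr', hW, he⟩ :=
          exists_value_eq (base := base) (W := S + W) ⟨S, L, W, hr, rfl⟩
        rw [he]
        have hc : ((S + W).card : ℕ∞) ≤ (n : ℕ∞) := by
          have := hb.2
          norm_cast at this ⊢
          omega
        -- The word itself may have `n` vertices, one more than `ih` covers; confluence only
        -- evaluates words obtained after a rule, which are smaller.
        exact (ih.ev_unique hδ hr hr' hW hb.1 hc).symm
      refine ⟨fun W hb σ => ?_, hrule⟩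
      by_cases hW : Reducible δ₂ δ₃ W
      · obtain ⟨S, L, U, hr, rfl⟩ := hW
        rw [hrule S L U hr hb, relabel_add, hrule _ _ _ (hr.relabel σ)]
        · unfold ev
          rw [List.map_map]
          refine congrArg List.sum (List.map_congr_left fun p hp => ?_)
          simp only [Function.comp_apply]
          rw [← relabel_add, ih.relabel]
          refine hr.below_of_card_le hb.1 ?_ hp
          have := hb.2
          norm_cast at this ⊢
          omega
        · rw [← relabel_add]
          exact ⟨hb.1.relabel σ.injective, by simpa using hb.2⟩
      · rw [value_of_not_reducible hW, value_of_not_reducible, hbase W hb.1]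
        intro h
        refine hW ?_
        have := h.relabel σ.symm
        rwa [relabel_symm] at this
  refine ⟨fun W hb σ => (key (W.card + 1)).relabel W ⟨hb.1, ?_⟩ σ,
    fun S L W hr hb => (key ((S + W).card + 1)).rule S L W hr ⟨hb.1, ?_⟩⟩ <;>
  · norm_cast
    omega

end Word

/-! ### Components and multiplicativity -/

namespace Word

variable {R : Type*} [CommRing R] {δ₂ δ₃ : R} {n : ℕ∞} {F : Multiset Atom → R}

/-- A non-empty valid word that is not a union of two smaller ones. -/
def Connected (C : Multiset Atom) : Prop :=
  C ≠ 0 ∧ Valid C ∧ ∀ C' ≤ C, Valid C' → C' = 0 ∨ C' = C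

open Classical in
/-- The components of a word. -/
noncomputable def components (W : Multiset Atom) : Finset (Multiset Atom) :=
  W.powerset.toFinset.filter Connected

theorem mem_components {C W : Multiset Atom} : C ∈ components W ↔ C ≤ W ∧ Connected C := by
  simp [components]

theorem Valid.inter {C V W : Multiset Atom} (h : Valid W) (hC : Valid C) (hV : Valid V)
    (hCW : C ≤ W) (hVW : V ≤ W) : Valid (C ∩ V) := by
  refine h.of_le ((Multiset.inter_le_left).trans hCW) fun a ha b hb n hn => ?_
  rw [Multiset.mem_inter] at ha ⊢
  exact ⟨h.closed hC hCW ha.1 hb hn, h.closed hV hVW ha.2 hb hn⟩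

/-- The intersection is a valid part of `C`, so by minimality it is empty or all of `C`. -/
theorem Connected.le_of_mem {C V W : Multiset Atom} (hC : Connected C) (h : Valid W) (hV : Valid V)
    (hCW : C ≤ W) (hVW : V ≤ W) {a : Atom} (ha : a ∈ C) (ha' : a ∈ V) : C ≤ V := by
  rcases hC.2.2 _ Multiset.inter_le_left (h.inter hC.2.1 hV hCW hVW) with h0 | h0
  · have : a ∈ C ∩ V := Multiset.mem_inter.2 ⟨ha, ha'⟩
    simp [h0] at this
  · rw [← h0]
    exact Multiset.inter_le_right

theorem components_add {V W : Multiset Atom} (h : Valid (V + W)) (hV : Valid V) (hW : Valid W) :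
    components (V + W) = components V ∪ components W := by
  ext C
  simp only [Finset.mem_union, mem_components]
  constructor
  · rintro ⟨hC, hcon⟩
    obtain ⟨a, ha⟩ := Multiset.exists_mem_of_ne_zero hcon.1
    rcases Multiset.mem_add.1 (Multiset.mem_of_le hC ha) with ha' | ha'
    · exact Or.inl ⟨hcon.le_of_mem h hV hC (Multiset.le_add_right _ _) ha ha', hcon⟩
    · exact Or.inr ⟨hcon.le_of_mem h hW hC (Multiset.le_add_left _ _) ha ha', hcon⟩
  · rintro (⟨hC, hcon⟩ | ⟨hC, hcon⟩)
    exacts [⟨hC.trans (Multiset.le_add_right _ _), hcon⟩,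
      ⟨hC.trans (Multiset.le_add_left _ _), hcon⟩]

/-- Components carry their labels, so isomorphic components are different elements. A product over
the finite set of components therefore counts each of them, which is what makes `componentProd`
multiplicative. -/
theorem disjoint_components {V W : Multiset Atom} (h : Valid (V + W)) :
    Disjoint (components V) (components W) := by
  rw [Finset.disjoint_left]
  intro C hC hC'
  rw [mem_components] at hC hC'
  obtain ⟨a, ha⟩ := Multiset.exists_mem_of_ne_zero hC.2.1
  have := h.word_nodup
  rw [Multiset.nodup_add] at this
  exact Multiset.disjoint_left.1 this.2.2 (Multiset.mem_of_le hC.1 ha)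
    (Multiset.mem_of_le hC'.1 ha)

theorem Connected.components_eq {C : Multiset Atom} (hC : Connected C) : components C = {C} := by
  ext D
  rw [mem_components, Finset.mem_singleton]
  constructor
  · rintro ⟨hD, hD'⟩
    exact (hC.2.2 D hD hD'.2.1).resolve_left hD'.1
  · rintro rfl
    exact ⟨le_rfl, hC⟩

theorem le_of_relabel_le {σ : Equiv.Perm ℕ} {V W : Multiset Atom}
    (h : relabel σ V ≤ relabel σ W) : V ≤ W := by
  have := Multiset.map_le_map (f := relabelAtom σ.symm) h
  change relabel σ.symm (relabel σ V) ≤ relabel σ.symm (relabel σ W) at this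
  rwa [relabel_symm, relabel_symm] at this

theorem Connected.relabel {C : Multiset Atom} (hC : Connected C) (σ : Equiv.Perm ℕ) :
    Connected (relabel σ C) := by
  refine ⟨fun h => hC.1 ?_, hC.2.1.relabel σ.injective, fun D hD hv => ?_⟩
  · rw [← Multiset.card_eq_zero] at h ⊢
    simpa using h
  · have h1 : Word.relabel σ (Word.relabel σ.symm D) = D := by
      simpa using relabel_symm σ.symm D
    have h2 : Word.relabel σ.symm D ≤ C := le_of_relabel_le (σ := σ) (by rwa [h1])
    rcases hC.2.2 _ h2 (hv.relabel σ.symm.injective) with h | h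
    · left; rw [← h1, h]; rfl
    · right; rw [← h1, h]

/-- The product of a function over all components of a word. -/
noncomputable def componentProd (var : Multiset Atom → R) (W : Multiset Atom) : R :=
  ∏ C ∈ components W, var C

variable {var : Multiset Atom → R}

theorem componentProd_zero : componentProd var 0 = 1 := by
  have : components 0 = ∅ := by
    ext C
    simp only [mem_components, Finset.notMem_empty, iff_false, not_and]
    intro hC hcon
    exact hcon.1 (by simpa using hC)
  simp [componentProd, this]

theorem componentProd_add {V W : Multiset Atom} (h : Valid (V + W)) (hV : Valid V) (hW : Valid W) :
    componentProd var (V + W) = componentProd var V * componentProd var W := by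
  rw [componentProd, components_add h hV hW, Finset.prod_union (disjoint_components h)]
  rfl

theorem componentProd_relabel (hvar : ∀ W, Valid W → ∀ σ : Equiv.Perm ℕ, var (relabel σ W) = var W)
    (W : Multiset Atom) (σ : Equiv.Perm ℕ) :
    componentProd var (relabel σ W) = componentProd var W := by
  symm
  refine Finset.prod_bij (fun C _ => relabel σ C) ?_ ?_ ?_ ?_
  · intro C hC
    rw [mem_components] at hC ⊢
    exact ⟨Multiset.map_le_map hC.1, hC.2.relabel σ⟩
  · intro C _ D _ h
    have := congrArg (relabel σ.symm) h
    simpa [relabel_symm] using this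
  · intro D hD
    rw [mem_components] at hD
    have h1 : relabel σ (relabel σ.symm D) = D := by simpa using relabel_symm σ.symm D
    refine ⟨relabel σ.symm D, mem_components.2 ⟨?_, hD.2.relabel σ.symm⟩, h1⟩
    exact le_of_relabel_le (σ := σ) (by rw [h1]; exact hD.1)
  · intro C hC
    exact (hvar C (mem_components.1 hC).2.2.1 σ).symm

/-- The left side of every rule is connected through its inner edges, so it cannot be spread over
two valid parts. -/
theorem subset_of_rule {S : Multiset Atom} {L : List (R × Multiset Atom)} (hr : Rule δ₂ δ₃ S L)
    {V W : Multiset Atom} (h : Valid W) (hV : Valid V) (hSW : S ⊆ W) (hVW : V ≤ W)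
    (hS : ∃ a ∈ S, a ∈ V) : S ⊆ V := by
  have cl : ∀ {a b : Atom}, a ∈ V → b ∈ W → ∀ n, n ∈ a.1 ∧ n ∈ b.2 ∨ n ∈ a.2 ∧ n ∈ b.1 → b ∈ V :=
    fun ha hb n hn => h.closed hV hVW ha hb hn
  cases hr with
  | join i o I O =>
    simp only [Multiset.subset_iff, Multiset.insert_eq_cons, Multiset.mem_cons,
      Multiset.mem_singleton, forall_eq_or_imp, forall_eq, exists_eq_or_imp, exists_eq_left]
      at hSW hS ⊢
    rcases hS with hS | hS
    · exact ⟨hS, cl hS hSW.2 o (by simp [strand])⟩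
    · exact ⟨cl hS hSW.1 o (by simp [strand]), hS⟩
  | circle i => simpa [Multiset.subset_iff] using hS
  | bigon x y o i =>
    simp only [Multiset.subset_iff, Multiset.insert_eq_cons, Multiset.mem_cons,
      Multiset.mem_singleton, forall_eq_or_imp, forall_eq, exists_eq_or_imp, exists_eq_left]
      at hSW hS ⊢
    rcases hS with hS | hS
    · exact ⟨hS, cl hS hSW.2 x (by simp [src, snk])⟩
    · exact ⟨cl hS hSW.1 x (by simp [src, snk]), hS⟩
  | quad x₁₁ x₁₂ x₂₁ x₂₂ o₁ o₂ i₁ i₂ =>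
    simp only [quadWord, Multiset.subset_iff, Multiset.insert_eq_cons, Multiset.mem_cons,
      Multiset.mem_singleton, forall_eq_or_imp, forall_eq, exists_eq_or_imp, exists_eq_left]
      at hSW hS ⊢
    obtain ⟨h1, h2, h3, h4⟩ := hSW
    have a13 : src x₁₁ x₁₂ o₁ ∈ V → snk x₁₁ x₂₁ i₁ ∈ V := fun h => cl h h3 x₁₁ (by simp [src, snk])
    have a32 : snk x₁₁ x₂₁ i₁ ∈ V → src x₂₁ x₂₂ o₂ ∈ V := fun h => cl h h2 x₂₁ (by simp [src, snk])
    have a24 : src x₂₁ x₂₂ o₂ ∈ V → snk x₁₂ x₂₂ i₂ ∈ V := fun h => cl h h4 x₂₂ (by simp [src, snk])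
    have a41 : snk x₁₂ x₂₂ i₂ ∈ V → src x₁₁ x₁₂ o₁ ∈ V := fun h => cl h h1 x₁₂ (by simp [src, snk])
    tauto

theorem Rule.ne_zero {S : Multiset Atom} {L : List (R × Multiset Atom)} (hr : Rule δ₂ δ₃ S L) :
    S ≠ 0 := by
  cases hr <;> simp [quadWord]

theorem Reducible.of_add {V W : Multiset Atom} (h : Valid (V + W)) (hV : Valid V) (hW : Valid W)
    (hr : Reducible δ₂ δ₃ (V + W)) : Reducible δ₂ δ₃ V ∨ Reducible δ₂ δ₃ W := by
  obtain ⟨S, L, U, hr, hS⟩ := hr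
  have hSle : S ≤ V + W := by rw [hS]; exact Multiset.le_add_right _ _
  have hSn := Multiset.nodup_of_le hSle h.word_nodup
  have hS0 : S ≠ 0 := hr.ne_zero
  obtain ⟨a, ha⟩ := Multiset.exists_mem_of_ne_zero hS0
  have hsub := Multiset.subset_of_le hSle
  rcases Multiset.mem_add.1 (hsub ha) with ha' | ha'
  · have := subset_of_rule hr h hV hsub (Multiset.le_add_right _ _) ⟨a, ha, ha'⟩
    obtain ⟨U', hU'⟩ := Multiset.le_iff_exists_add.1 ((Multiset.le_iff_subset hSn).2 this)
    exact Or.inl ⟨S, L, U', hr, hU'⟩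
  · have := subset_of_rule hr h hW hsub (Multiset.le_add_left _ _) ⟨a, ha, ha'⟩
    obtain ⟨U', hU'⟩ := Multiset.le_iff_exists_add.1 ((Multiset.le_iff_subset hSn).2 this)
    exact Or.inr ⟨S, L, U', hr, hU'⟩

/-- Induction on the number of vertices: a rule for one summand is also a rule for the sum. When
neither summand is reducible, neither is the sum, and the product over components splits. -/
theorem value_add (S : Skein δ₂ δ₃ ⊤ (value δ₂ δ₃ (componentProd var))) {V W : Multiset Atom}
    (h : Valid (V + W)) (hV : Valid V) (hW : Valid W) :
    value δ₂ δ₃ (componentProd var) (V + W) =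
      value δ₂ δ₃ (componentProd var) V * value δ₂ δ₃ (componentProd var) W := by
  have below : ∀ {W : Multiset Atom}, Valid W → Below ⊤ W := fun h => ⟨h, by simp⟩
  induction hn : V.card + W.card using Nat.strong_induction_on generalizing V W with
  | _ n ih =>
    have left : ∀ {V W : Multiset Atom}, Valid (V + W) → Valid V → Valid W → V.card + W.card = n →
        Reducible δ₂ δ₃ V → value δ₂ δ₃ (componentProd var) (V + W) =
          value δ₂ δ₃ (componentProd var) V * value δ₂ δ₃ (componentProd var) W := by
      rintro V W h hV hW hn ⟨T, L, U, hr, rfl⟩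
      rw [add_assoc] at h ⊢
      rw [S.rule T L _ hr (below h), S.rule T L _ hr (below hV), ev, ev, ← List.sum_map_mul_right]
      refine congrArg List.sum (List.map_congr_left fun p hp => ?_)
      have h1 := hr.valid h hp
      have h2 := hr.valid hV hp
      have h3 := hr.card_lt hp
      rw [← add_assoc] at h1 ⊢
      rw [ih _ ?_ h1 h2 hW rfl, mul_assoc]
      simp only [Multiset.card_add] at hn ⊢
      omega
    by_cases h1 : Reducible δ₂ δ₃ V
    · exact left h hV hW hn h1
    by_cases h2 : Reducible δ₂ δ₃ W
    · rw [add_comm V W] at h ⊢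
      rw [left h hW hV (by omega) h2, mul_comm]
    · rw [value_of_not_reducible h1, value_of_not_reducible h2, value_of_not_reducible,
        componentProd_add h hV hW]
      intro h3
      exact (h3.of_add h hV hW).elim h1 h2

end Word

/-! ### The word of a complex with labelled edges -/

open Word

theorem Multiset.exists_eq_triple {s : Multiset ℕ} {x y : ℕ} (hs : s.card = 3) (hx : x ∈ s)
    (hy : y ∈ s) (hxy : x ≠ y) : ∃ z, s = {x, y, z} := by
  obtain ⟨t, rfl⟩ := Multiset.exists_cons_of_mem hx
  obtain ⟨u, rfl⟩ := Multiset.exists_cons_of_mem ((Multiset.mem_cons.1 hy).resolve_left hxy.symm)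
  obtain ⟨z, rfl⟩ := Multiset.card_eq_one.1 (by simpa using hs : u.card = 1)
  exact ⟨z, rfl⟩

theorem Word.Valid.ext {V W : Multiset Atom} (hV : Valid V) (hW : Valid W)
    (h : ∀ a, a ∈ V ↔ a ∈ W) : V = W :=
  (Multiset.Nodup.ext hV.word_nodup hW.word_nodup).2 h

/-- The labels of a set of edges. -/
noncomputable def labels {E : Type} [Finite E] (ℓ : E → ℕ) (s : Set E) : Multiset ℕ :=
  (Set.toFinite s).toFinset.val.map ℓ

section labels

variable {E : Type} [Finite E] {ℓ : E → ℕ} {s t : Set E}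

theorem mem_labels {n : ℕ} : n ∈ labels ℓ s ↔ ∃ e ∈ s, ℓ e = n := by
  simp [labels]

theorem card_labels : (labels ℓ s).card = s.ncard := by
  simp [labels, Set.ncard_eq_toFinset_card s (Set.toFinite s)]

theorem nodup_labels (hℓ : Function.Injective ℓ) : (labels ℓ s).Nodup :=
  (Finset.nodup _).map hℓ

theorem label_mem_labels (hℓ : Function.Injective ℓ) {e : E} : ℓ e ∈ labels ℓ s ↔ e ∈ s := by
  rw [mem_labels]
  constructor
  · rintro ⟨e', h, h'⟩
    rwa [← hℓ h']
  · exact fun h => ⟨e, h, rfl⟩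

theorem labels_eq (hℓ : Function.Injective ℓ) {m : Multiset ℕ} (hm : m.Nodup)
    (h : ∀ n, (∃ e ∈ s, ℓ e = n) ↔ n ∈ m) : labels ℓ s = m :=
  (Multiset.Nodup.ext (nodup_labels hℓ) hm).2 fun n => by rw [mem_labels, h]

theorem map_labels (σ : ℕ → ℕ) : (labels ℓ s).map σ = labels (σ ∘ ℓ) s := by
  simp [labels, Multiset.map_map]

/-- The fibres of `g` partition the edges. Applied to source and target maps this yields the balance
of the word of a complex. -/
theorem sum_labels {V : Type} [Fintype V] (g : E → V) :
    ∑ v, labels ℓ {e | g e = v} = labels ℓ Set.univ := by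
  classical
  have := Fintype.ofFinite E
  have key : ∀ s : Finset E, s.val.map ℓ = ∑ e ∈ s, {ℓ e} := by
    intro s
    rw [← Multiset.sum_map_singleton (s.val.map ℓ), Multiset.map_map]
    rfl
  simp only [labels, key]
  rw [show (Set.toFinite (Set.univ : Set E)).toFinset = Finset.univ by ext; simp,
    ← Finset.sum_fiberwise Finset.univ g fun e => ({ℓ e} : Multiset ℕ)]
  refine Finset.sum_congr rfl fun v _ => Finset.sum_congr ?_ fun _ _ => rfl
  ext
  simp

end labels

namespace Web

variable {G H : Web} {ℓ : G.E → ℕ}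

/-- The vertex `v` with its labels. -/
noncomputable def vertexAtom (G : Web) (ℓ : G.E → ℕ) (v : G.V) : Atom :=
  ⟨labels ℓ {e | G.tgt e = v}, labels ℓ {e | G.src e = v}⟩

/-- The word of a complex with labelled edges. -/
noncomputable def word (G : Web) (ℓ : G.E → ℕ) : Multiset Atom :=
  (Set.toFinite (Set.univ : Set G.V)).toFinset.val.map (G.vertexAtom ℓ)

theorem mem_word {a : Atom} : a ∈ G.word ℓ ↔ ∃ v, G.vertexAtom ℓ v = a := by
  simp [word]

theorem vertexAtom_mem_word (v : G.V) : G.vertexAtom ℓ v ∈ G.word ℓ := mem_word.2 ⟨v, rfl⟩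

theorem word_eq_sum [Fintype G.V] : G.word ℓ = ∑ v, {G.vertexAtom ℓ v} := by
  classical
  rw [word, ← Multiset.sum_map_singleton (Multiset.map _ _), Multiset.map_map]
  change ∑ v ∈ _, _ = _
  congr 1
  ext; simp

theorem ins_word : ins (G.word ℓ) = labels ℓ Set.univ := by
  have := Fintype.ofFinite G.V
  rw [← sum_labels G.tgt, ins, word, Multiset.bind_map]
  change ∑ v ∈ _, _ = _
  congr 1
  ext; simp

theorem outs_word : outs (G.word ℓ) = labels ℓ Set.univ := by
  have := Fintype.ofFinite G.V
  rw [← sum_labels G.src, outs, word, Multiset.bind_map]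
  change ∑ v ∈ _, _ = _
  congr 1
  ext; simp

theorem valid_word (hℓ : Function.Injective ℓ) : Valid (G.word ℓ) := by
  refine ⟨by rw [ins_word, outs_word], by rw [ins_word]; exact nodup_labels hℓ, fun a ha => ?_⟩
  obtain ⟨v, rfl⟩ := mem_word.1 ha
  simp only [Shape, vertexAtom, card_labels]
  have := G.valence v
  tauto

/-- By the valence condition each vertex has an edge, and the label of this edge tells where it
starts or ends. -/
theorem vertexAtom_injective (hℓ : Function.Injective ℓ) :
    Function.Injective (G.vertexAtom ℓ) := by
  intro v w h
  have hv := (valid_word hℓ).shape _ (vertexAtom_mem_word v)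
  have h1 : ∀ e, G.tgt e = v ↔ G.tgt e = w := fun e => by
    have := label_mem_labels hℓ (e := e) (s := {e | G.tgt e = v})
    rw [show labels ℓ {e | G.tgt e = v} = labels ℓ {e | G.tgt e = w} from congrArg Atom.ins h,
      label_mem_labels hℓ] at this
    exact this.symm
  have h2 : ∀ e, G.src e = v ↔ G.src e = w := fun e => by
    have := label_mem_labels hℓ (e := e) (s := {e | G.src e = v})
    rw [show labels ℓ {e | G.src e = v} = labels ℓ {e | G.src e = w} from congrArg Atom.outs h,
      label_mem_labels hℓ] at this
    exact this.symm
  have h3 : 0 < {e | G.tgt e = v}.ncard ∨ 0 < {e | G.src e = v}.ncard := by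
    have := G.valence v
    omega
  rcases h3 with h3 | h3
  · obtain ⟨e, he : G.tgt e = v⟩ := Set.nonempty_of_ncard_ne_zero h3.ne'
    rw [← (h1 e).1 he, he]
  · obtain ⟨e, he : G.src e = v⟩ := Set.nonempty_of_ncard_ne_zero h3.ne'
    rw [← (h2 e).1 he, he]

theorem label_mem_ins (hℓ : Function.Injective ℓ) {e : G.E} {v : G.V} :
    ℓ e ∈ (G.vertexAtom ℓ v).1 ↔ G.tgt e = v := label_mem_labels hℓ

theorem label_mem_outs (hℓ : Function.Injective ℓ) {e : G.E} {v : G.V} :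
    ℓ e ∈ (G.vertexAtom ℓ v).2 ↔ G.src e = v := label_mem_labels hℓ

theorem eq_vertexAtom_src (hℓ : Function.Injective ℓ) {a : Atom} (ha : a ∈ G.word ℓ) {e : G.E}
    (he : ℓ e ∈ a.2) : a = G.vertexAtom ℓ (G.src e) := by
  obtain ⟨v, rfl⟩ := mem_word.1 ha
  rw [(label_mem_outs hℓ).1 he]

theorem eq_vertexAtom_tgt (hℓ : Function.Injective ℓ) {a : Atom} (ha : a ∈ G.word ℓ) {e : G.E}
    (he : ℓ e ∈ a.1) : a = G.vertexAtom ℓ (G.tgt e) := by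
  obtain ⟨v, rfl⟩ := mem_word.1 ha
  rw [(label_mem_ins hℓ).1 he]

theorem exists_label_of_mem_ins {a : Atom} (ha : a ∈ G.word ℓ) {n : ℕ} (hn : n ∈ a.1) :
    ∃ e, ℓ e = n := by
  obtain ⟨v, rfl⟩ := mem_word.1 ha
  obtain ⟨e, -, he⟩ := mem_labels.1 hn
  exact ⟨e, he⟩

theorem exists_label_of_mem_outs {a : Atom} (ha : a ∈ G.word ℓ) {n : ℕ} (hn : n ∈ a.2) :
    ∃ e, ℓ e = n := by
  obtain ⟨v, rfl⟩ := mem_word.1 ha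
  obtain ⟨e, -, he⟩ := mem_labels.1 hn
  exact ⟨e, he⟩

theorem relabel_word (σ : ℕ → ℕ) : relabel σ (G.word ℓ) = G.word (σ ∘ ℓ) := by
  simp only [relabel, word, Multiset.map_map]
  refine Multiset.map_congr rfl fun v _ => ?_
  simp only [Function.comp_apply, relabelAtom, vertexAtom, map_labels]

theorem exists_injective_label (E : Type) [Finite E] : ∃ ℓ : E → ℕ, Function.Injective ℓ := by
  obtain ⟨n, ⟨e⟩⟩ := Finite.exists_equiv_fin E
  exact ⟨fun x => e x, Fin.val_injective.comp e.injective⟩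

/-- The permutations of an infinite set act transitively on tuples of different elements. Hence a
function on words that is invariant under permutations of the labels does not depend on the
labelling of a complex. -/
theorem exists_perm_comp_eq {E : Type} [Finite E] {ℓ ℓ' : E → ℕ} (hℓ : Function.Injective ℓ)
    (hℓ' : Function.Injective ℓ') : ∃ σ : Equiv.Perm ℕ, σ ∘ ℓ = ℓ' := by
  obtain ⟨n, ⟨e⟩⟩ := Finite.exists_equiv_fin E
  obtain ⟨σ, hσ⟩ := (Equiv.Perm.isMultiplyPretransitive ℕ n).exists_smul_eq
    ⟨ℓ ∘ e.symm, hℓ.comp e.symm.injective⟩ ⟨ℓ' ∘ e.symm, hℓ'.comp e.symm.injective⟩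
  refine ⟨σ, funext fun x => ?_⟩
  have := DFunLike.congr_fun hσ (e x)
  simpa using this

/-- Complexes with the same word are isomorphic. -/
theorem iso_of_word_eq {ℓ' : H.E → ℕ} (hℓ : Function.Injective ℓ) (hℓ' : Function.Injective ℓ')
    (h : G.word ℓ = H.word ℓ') : Nonempty (Iso G H) := by
  have hV : ∀ v, ∃ w, H.vertexAtom ℓ' w = G.vertexAtom ℓ v := fun v =>
    mem_word.1 (h ▸ vertexAtom_mem_word v)
  have hV' : ∀ w, ∃ v, G.vertexAtom ℓ v = H.vertexAtom ℓ' w := fun w =>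
    mem_word.1 (h ▸ vertexAtom_mem_word w)
  have hE : ∀ e, ∃ e', ℓ' e' = ℓ e := fun e => by
    obtain ⟨w, hw⟩ := hV (G.src e)
    have := (label_mem_outs hℓ).2 (rfl : G.src e = G.src e)
    rw [← hw] at this
    exact exists_label_of_mem_outs (vertexAtom_mem_word w) this
  have hE' : ∀ e', ∃ e, ℓ e = ℓ' e' := fun e => by
    obtain ⟨w, hw⟩ := hV' (H.src e)
    have := (label_mem_outs hℓ').2 (rfl : H.src e = H.src e)
    rw [← hw] at this
    exact exists_label_of_mem_outs (vertexAtom_mem_word w) this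
  choose f hf using hV
  choose f' hf' using hV'
  choose g hg using hE
  choose g' hg' using hE'
  refine ⟨⟨⟨f, f', fun v => ?_, fun v => ?_⟩, ⟨g, g', fun e => ?_, fun e => ?_⟩, fun e => ?_,
    fun e => ?_⟩⟩
  · exact vertexAtom_injective hℓ (by rw [hf', hf])
  · exact vertexAtom_injective hℓ' (by rw [hf, hf'])
  · exact hℓ (by rw [hg', hg])
  · exact hℓ' (by rw [hg, hg'])
  · refine (label_mem_outs hℓ').1 ?_
    change ℓ' (g e) ∈ (H.vertexAtom ℓ' (f (G.src e))).2
    rw [hf, hg, label_mem_outs hℓ]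
  · refine (label_mem_ins hℓ').1 ?_
    change ℓ' (g e) ∈ (H.vertexAtom ℓ' (f (G.tgt e))).1
    rw [hf, hg, label_mem_ins hℓ]

theorem Iso.word_eq (φ : Iso G H) (ℓ' : H.E → ℕ) : G.word (ℓ' ∘ φ.onE) = H.word ℓ' := by
  classical
  have := Fintype.ofFinite G.V
  have := Fintype.ofFinite H.V
  rw [word_eq_sum, word_eq_sum]
  have key : ∀ s : Set H.E, labels (ℓ' ∘ φ.onE) (φ.onE ⁻¹' s) = labels ℓ' s := fun s => by
    unfold labels
    have : (Set.toFinite s).toFinset = (Set.toFinite (φ.onE ⁻¹' s)).toFinset.map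
        φ.onE.toEmbedding := by
      ext; simp
    rw [this]
    simp [Multiset.map_map]
  refine Fintype.sum_equiv φ.onV _ _ fun v => ?_
  congr 1
  refine Atom.ext ?_ ?_
  · refine Eq.trans ?_ (key _)
    change labels _ _ = labels _ _
    congr 1
    ext e
    simp [φ.tgt_comm]
  · refine Eq.trans ?_ (key _)
    change labels _ _ = labels _ _
    congr 1
    ext e
    simp [φ.src_comm]

/-! ### The complex of a word -/

theorem _root_.Word.Valid.exists_tgt {W : Multiset Atom} (_h : Valid W) (n : {n // n ∈ ins W}) :
    ∃ a : {a // a ∈ W}, n.1 ∈ a.1.1 := by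
  obtain ⟨a, ha, hn⟩ := mem_ins.1 n.2
  exact ⟨⟨a, ha⟩, hn⟩

theorem _root_.Word.Valid.exists_src {W : Multiset Atom} (h : Valid W) (n : {n // n ∈ ins W}) :
    ∃ a : {a // a ∈ W}, n.1 ∈ a.1.2 := by
  obtain ⟨a, ha, hn⟩ := mem_outs.1 (h.bal.subst (motive := fun m => n.1 ∈ m) n.2)
  exact ⟨⟨a, ha⟩, hn⟩

theorem _root_.Word.Valid.tgt_eq_iff {W : Multiset Atom} (h : Valid W) (n : {n // n ∈ ins W})
    (a : {a // a ∈ W}) : (h.exists_tgt n).choose = a ↔ n.1 ∈ a.1.1 := by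
  constructor
  · rintro rfl
    exact (h.exists_tgt n).choose_spec
  · exact fun hn => Subtype.ext (h.eq_of_mem_in (h.exists_tgt n).choose.2 a.2
      (h.exists_tgt n).choose_spec hn)

theorem _root_.Word.Valid.src_eq_iff {W : Multiset Atom} (h : Valid W) (n : {n // n ∈ ins W})
    (a : {a // a ∈ W}) : (h.exists_src n).choose = a ↔ n.1 ∈ a.1.2 := by
  constructor
  · rintro rfl
    exact (h.exists_src n).choose_spec
  · exact fun hn => Subtype.ext (h.eq_of_mem_out (h.exists_src n).choose.2 a.2
      (h.exists_src n).choose_spec hn)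

theorem _root_.Multiset.ncard_mem {m M : Multiset ℕ} (hm : m.Nodup) (h : m ⊆ M) :
    {n : {n // n ∈ M} | n.1 ∈ m}.ncard = m.card := by
  rw [← Set.ncard_image_of_injective _ Subtype.val_injective,
    ← Multiset.toFinset_card_of_nodup hm, ← Set.ncard_coe_finset]
  congr 1
  ext n
  simp only [Set.mem_image, Set.mem_ofPred_eq, Subtype.exists, Finset.mem_coe, Multiset.mem_toFinset]
  constructor
  · rintro ⟨_, _, h, rfl⟩
    exact h
  · exact fun hn => ⟨n, h hn, hn, rfl⟩

/-- The complex of a word. -/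
noncomputable def ofWord (W : Multiset Atom) (h : Valid W) : Web where
  V := {a // a ∈ W}
  E := {n // n ∈ ins W}
  finV := by
    classical
    exact Finite.of_injective (fun a => (⟨a.1, Multiset.mem_toFinset.2 a.2⟩ : {a // a ∈ W.toFinset}))
      fun a b h => by simpa [Subtype.ext_iff] using h
  finE := by
    classical
    exact Finite.of_injective
      (fun a => (⟨a.1, Multiset.mem_toFinset.2 a.2⟩ : {a // a ∈ (ins W).toFinset}))
      fun a b h => by simpa [Subtype.ext_iff] using h
  src := fun n => (h.exists_src n).choose
  tgt := fun n => (h.exists_tgt n).choose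
  valence := fun a => by
    simp only [h.src_eq_iff, h.tgt_eq_iff]
    have hi : a.1.1 ≤ ins W := Multiset.le_bind W a.2
    have ho : a.1.2 ≤ outs W := Multiset.le_bind W a.2
    rw [Multiset.ncard_mem (Multiset.nodup_of_le hi h.nodup) (Multiset.subset_of_le hi),
      Multiset.ncard_mem (Multiset.nodup_of_le ho h.nodup') (h.bal ▸ Multiset.subset_of_le ho)]
    have := h.shape a.1 a.2
    unfold Shape at this
    tauto

/-- The labels of the edges of the complex of a word. -/
def ofWordLabel (W : Multiset Atom) (h : Valid W) : (ofWord W h).E → ℕ := Subtype.val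

theorem ofWordLabel_injective (W : Multiset Atom) (h : Valid W) :
    Function.Injective (ofWordLabel W h) := Subtype.val_injective

theorem word_ofWord {W : Multiset Atom} (h : Valid W) :
    (ofWord W h).word (ofWordLabel W h) = W := by
  refine (valid_word (ofWordLabel_injective W h)).ext h fun a => ?_
  have key : ∀ b : {a // a ∈ W}, (ofWord W h).vertexAtom (ofWordLabel W h) b = b.1 := by
    intro b
    have hi : b.1.1 ≤ ins W := Multiset.le_bind W b.2
    have ho : b.1.2 ≤ outs W := Multiset.le_bind W b.2
    refine Atom.ext (labels_eq (ofWordLabel_injective W h) (Multiset.nodup_of_le hi h.nodup) fun n => ?_)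
      (labels_eq (ofWordLabel_injective W h) (Multiset.nodup_of_le ho h.nodup') fun n => ?_)
    · constructor
      · rintro ⟨e, he, rfl⟩
        exact (h.tgt_eq_iff e b).1 he
      · exact fun hn => ⟨⟨n, Multiset.mem_of_le hi hn⟩, (h.tgt_eq_iff _ b).2 hn, rfl⟩
    · constructor
      · rintro ⟨e, he, rfl⟩
        exact (h.src_eq_iff e b).1 he
      · exact fun hn => ⟨⟨n, h.bal ▸ Multiset.mem_of_le ho hn⟩, (h.src_eq_iff _ b).2 hn, rfl⟩
  rw [mem_word]
  constructor
  · rintro ⟨b, rfl⟩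
    exact Eq.subst (motive := (· ∈ W)) (key b).symm b.2
  · exact fun ha => ⟨⟨a, ha⟩, key _⟩

theorem toGraph_eq_of_word_eq {ℓ' : H.E → ℕ} (hℓ : Function.Injective ℓ)
    (hℓ' : Function.Injective ℓ') (h : G.word ℓ = H.word ℓ') : G.toGraph = H.toGraph :=
  (iso_of_word_eq hℓ hℓ' h).elim fun φ => Quot.sound (.iso φ)

end Web

theorem labels_setOf_eq {E : Type} [Finite E] {ℓ : E → ℕ} (hℓ : Function.Injective ℓ) {p : E → Prop}
    {m : Multiset ℕ} (hm : m.Nodup) (h : ∀ n, (∃ e, p e ∧ ℓ e = n) ↔ n ∈ m) :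
    labels ℓ {e | p e} = m :=
  labels_eq hℓ hm h

theorem labels_comp_eq {E E' : Type} [Finite E] [Finite E'] {ℓ : E → ℕ} (hℓ : Function.Injective ℓ)
    {g : E' → E} (hg : Function.Injective g) {p : E → Prop} {q : E' → Prop}
    (h : ∀ e, p e ↔ ∃ e', q e' ∧ g e' = e) : labels ℓ {e | p e} = labels (ℓ ∘ g) {e | q e} := by
  refine labels_setOf_eq hℓ (nodup_labels (hℓ.comp hg)) fun n => ?_
  rw [mem_labels]
  constructor
  · rintro ⟨e, he, rfl⟩
    obtain ⟨e', he', rfl⟩ := (h e).1 he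
    exact ⟨e', he', rfl⟩
  · rintro ⟨e', he', rfl⟩
    exact ⟨g e', (h _).2 ⟨e', he', rfl⟩, rfl⟩

/-! ### Words of the empty complex, the circle, unions and subdivisions -/

namespace Web

variable {G H : Web}

theorem word_empty (ℓ : empty.E → ℕ) : empty.word ℓ = 0 :=
  Multiset.eq_zero_of_forall_notMem fun _ ha => (mem_word.1 ha).choose.elim

theorem word_circle (ℓ : circle.E → ℕ) : circle.word ℓ = {strand (ℓ ()) (ℓ ())} := by
  have hℓ : Function.Injective ℓ := fun _ _ _ => rfl
  have hF : Fintype circle.V := inferInstanceAs (Fintype Unit)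
  have key : ∀ v, circle.vertexAtom ℓ v = strand (ℓ ()) (ℓ ()) := fun v => by
    refine Atom.ext (labels_setOf_eq hℓ (by simp [strand]) fun n => ?_)
      (labels_setOf_eq hℓ (by simp [strand]) fun n => ?_)
    · simp only [strand, Multiset.mem_singleton]
      exact ⟨fun ⟨e, _, he⟩ => he.symm, fun h => ⟨(), rfl, h.symm⟩⟩
    · simp only [strand, Multiset.mem_singleton]
      exact ⟨fun ⟨e, _, he⟩ => he.symm, fun h => ⟨(), rfl, h.symm⟩⟩
  have hv := valid_word (G := circle) hℓ
  refine (Multiset.Nodup.ext hv.word_nodup (Multiset.nodup_singleton _)).2 fun a => ?_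
  rw [mem_word, Multiset.mem_singleton]
  exact ⟨fun ⟨v, h⟩ => by rw [← h, key], fun h => ⟨(), (key ()).trans h.symm⟩⟩

theorem word_disjUnion {ℓ : (G.disjUnion H).E → ℕ} (hℓ : Function.Injective ℓ) :
    (G.disjUnion H).word ℓ = G.word (ℓ ∘ Sum.inl) + H.word (ℓ ∘ Sum.inr) := by
  have := Fintype.ofFinite G.V
  have := Fintype.ofFinite H.V
  let _ : Fintype (G.disjUnion H).V := inferInstanceAs (Fintype (G.V ⊕ H.V))
  rw [word_eq_sum, word_eq_sum, word_eq_sum]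
  refine (Fintype.sum_sum_type (fun v : G.V ⊕ H.V =>
    ({(G.disjUnion H).vertexAtom ℓ v} : Multiset Atom))).trans ?_
  congr 1
  · refine Finset.sum_congr rfl fun v _ => congrArg _ (Atom.ext ?_ ?_)
    · exact labels_comp_eq hℓ Sum.inl_injective (by rintro (e | e) <;> simp [disjUnion])
    · exact labels_comp_eq hℓ Sum.inl_injective (by rintro (e | e) <;> simp [disjUnion])
  · refine Finset.sum_congr rfl fun v _ => congrArg _ (Atom.ext ?_ ?_)
    · exact labels_comp_eq hℓ Sum.inr_injective (by rintro (e | e) <;> simp [disjUnion])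
    · exact labels_comp_eq hℓ Sum.inr_injective (by rintro (e | e) <;> simp [disjUnion])

/-- The common data `I`, `O`, `U` exhibit the two words as the two sides of `Rule.join`; so
invariance under subdivision is the same as this rule. -/
theorem exists_word_subdivide (e₀ : G.E) {ℓ : (G.subdivide e₀).E → ℕ}
    (hℓ : Function.Injective ℓ) : ∃ I O U,
      G.word (ℓ ∘ some) = {Atom.mk (ℓ (some e₀) ::ₘ I) O} + U ∧
      (G.subdivide e₀).word ℓ =
        {strand (ℓ (some e₀)) (ℓ none), Atom.mk (ℓ none ::ₘ I) O} + U := by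
  classical
  have := Fintype.ofFinite G.V
  let _ : Fintype (G.subdivide e₀).V := inferInstanceAs (Fintype (Option G.V))
  have hs : Function.Injective (ℓ ∘ some) := hℓ.comp (Option.some_injective _)
  set I := labels (ℓ ∘ some) ({e | G.tgt e = G.tgt e₀} \ {e₀}) with hI
  set O := labels (ℓ ∘ some) {e | G.src e = G.tgt e₀} with hO
  refine ⟨I, O, ∑ v ∈ Finset.univ.erase (G.tgt e₀), {G.vertexAtom (ℓ ∘ some) v}, ?_, ?_⟩
  · rw [word_eq_sum, ← Finset.add_sum_erase _ _ (Finset.mem_univ (G.tgt e₀))]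
    congr 2
    refine Atom.ext (labels_setOf_eq hs ?_ fun n => ?_) rfl
    · refine Multiset.nodup_cons.2 ⟨fun h => ?_, nodup_labels hs⟩
      exact ((label_mem_labels hs (e := e₀)).1 h).2 rfl
    · rw [Multiset.mem_cons, hI, mem_labels]
      constructor
      · rintro ⟨e, he, rfl⟩
        by_cases h : e = e₀
        · subst h; exact Or.inl rfl
        · exact Or.inr ⟨e, ⟨he, h⟩, rfl⟩
      · rintro (rfl | ⟨e, he, rfl⟩)
        exacts [⟨e₀, rfl, rfl⟩, ⟨e, he.1, rfl⟩]
  · rw [word_eq_sum]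
    refine (Fintype.sum_option (fun v : Option G.V =>
      ({(G.subdivide e₀).vertexAtom ℓ v} : Multiset Atom))).trans ?_
    rw [← Finset.add_sum_erase _ _ (Finset.mem_univ (G.tgt e₀)), ← add_assoc]
    have h1 : (G.subdivide e₀).vertexAtom ℓ none = strand (ℓ (some e₀)) (ℓ none) := by
      refine Atom.ext (labels_setOf_eq hℓ (by simp [strand]) fun n => ?_)
        (labels_setOf_eq hℓ (by simp [strand]) fun n => ?_)
      · constructor
        · rintro ⟨_ | e, he, rfl⟩
          · simp [subdivide] at he
          · by_cases h : e = e₀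
            · subst h; simp [strand]
            · simp [subdivide, h] at he
        · intro h
          simp only [strand, Multiset.mem_singleton] at h
          exact ⟨some e₀, by simp [subdivide], h.symm⟩
      · constructor
        · rintro ⟨_ | e, he, rfl⟩
          · simp [strand]
          · simp [subdivide] at he
        · intro h
          simp only [strand, Multiset.mem_singleton] at h
          exact ⟨none, by simp [subdivide], h.symm⟩
    have h2 : (G.subdivide e₀).vertexAtom ℓ (some (G.tgt e₀)) = Atom.mk (ℓ none ::ₘ I) O := by
      refine Atom.ext (labels_setOf_eq hℓ ?_ fun n => ?_)
        (labels_comp_eq hℓ (Option.some_injective _) (by rintro (_ | e) <;> simp [subdivide]))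
      · refine Multiset.nodup_cons.2 ⟨fun h => ?_, nodup_labels hs⟩
        obtain ⟨e, -, he⟩ := mem_labels.1 h
        exact Option.some_ne_none _ (hℓ he)
      · rw [Multiset.mem_cons, hI, mem_labels]
        constructor
        · rintro ⟨_ | e, he, rfl⟩
          · exact Or.inl rfl
          · by_cases h : e = e₀
            · subst h; simp [subdivide] at he
            · exact Or.inr ⟨e, ⟨by simpa [subdivide, h] using he, h⟩, rfl⟩
        · rintro (rfl | ⟨e, he, rfl⟩)
          · exact ⟨none, by simp [subdivide], rfl⟩
          · refine ⟨some e, ?_, rfl⟩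
            have h : e ≠ e₀ := he.2
            have h' : G.tgt e = G.tgt e₀ := he.1
            simp [subdivide, h, h']
    have h3 : ∀ v ∈ Finset.univ.erase (G.tgt e₀), (G.subdivide e₀).vertexAtom ℓ (some v) =
        G.vertexAtom (ℓ ∘ some) v := by
      intro v hv
      have hv' := Finset.ne_of_mem_erase hv
      refine Atom.ext (labels_comp_eq hℓ (Option.some_injective _) ?_)
        (labels_comp_eq hℓ (Option.some_injective _) (by rintro (_ | e) <;> simp [subdivide]))
      rintro (_ | e)
      · simp [subdivide, Ne.symm hv']
      · by_cases h : e = e₀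
        · subst h; simp [subdivide, Ne.symm hv']
        · simp [subdivide, h]
    congr 1
    · rw [h1, h2]
      rfl
    · exact Finset.sum_congr rfl fun v hv => by rw [h3 v hv]

/-! ### Words of resolutions -/

theorem exists_vertexAtom_src {ℓ : G.E → ℕ} (hℓ : Function.Injective ℓ) {e₁ e₂ : G.E}
    (hne : e₁ ≠ e₂) (h : G.src e₂ = G.src e₁) :
    ∃ o, G.vertexAtom ℓ (G.src e₁) = Word.src (ℓ e₁) (ℓ e₂) o := by
  have h1 : ℓ e₁ ∈ (G.vertexAtom ℓ (G.src e₁)).2 := (label_mem_outs hℓ).2 rfl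
  have h2 : ℓ e₂ ∈ (G.vertexAtom ℓ (G.src e₁)).2 := (label_mem_outs hℓ).2 h
  have hc := two_le_out hne h
  obtain ⟨o, ho⟩ := Multiset.exists_eq_triple (card_labels.trans hc.1) h1 h2 (hℓ.ne hne)
  exact ⟨o, Atom.ext (Multiset.card_eq_zero.1 (card_labels.trans hc.2)) ho⟩

theorem exists_vertexAtom_tgt {ℓ : G.E → ℕ} (hℓ : Function.Injective ℓ) {e₁ e₂ : G.E}
    (hne : e₁ ≠ e₂) (h : G.tgt e₂ = G.tgt e₁) :
    ∃ i, G.vertexAtom ℓ (G.tgt e₁) = Word.snk (ℓ e₁) (ℓ e₂) i := by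
  have h1 : ℓ e₁ ∈ (G.vertexAtom ℓ (G.tgt e₁)).1 := (label_mem_ins hℓ).2 rfl
  have h2 : ℓ e₂ ∈ (G.vertexAtom ℓ (G.tgt e₁)).1 := (label_mem_ins hℓ).2 h
  have hc := two_le_in hne h
  obtain ⟨o, ho⟩ := Multiset.exists_eq_triple (card_labels.trans hc.2) h1 h2 (hℓ.ne hne)
  exact ⟨o, Atom.ext ho (Multiset.card_eq_zero.1 (card_labels.trans hc.1))⟩

variable {ℓ : G.E → ℕ} (hℓ : Function.Injective ℓ)
include hℓ

theorem Bigon.exists_word (B : G.Bigon) : ∃ i o U,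
    G.word ℓ = {Word.src (ℓ B.e₁) (ℓ B.e₂) o, Word.snk (ℓ B.e₁) (ℓ B.e₂) i} + U := by
  obtain ⟨o, ho⟩ := exists_vertexAtom_src hℓ B.ne B.src_eq
  obtain ⟨i, hi⟩ := exists_vertexAtom_tgt hℓ B.ne B.tgt_eq
  refine ⟨i, o, ?_⟩
  rw [← ho, ← hi]
  refine Multiset.le_iff_exists_add.1 ((Multiset.le_iff_subset ?_).2 ?_)
  · simpa using (vertexAtom_injective hℓ).ne B.src_ne_tgt
  · simp [Multiset.subset_iff, vertexAtom_mem_word]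

-- The part of `W` not met by the complex has no labels left, and vertices without labels are
-- excluded by `Shape`. This avoids listing the vertices of a resolution.
omit hℓ in
theorem word_eq_of_forall_mem {W : Multiset Atom} (hW : Valid W) {ℓ : G.E → ℕ}
    (hℓ : Function.Injective ℓ) (h : ∀ v, G.vertexAtom ℓ v ∈ W)
    (hl : ∀ n ∈ ins W, ∃ e, ℓ e = n) : G.word ℓ = W := by
  have hle : G.word ℓ ≤ W := (Multiset.le_iff_subset (valid_word hℓ).word_nodup).2 fun a ha => by
    obtain ⟨v, rfl⟩ := mem_word.1 ha
    exact h v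
  obtain ⟨X, rfl⟩ := Multiset.le_iff_exists_add.1 hle
  have hX := hW.of_add_right (valid_word hℓ)
  have hX0 : ins X = 0 := Multiset.eq_zero_of_forall_notMem fun n hn => by
    obtain ⟨e, rfl⟩ := hl n (by simp [hn])
    have hd := hW.nodup
    rw [ins_add, Multiset.nodup_add] at hd
    exact Multiset.disjoint_left.1 hd.2.2 (by rw [ins_word, label_mem_labels hℓ]; trivial) hn
  suffices X = 0 by rw [this, add_zero]
  refine Multiset.eq_zero_of_forall_notMem fun a ha => ?_
  have h1 : a.1 ≤ ins X := Multiset.le_bind X ha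
  have h2 : a.2 ≤ outs X := Multiset.le_bind X ha
  rw [hX0] at h1
  rw [← hX.bal, hX0] at h2
  have := hX.shape a ha
  simp [Shape, Multiset.le_zero.1 h1, Multiset.le_zero.1 h2] at this

omit hℓ in
theorem Bigon.fuse_eq_iff (B : G.Bigon) (w : G.V) (v : {v : G.V // v ≠ G.tgt B.e₁}) :
    B.fuse w = v ↔ w = v.1 ∨ w = G.tgt B.e₁ ∧ v.1 = G.src B.e₁ := by
  obtain ⟨v, hv⟩ := v
  unfold fuse
  split_ifs with h
  · subst h
    simp [Ne.symm hv, eq_comm]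
  · simp [h]

/-- The labels of a resolution. -/
def Bigon.resolveLabel (B : G.Bigon) (ℓ : G.E → ℕ) : B.resolve.E → ℕ := ℓ ∘ Subtype.val

theorem Bigon.resolveLabel_injective (B : G.Bigon) : Function.Injective (B.resolveLabel ℓ) :=
  hℓ.comp Subtype.val_injective

/-- The merged vertex keeps the third edge of the sink as its incoming edge and that of the source
as its outgoing one; all other vertices keep their labels. -/
theorem Bigon.word_resolve (B : G.Bigon) {i o : ℕ} {U : Multiset Atom}
    (h : G.word ℓ = {Word.src (ℓ B.e₁) (ℓ B.e₂) o, Word.snk (ℓ B.e₁) (ℓ B.e₂) i} + U) :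
    B.resolve.word (B.resolveLabel ℓ) = {strand i o} + U := by
  have hv := valid_word hℓ (G := G)
  have hv' := h ▸ hv
  have hs : Function.Injective (Subtype.val : B.resolve.E → G.E) := Subtype.val_injective
  have hsrc : Word.src (ℓ B.e₁) (ℓ B.e₂) o = G.vertexAtom ℓ (G.src B.e₁) :=
    eq_vertexAtom_src hℓ (by rw [h]; simp) (by simp [Word.src])
  have hsnk : Word.snk (ℓ B.e₁) (ℓ B.e₂) i = G.vertexAtom ℓ (G.tgt B.e₁) :=
    eq_vertexAtom_tgt hℓ (by rw [h]; simp) (by simp [Word.snk])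
  obtain ⟨eo, rfl⟩ : ∃ e, ℓ e = o := exists_label_of_mem_outs
    (a := Word.src (ℓ B.e₁) (ℓ B.e₂) o) (by rw [h]; simp) (by simp [Word.src])
  obtain ⟨ei, rfl⟩ : ∃ e, ℓ e = i := exists_label_of_mem_ins
    (a := Word.snk (ℓ B.e₁) (ℓ B.e₂) i) (by rw [h]; simp) (by simp [Word.snk])
  have hins : ins ({Word.src (ℓ B.e₁) (ℓ B.e₂) (ℓ eo), Word.snk (ℓ B.e₁) (ℓ B.e₂) (ℓ ei)} + U) =
      ins ({strand (ℓ ei) (ℓ eo)} + U) + {ℓ B.e₁, ℓ B.e₂} := by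
    simp only [Word.src, Word.snk, strand, Multiset.insert_eq_cons, ← Multiset.singleton_add,
      ins_add, ins_singleton, zero_add]
    abel
  have hV : Valid ({strand (ℓ ei) (ℓ eo)} + U) := by
    refine hv'.replace {ℓ B.e₁, ℓ B.e₂} ?_ ?_ (by simp [shape_strand])
    · simp only [Word.src, Word.snk, strand, Multiset.insert_eq_cons, ← Multiset.singleton_add,
        ins_add, ins_singleton, zero_add]
      abel
    · simp only [Word.src, Word.snk, strand, Multiset.insert_eq_cons, ← Multiset.singleton_add,
        outs_add, outs_singleton, add_zero]
      abel
  have hso : ∀ e, G.src e = G.src B.e₁ ↔ e = B.e₁ ∨ e = B.e₂ ∨ e = eo := fun e => by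
    rw [← label_mem_outs hℓ, ← hsrc]
    simp [Word.src, hℓ.eq_iff]
  have hti : ∀ e, G.tgt e = G.tgt B.e₁ ↔ e = B.e₁ ∨ e = B.e₂ ∨ e = ei := fun e => by
    rw [← label_mem_ins hℓ, ← hsnk]
    simp [Word.snk, hℓ.eq_iff]
  have hnt : ∀ e, G.tgt e ≠ G.src B.e₁ := fun e => by
    rw [Ne, ← label_mem_ins hℓ, ← hsrc]
    simp [Word.src]
  have hno : ∀ n ∈ ins ({strand (ℓ ei) (ℓ eo)} + U), n ≠ ℓ B.e₁ ∧ n ≠ ℓ B.e₂ := fun n hn => by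
    have hd := hv'.nodup
    rw [hins, Multiset.nodup_add] at hd
    have := Multiset.disjoint_left.1 hd.2.2 hn
    simpa using this
  have hei := hno (ℓ ei) (by simp [strand])
  have heo := hno (ℓ eo) (by rw [hV.bal]; simp [strand])
  rw [hℓ.ne_iff, hℓ.ne_iff] at hei heo
  refine word_eq_of_forall_mem hV (hℓ.comp hs) (fun v => ?_) fun n hn => ?_
  · obtain ⟨v, hvt⟩ := v
    by_cases hvs : v = G.src B.e₁
    · subst hvs
      refine Multiset.mem_add.2 (Or.inl (Multiset.mem_singleton.2 (Atom.ext
        (labels_setOf_eq (hℓ.comp hs) (by simp [strand]) fun n => ?_)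
        (labels_setOf_eq (hℓ.comp hs) (by simp [strand]) fun n => ?_))))
      · simp only [strand, Multiset.mem_singleton]
        constructor
        · rintro ⟨e, he, rfl⟩
          have := (B.fuse_eq_iff _ _).1 he
          simp only [hnt, and_true, false_or, hti, e.2.1, e.2.2] at this
          simp [this]
        · rintro rfl
          exact ⟨⟨ei, hei⟩, (B.fuse_eq_iff _ _).2 (by simp [hti]), rfl⟩
      · simp only [strand, Multiset.mem_singleton]
        constructor
        · rintro ⟨e, he, rfl⟩
          have := congrArg Subtype.val he
          change (B.fuse (G.src e.1)).1 = _ at this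
          rw [B.fuse_src, hso] at this
          simp [this.resolve_left e.2.1 |>.resolve_left e.2.2]
        · rintro rfl
          exact ⟨⟨eo, heo⟩, Subtype.ext ((B.fuse_src _).trans (by simp [hso])), rfl⟩
    · have hmem := vertexAtom_mem_word (ℓ := ℓ) v
      rw [h, hsrc, hsnk] at hmem
      simp only [Multiset.mem_add, Multiset.insert_eq_cons, Multiset.mem_cons,
        Multiset.mem_singleton, (vertexAtom_injective hℓ).eq_iff, hvs, hvt, false_or] at hmem
      refine Multiset.mem_add.2 (Or.inr (Eq.subst (motive := (· ∈ U)) (Atom.ext ?_ ?_) hmem))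
      · refine labels_comp_eq hℓ hs fun e => ⟨fun he => ⟨⟨e, ?_, ?_⟩, ?_, rfl⟩, ?_⟩
        · rintro rfl
          exact hvt he.symm
        · rintro rfl
          exact hvt (he.symm.trans B.tgt_eq)
        · exact (B.fuse_eq_iff _ _).2 (Or.inl he)
        · rintro ⟨e, he, rfl⟩
          exact ((B.fuse_eq_iff _ _).1 he).resolve_right fun h => hvs h.2
      · refine labels_comp_eq hℓ hs fun e => ⟨fun he => ⟨⟨e, ?_, ?_⟩, ?_, rfl⟩, ?_⟩
        · rintro rfl
          exact hvs he.symm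
        · rintro rfl
          exact hvs (he.symm.trans B.src_eq)
        · exact Subtype.ext ((B.fuse_src _).trans he)
        · rintro ⟨e, he, rfl⟩
          exact (B.fuse_src _).symm.trans (congrArg Subtype.val he)
  · have : n ∈ ins (G.word ℓ) := by
      rw [h, hins]
      exact Multiset.mem_add.2 (Or.inl hn)
    rw [ins_word] at this
    obtain ⟨e, -, rfl⟩ := mem_labels.1 this
    have := hno _ hn
    rw [hℓ.ne_iff, hℓ.ne_iff] at this
    exact ⟨⟨e, this⟩, rfl⟩

end Web

namespace Web

variable {G H : Web}

namespace Quad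

theorem a₂_ne_b₂ (Q : G.Quad) : Q.a₂ ≠ Q.b₂ := Q.flip.a_ne_b

theorem fuse_eq_iff (Q : G.Quad) (w : G.V) (v : {v : G.V // v ≠ Q.b₁ ∧ v ≠ Q.b₂}) :
    Q.fuse w = v ↔ w = v.1 ∨ w = Q.b₁ ∧ v.1 = Q.a₁ ∨ w = Q.b₂ ∧ v.1 = Q.a₂ := by
  obtain ⟨v, hv, hv'⟩ := v
  unfold fuse
  split_ifs with h h'
  · subst h
    simp [Ne.symm hv, eq_comm, Q.ne_b]
  · subst h'
    simp [Ne.symm hv', eq_comm, Q.ne_b]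
  · simp [h, h']

variable {ℓ : G.E → ℕ}

theorem exists_word (hℓ : Function.Injective ℓ) (Q : G.Quad) : ∃ o₁ o₂ i₁ i₂ U, G.word ℓ =
    quadWord (ℓ Q.e₁₁) (ℓ Q.e₁₂) (ℓ Q.e₂₁) (ℓ Q.e₂₂) o₁ o₂ i₁ i₂ + U := by
  obtain ⟨o₁, ho₁⟩ := exists_vertexAtom_src hℓ Q.ne_row (by rw [Q.src₁₁, Q.src₁₂])
  obtain ⟨o₂, ho₂⟩ := exists_vertexAtom_src hℓ Q.flip.swap.ne_row (by simp [swap, flip, Q.src₂₁, Q.src₂₂])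
  obtain ⟨i₁, hi₁⟩ := exists_vertexAtom_tgt hℓ Q.ne_col (by rw [Q.tgt₁₁, Q.tgt₂₁])
  obtain ⟨i₂, hi₂⟩ := exists_vertexAtom_tgt hℓ Q.swap.ne_col (by simp [swap, Q.tgt₁₂, Q.tgt₂₂])
  simp only [swap, flip] at ho₂ hi₂
  refine ⟨o₁, o₂, i₁, i₂, ?_⟩
  rw [quadWord, ← ho₁, ← ho₂, ← hi₁, ← hi₂, Q.src₁₁, Q.src₂₁, Q.tgt₁₁, Q.tgt₁₂]
  have h1 : Q.a₂ ≠ Q.b₁ := Q.flip.swap.a_ne_b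
  have h2 : Q.a₁ ≠ Q.b₂ := Q.swap.a_ne_b
  refine Multiset.le_iff_exists_add.1 ((Multiset.le_iff_subset ?_).2 ?_)
  · simp [(vertexAtom_injective hℓ).eq_iff, Q.a_ne_b, Q.a₂_ne_b₂, Q.ne_a, Q.ne_b, h1, h2]
  · simp [Multiset.subset_iff, vertexAtom_mem_word]

/-- The labels of a resolution. -/
def resolveLabel (Q : G.Quad) (ℓ : G.E → ℕ) : Q.resolve.E → ℕ := ℓ ∘ Subtype.val

theorem resolveLabel_injective (hℓ : Function.Injective ℓ) (Q : G.Quad) :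
    Function.Injective (Q.resolveLabel ℓ) :=
  hℓ.comp Subtype.val_injective

/-- One vertex that arises by merging a source `v` with a sink `b`; the form with free side names
serves for both pairs of a quadrilateral. -/
theorem vertexAtom_resolve (hℓ : Function.Injective ℓ) (Q : G.Quad)
    (v : {v : G.V // v ≠ Q.b₁ ∧ v ≠ Q.b₂}) {e e' f f' eo ei : G.E} {b : G.V}
    (hf : ∀ w, Q.fuse w = v ↔ w = v.1 ∨ w = b) (hv : ∀ e, G.tgt e ≠ v.1)
    (hs : ∀ x, G.src x = v.1 ↔ x = e ∨ x = e' ∨ x = eo)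
    (ht : ∀ x, G.tgt x = b ↔ x = f ∨ x = f' ∨ x = ei)
    (he : ∀ x, Q.Off x → x ≠ e ∧ x ≠ e' ∧ x ≠ f ∧ x ≠ f') (ho : Q.Off eo) (hi : Q.Off ei) :
    Q.resolve.vertexAtom (Q.resolveLabel ℓ) v = strand (ℓ ei) (ℓ eo) := by
  have hsub : Function.Injective (Subtype.val : Q.resolve.E → G.E) := Subtype.val_injective
  refine Atom.ext (labels_setOf_eq (hℓ.comp hsub) (by simp [strand]) fun n => ?_)
        (labels_setOf_eq (hℓ.comp hsub) (by simp [strand]) fun n => ?_)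
  · simp only [strand, Multiset.mem_singleton]
    constructor
    · rintro ⟨x, hx, rfl⟩
      have := ((hf _).1 hx).resolve_left (hv _)
      rw [ht] at this
      have h' := he _ x.2
      simp [(this.resolve_left h'.2.2.1).resolve_left h'.2.2.2]
    · rintro rfl
      exact ⟨⟨ei, hi⟩, (hf _).2 (Or.inr ((ht _).2 (Or.inr (Or.inr rfl)))), rfl⟩
  · simp only [strand, Multiset.mem_singleton]
    constructor
    · rintro ⟨x, hx, rfl⟩
      have := (Q.fuse_src x.1).symm.trans (congrArg Subtype.val hx)
      rw [hs] at this
      have h' := he _ x.2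
      simp [(this.resolve_left h'.1).resolve_left h'.2.1]
    · rintro rfl
      exact ⟨⟨eo, ho⟩, Subtype.ext ((Q.fuse_src _).trans (by simp [hs])), rfl⟩

theorem word_resolve (hℓ : Function.Injective ℓ) (Q : G.Quad) {o₁ o₂ i₁ i₂ : ℕ} {U : Multiset Atom}
    (h : G.word ℓ =
      quadWord (ℓ Q.e₁₁) (ℓ Q.e₁₂) (ℓ Q.e₂₁) (ℓ Q.e₂₂) o₁ o₂ i₁ i₂ + U) :
    Q.resolve.word (Q.resolveLabel ℓ) = {strand i₁ o₁, strand i₂ o₂} + U := by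
  have hv := valid_word hℓ (G := G)
  have hv' := h ▸ hv
  have hs : Function.Injective (Subtype.val : Q.resolve.E → G.E) := Subtype.val_injective
  have hsrc₁ : Word.src (ℓ Q.e₁₁) (ℓ Q.e₁₂) o₁ = G.vertexAtom ℓ Q.a₁ := by
    rw [← Q.src₁₁]
    exact eq_vertexAtom_src hℓ (by rw [h]; simp [quadWord]) (by simp [Word.src])
  have hsrc₂ : Word.src (ℓ Q.e₂₁) (ℓ Q.e₂₂) o₂ = G.vertexAtom ℓ Q.a₂ := by
    rw [← Q.src₂₁]
    exact eq_vertexAtom_src hℓ (by rw [h]; simp [quadWord]) (by simp [Word.src])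
  have hsnk₁ : Word.snk (ℓ Q.e₁₁) (ℓ Q.e₂₁) i₁ = G.vertexAtom ℓ Q.b₁ := by
    rw [← Q.tgt₁₁]
    exact eq_vertexAtom_tgt hℓ (by rw [h]; simp [quadWord]) (by simp [Word.snk])
  have hsnk₂ : Word.snk (ℓ Q.e₁₂) (ℓ Q.e₂₂) i₂ = G.vertexAtom ℓ Q.b₂ := by
    rw [← Q.tgt₁₂]
    exact eq_vertexAtom_tgt hℓ (by rw [h]; simp [quadWord]) (by simp [Word.snk])
  obtain ⟨p₁, rfl⟩ : ∃ e, ℓ e = o₁ := exists_label_of_mem_outs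
    (a := Word.src (ℓ Q.e₁₁) (ℓ Q.e₁₂) o₁) (by rw [h]; simp [quadWord]) (by simp [Word.src])
  obtain ⟨p₂, rfl⟩ : ∃ e, ℓ e = o₂ := exists_label_of_mem_outs
    (a := Word.src (ℓ Q.e₂₁) (ℓ Q.e₂₂) o₂) (by rw [h]; simp [quadWord]) (by simp [Word.src])
  obtain ⟨q₁, rfl⟩ : ∃ e, ℓ e = i₁ := exists_label_of_mem_ins
    (a := Word.snk (ℓ Q.e₁₁) (ℓ Q.e₂₁) i₁) (by rw [h]; simp [quadWord]) (by simp [Word.snk])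
  obtain ⟨q₂, rfl⟩ : ∃ e, ℓ e = i₂ := exists_label_of_mem_ins
    (a := Word.snk (ℓ Q.e₁₂) (ℓ Q.e₂₂) i₂) (by rw [h]; simp [quadWord]) (by simp [Word.snk])
  have hins : ins (quadWord (ℓ Q.e₁₁) (ℓ Q.e₁₂) (ℓ Q.e₂₁) (ℓ Q.e₂₂) (ℓ p₁) (ℓ p₂) (ℓ q₁) (ℓ q₂) + U) =
      ins ({strand (ℓ q₁) (ℓ p₁), strand (ℓ q₂) (ℓ p₂)} + U) +
        {ℓ Q.e₁₁, ℓ Q.e₁₂, ℓ Q.e₂₁, ℓ Q.e₂₂} := by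
    simp only [quadWord, Word.src, Word.snk, strand, Multiset.insert_eq_cons,
      ← Multiset.singleton_add, ins_add, ins_singleton, zero_add]
    abel
  have hV : Valid ({strand (ℓ q₁) (ℓ p₁), strand (ℓ q₂) (ℓ p₂)} + U) :=
    -- Only the validity of the right side is used, for which the scalars are irrelevant.
    (Rule.quad (δ₂ := (0 : ℤ)) (δ₃ := 0) _ _ _ _ _ _ _ _).valid hv' (p := (1, _)) (by simp)
  have hso₁ : ∀ e, G.src e = Q.a₁ ↔ e = Q.e₁₁ ∨ e = Q.e₁₂ ∨ e = p₁ := fun e => by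
    rw [← label_mem_outs hℓ, ← hsrc₁]
    simp [Word.src, hℓ.eq_iff]
  have hso₂ : ∀ e, G.src e = Q.a₂ ↔ e = Q.e₂₁ ∨ e = Q.e₂₂ ∨ e = p₂ := fun e => by
    rw [← label_mem_outs hℓ, ← hsrc₂]
    simp [Word.src, hℓ.eq_iff]
  have hti₁ : ∀ e, G.tgt e = Q.b₁ ↔ e = Q.e₁₁ ∨ e = Q.e₂₁ ∨ e = q₁ := fun e => by
    rw [← label_mem_ins hℓ, ← hsnk₁]
    simp [Word.snk, hℓ.eq_iff]
  have hti₂ : ∀ e, G.tgt e = Q.b₂ ↔ e = Q.e₁₂ ∨ e = Q.e₂₂ ∨ e = q₂ := fun e => by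
    rw [← label_mem_ins hℓ, ← hsnk₂]
    simp [Word.snk, hℓ.eq_iff]
  have hno : ∀ e, ℓ e ∈ ins ({strand (ℓ q₁) (ℓ p₁), strand (ℓ q₂) (ℓ p₂)} + U) → Q.Off e :=
    fun e he => by
      have hd := hv'.nodup
      rw [hins, Multiset.nodup_add] at hd
      have := Multiset.disjoint_left.1 hd.2.2 he
      simpa [Off, hℓ.eq_iff] using this
  have hq₁ := hno q₁ (by simp [strand])
  have hq₂ := hno q₂ (by simp [strand])
  have hp₁ := hno p₁ (by rw [hV.bal]; simp [strand])
  have hp₂ := hno p₂ (by rw [hV.bal]; simp [strand])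
  refine word_eq_of_forall_mem hV (hℓ.comp hs) (fun v => ?_) fun n hn => ?_
  · obtain ⟨v, hv₁, hv₂⟩ := v
    by_cases ha₁ : v = Q.a₁
    · subst ha₁
      have := vertexAtom_resolve hℓ Q ⟨Q.a₁, hv₁, hv₂⟩ (b := Q.b₁)
        (fun w => by simp [Q.fuse_eq_iff, Q.ne_a]) Q.tgt_ne hso₁ hti₁
        (by simp only [Off]; tauto) hp₁ hq₁
      refine Multiset.mem_add.2 (Or.inl ?_)
      rw [Multiset.insert_eq_cons, Multiset.mem_cons]
      exact Or.inl this
    by_cases ha₂ : v = Q.a₂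
    · subst ha₂
      have := vertexAtom_resolve hℓ Q ⟨Q.a₂, hv₁, hv₂⟩ (b := Q.b₂)
        (fun w => by simp [Q.fuse_eq_iff, Q.ne_a.symm]) Q.flip.tgt_ne hso₂ hti₂
        (by simp only [Off]; tauto) hp₂ hq₂
      refine Multiset.mem_add.2 (Or.inl ?_)
      rw [Multiset.insert_eq_cons, Multiset.mem_cons, Multiset.mem_singleton]
      exact Or.inr this
    · have hmem := vertexAtom_mem_word (ℓ := ℓ) v
      rw [h, quadWord, hsrc₁, hsrc₂, hsnk₁, hsnk₂] at hmem
      simp only [Multiset.mem_add, Multiset.insert_eq_cons, Multiset.mem_cons,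
        Multiset.mem_singleton, (vertexAtom_injective hℓ).eq_iff, hv₁, hv₂, ha₁, ha₂,
        false_or] at hmem
      refine Multiset.mem_add.2 (Or.inr (Eq.subst (motive := (· ∈ U)) (Atom.ext ?_ ?_) hmem))
      · refine labels_comp_eq hℓ hs fun e => ⟨fun he => ⟨⟨e, ?_⟩, ?_, rfl⟩, ?_⟩
        · refine ⟨?_, ?_, ?_, ?_⟩ <;> rintro rfl
          · exact hv₁ (he.symm.trans Q.tgt₁₁)
          · exact hv₂ (he.symm.trans Q.tgt₁₂)
          · exact hv₁ (he.symm.trans Q.tgt₂₁)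
          · exact hv₂ (he.symm.trans Q.tgt₂₂)
        · exact (Q.fuse_eq_iff _ _).2 (Or.inl he)
        · rintro ⟨e, he, rfl⟩
          exact ((Q.fuse_eq_iff _ _).1 he).resolve_right fun h =>
            h.elim (fun h => ha₁ h.2) fun h => ha₂ h.2
      · refine labels_comp_eq hℓ hs fun e => ⟨fun he => ⟨⟨e, ?_⟩, ?_, rfl⟩, ?_⟩
        · refine ⟨?_, ?_, ?_, ?_⟩ <;> rintro rfl
          · exact ha₁ (he.symm.trans Q.src₁₁)
          · exact ha₁ (he.symm.trans Q.src₁₂)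
          · exact ha₂ (he.symm.trans Q.src₂₁)
          · exact ha₂ (he.symm.trans Q.src₂₂)
        · exact Subtype.ext ((Q.fuse_src _).trans he)
        · rintro ⟨e, he, rfl⟩
          exact (Q.fuse_src _).symm.trans (congrArg Subtype.val he)
  · have : n ∈ ins (G.word ℓ) := by
      rw [h, hins]
      exact Multiset.mem_add.2 (Or.inl hn)
    rw [ins_word] at this
    obtain ⟨e, -, rfl⟩ := mem_labels.1 this
    exact ⟨⟨e, hno _ hn⟩, rfl⟩

end Quad

/-! ### Bigons and quadrilaterals of words -/

variable {ℓ : G.E → ℕ} (hℓ : Function.Injective ℓ)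
include hℓ

theorem exists_bigon {x y i o : ℕ} {U : Multiset Atom}
    (h : G.word ℓ = {Word.src x y o, Word.snk x y i} + U) :
    ∃ B : G.Bigon, ℓ B.e₁ = x ∧ ℓ B.e₂ = y := by
  have h1 : Word.src x y o ∈ G.word ℓ := by rw [h]; simp
  have h2 : Word.snk x y i ∈ G.word ℓ := by rw [h]; simp
  obtain ⟨e₁, rfl⟩ := exists_label_of_mem_outs h1 (n := x) (by simp [Word.src])
  obtain ⟨e₂, rfl⟩ := exists_label_of_mem_outs h1 (n := y) (by simp [Word.src])
  have hs := vertexAtom_injective hℓ ((eq_vertexAtom_src hℓ h1 (e := e₁) (by simp [Word.src])).symm.trans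
    (eq_vertexAtom_src hℓ h1 (e := e₂) (by simp [Word.src])))
  have ht := vertexAtom_injective hℓ ((eq_vertexAtom_tgt hℓ h2 (e := e₁) (by simp [Word.snk])).symm.trans
    (eq_vertexAtom_tgt hℓ h2 (e := e₂) (by simp [Word.snk])))
  refine ⟨⟨e₁, e₂, ?_, hs.symm, ht.symm⟩, rfl, rfl⟩
  rintro rfl
  have := (valid_word hℓ (G := G)).nodup'
  rw [h] at this
  simp [Word.src] at this

theorem exists_quad {x₁₁ x₁₂ x₂₁ x₂₂ o₁ o₂ i₁ i₂ : ℕ} {U : Multiset Atom}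
    (h : G.word ℓ = quadWord x₁₁ x₁₂ x₂₁ x₂₂ o₁ o₂ i₁ i₂ + U) :
    ∃ Q : G.Quad, ℓ Q.e₁₁ = x₁₁ ∧ ℓ Q.e₁₂ = x₁₂ ∧ ℓ Q.e₂₁ = x₂₁ ∧ ℓ Q.e₂₂ = x₂₂ := by
  have h1 : Word.src x₁₁ x₁₂ o₁ ∈ G.word ℓ := by rw [h]; simp [quadWord]
  have h2 : Word.src x₂₁ x₂₂ o₂ ∈ G.word ℓ := by rw [h]; simp [quadWord]
  have h3 : Word.snk x₁₁ x₂₁ i₁ ∈ G.word ℓ := by rw [h]; simp [quadWord]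
  have h4 : Word.snk x₁₂ x₂₂ i₂ ∈ G.word ℓ := by rw [h]; simp [quadWord]
  have hnd := (valid_word hℓ (G := G)).word_nodup
  rw [h] at hnd
  simp only [quadWord, Multiset.insert_eq_cons, Multiset.cons_add, Multiset.singleton_add,
    Multiset.nodup_cons, Multiset.mem_cons, not_or] at hnd
  obtain ⟨e₁₁, rfl⟩ := exists_label_of_mem_outs h1 (n := x₁₁) (by simp [Word.src])
  obtain ⟨e₁₂, rfl⟩ := exists_label_of_mem_outs h1 (n := x₁₂) (by simp [Word.src])
  obtain ⟨e₂₁, rfl⟩ := exists_label_of_mem_outs h2 (n := x₂₁) (by simp [Word.src])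
  obtain ⟨e₂₂, rfl⟩ := exists_label_of_mem_outs h2 (n := x₂₂) (by simp [Word.src])
  have s11 := eq_vertexAtom_src hℓ h1 (e := e₁₁) (by simp [Word.src])
  have s12 := eq_vertexAtom_src hℓ h1 (e := e₁₂) (by simp [Word.src])
  have s21 := eq_vertexAtom_src hℓ h2 (e := e₂₁) (by simp [Word.src])
  have s22 := eq_vertexAtom_src hℓ h2 (e := e₂₂) (by simp [Word.src])
  have t11 := eq_vertexAtom_tgt hℓ h3 (e := e₁₁) (by simp [Word.snk])
  have t21 := eq_vertexAtom_tgt hℓ h3 (e := e₂₁) (by simp [Word.snk])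
  have t12 := eq_vertexAtom_tgt hℓ h4 (e := e₁₂) (by simp [Word.snk])
  have t22 := eq_vertexAtom_tgt hℓ h4 (e := e₂₂) (by simp [Word.snk])
  have hi := vertexAtom_injective hℓ (G := G)
  exact ⟨{
    a₁ := G.src e₁₁, a₂ := G.src e₂₁, b₁ := G.tgt e₁₁, b₂ := G.tgt e₁₂
    ne_a := fun h => hnd.1.1 (by rw [s11, s21, h])
    ne_b := fun h => hnd.2.2.1.1 (by rw [t11, t12, h])
    e₁₁ := e₁₁, e₁₂ := e₁₂, e₂₁ := e₂₁, e₂₂ := e₂₂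
    src₁₁ := rfl, tgt₁₁ := rfl
    src₁₂ := hi (s12.symm.trans s11)
    tgt₁₂ := rfl
    src₂₁ := rfl
    tgt₂₁ := hi (t21.symm.trans t11)
    src₂₂ := hi (s22.symm.trans s21)
    tgt₂₂ := hi (t22.symm.trans t12) }, rfl, rfl, rfl, rfl⟩

omit hℓ in
/-- Subdivision points of a complex are strands of its word. -/
theorem isTrivalent_iff : G.IsTrivalent ↔ ∀ i o, strand i o ∉ G.word ℓ := by
  constructor
  · intro h i o hm
    obtain ⟨v, hv⟩ := mem_word.1 hm
    have h1 : (G.vertexAtom ℓ v).1.card = 1 := by rw [hv]; simp [strand]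
    have h2 : (G.vertexAtom ℓ v).2.card = 1 := by rw [hv]; simp [strand]
    rw [vertexAtom, card_labels] at h1 h2
    have := h v
    unfold outDeg inDeg at this
    omega
  · intro h v
    rcases G.valence v with h' | h' | h'
    · exact Or.inl h'.1
    · exact Or.inr h'.2
    · exfalso
      have hi : (G.vertexAtom ℓ v).1.card = 1 := card_labels.trans h'.2
      have ho : (G.vertexAtom ℓ v).2.card = 1 := card_labels.trans h'.1
      obtain ⟨i, hi⟩ := Multiset.card_eq_one.1 hi
      obtain ⟨o, ho⟩ := Multiset.card_eq_one.1 ho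
      refine h i o ?_
      rw [show strand i o = G.vertexAtom ℓ v from Atom.ext hi.symm ho.symm]
      exact vertexAtom_mem_word v

end Web

/-! ### Connected and irreducible complexes in terms of words -/

namespace Web

variable {G H : Web} {ℓ : G.E → ℕ}

/-- A valid part contains the neighbours of its vertices, so if it is not empty it spreads along
paths to the whole word. -/
theorem connected_word (hℓ : Function.Injective ℓ) (h : G.IsConnected) :
    Connected (G.word ℓ) := by
  obtain ⟨v₀⟩ := h.nonempty
  refine ⟨fun h0 => ?_, valid_word hℓ, fun C hC hv => ?_⟩
  · have := vertexAtom_mem_word (ℓ := ℓ) v₀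
    simp [h0] at this
  · by_cases hC0 : C = 0
    · exact Or.inl hC0
    right
    obtain ⟨a, ha⟩ := Multiset.exists_mem_of_ne_zero hC0
    obtain ⟨u, rfl⟩ := mem_word.1 (Multiset.mem_of_le hC ha)
    refine le_antisymm hC ((Multiset.le_iff_subset (valid_word hℓ).word_nodup).2 fun b hb => ?_)
    obtain ⟨w, rfl⟩ := mem_word.1 hb
    have hr := (SimpleGraph.reachable_iff_reflTransGen _ _).1 (h.preconnected u w)
    clear hb
    induction hr with
    | refl => exact ha
    | @tail x y _ hxy ih =>
      rw [SimpleGraph.fromRel_adj] at hxy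
      have hy := vertexAtom_mem_word (ℓ := ℓ) y
      rcases hxy.2 with ⟨e, h1, h2⟩ | ⟨e, h1, h2⟩
      · exact (valid_word hℓ).closed hv hC ih hy (n := ℓ e)
          (Or.inr ⟨(label_mem_outs hℓ).2 h1, (label_mem_ins hℓ).2 h2⟩)
      · exact (valid_word hℓ).closed hv hC ih hy (n := ℓ e)
          (Or.inl ⟨(label_mem_ins hℓ).2 h2, (label_mem_outs hℓ).2 h1⟩)

/-- The vertices that can be reached from a given one form a valid part, which then has to be
everything. -/
theorem isConnected_of_word (hℓ : Function.Injective ℓ) (h : Connected (G.word ℓ)) :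
    G.IsConnected := by
  classical
  obtain ⟨a, ha⟩ := Multiset.exists_mem_of_ne_zero h.1
  obtain ⟨u, rfl⟩ := mem_word.1 ha
  set Γ := SimpleGraph.fromRel fun u v : G.V => ∃ e, G.src e = u ∧ G.tgt e = v with hΓ
  have key : ∀ e, Γ.Reachable (G.src e) (G.tgt e) := fun e => by
    by_cases he : G.src e = G.tgt e
    · rw [he]
    · exact SimpleGraph.Adj.reachable ((SimpleGraph.fromRel_adj _ _ _).2 ⟨he, Or.inl ⟨e, rfl, rfl⟩⟩)
  have hle : (G.word ℓ).filter (fun a => ∃ v, Γ.Reachable u v ∧ G.vertexAtom ℓ v = a) ≤ G.word ℓ :=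
    Multiset.filter_le _ _
  have hv : Valid ((G.word ℓ).filter (fun a => ∃ v, Γ.Reachable u v ∧ G.vertexAtom ℓ v = a)) := by
    refine (valid_word hℓ).of_le hle fun a ha b hb n hn => ?_
    rw [Multiset.mem_filter] at ha ⊢
    obtain ⟨v, hv, rfl⟩ := ha.2
    obtain ⟨w, rfl⟩ := mem_word.1 hb
    refine ⟨hb, w, hv.trans ?_, rfl⟩
    rcases hn with ⟨h1, h2⟩ | ⟨h1, h2⟩
    · obtain ⟨e, rfl⟩ := exists_label_of_mem_ins ha.1 h1
      rw [label_mem_ins hℓ] at h1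
      rw [label_mem_outs hℓ] at h2
      rw [← h1, ← h2]
      exact (key e).symm
    · obtain ⟨e, rfl⟩ := exists_label_of_mem_outs ha.1 h1
      rw [label_mem_outs hℓ] at h1
      rw [label_mem_ins hℓ] at h2
      rw [← h1, ← h2]
      exact key e
  have hall : ∀ v, Γ.Reachable u v := fun v => by
    rcases h.2.2 _ hle hv with h0 | h0
    · have : G.vertexAtom ℓ u ∈ (G.word ℓ).filter
          (fun a => ∃ v, Γ.Reachable u v ∧ G.vertexAtom ℓ v = a) :=
        Multiset.mem_filter.2 ⟨ha, u, SimpleGraph.Reachable.refl _, rfl⟩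
      rw [h0] at this
      simp at this
    · have := vertexAtom_mem_word (ℓ := ℓ) v
      rw [← h0, Multiset.mem_filter] at this
      obtain ⟨-, w, hw, he⟩ := this
      rwa [← vertexAtom_injective hℓ he]
  have : Nonempty G.V := ⟨u⟩
  exact ⟨fun v w => (hall v).symm.trans (hall w)⟩

variable {R : Type*} [CommRing R] (δ₂ δ₃ : R)

theorem _root_.Word.not_reducible_zero : ¬ Reducible δ₂ δ₃ 0 := by
  rintro ⟨S, L, U, hr, h⟩
  refine hr.ne_zero (Multiset.le_zero.1 ?_)
  rw [h]
  exact Multiset.le_add_right _ _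

theorem not_reducible_word (hℓ : Function.Injective ℓ) (ht : G.IsTrivalent) (hb : IsEmpty G.Bigon)
    (hq : IsEmpty G.Quad) : ¬ Reducible δ₂ δ₃ (G.word ℓ) := by
  rw [isTrivalent_iff (ℓ := ℓ)] at ht
  rintro ⟨S, L, U, hr, h⟩
  cases hr with
  | join i o I O => exact ht i o (by rw [h]; simp)
  | circle i => exact ht i i (by rw [h]; simp)
  | bigon x y o i => exact hb.elim (exists_bigon hℓ h).choose
  | quad => exact hq.elim (exists_quad hℓ h).choose

/-- A strand either closes up, and `circle` applies, or its label `o` arrives at another vertex, and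
`join` applies. Hence irreducible words have no subdivision points. -/
theorem _root_.Word.reducible_of_strand {W : Multiset Atom} (h : Valid W) {i o : ℕ}
    (hm : strand i o ∈ W) : Reducible δ₂ δ₃ W := by
  obtain ⟨U, rfl⟩ := Multiset.exists_cons_of_mem hm
  by_cases hio : i = o
  · subst hio
    exact ⟨_, _, U, Rule.circle i, rfl⟩
  · have : o ∈ ins (strand i o ::ₘ U) := by rw [h.bal]; simp [strand]
    obtain ⟨a, ha, hoa⟩ := mem_ins.1 this
    have hne : a ≠ strand i o := by
      rintro rfl
      exact hio (by simpa [strand, eq_comm] using hoa)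
    obtain ⟨U', rfl⟩ := Multiset.exists_cons_of_mem ((Multiset.mem_cons.1 ha).resolve_left hne)
    obtain ⟨I, hI⟩ := Multiset.exists_cons_of_mem hoa
    obtain ⟨a1, a2⟩ := a
    obtain rfl : a1 = o ::ₘ I := hI
    exact ⟨_, _, U', Rule.join i o I a2, by simp⟩

theorem isTrivalent_of_word (hℓ : Function.Injective ℓ) (h : ¬ Reducible δ₂ δ₃ (G.word ℓ)) :
    G.IsTrivalent ∧ IsEmpty G.Bigon ∧ IsEmpty G.Quad := by
  refine ⟨(isTrivalent_iff (ℓ := ℓ)).2 fun i o hm => h (reducible_of_strand _ _ (valid_word hℓ) hm),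
    ⟨fun B => h ?_⟩, ⟨fun Q => h ?_⟩⟩
  · obtain ⟨i, o, U, hU⟩ := B.exists_word hℓ
    exact ⟨_, _, U, Rule.bigon _ _ _ _, hU⟩
  · obtain ⟨o₁, o₂, i₁, i₂, U, hU⟩ := Q.exists_word hℓ
    exact ⟨_, _, U, Rule.quad _ _ _ _ _ _ _ _, hU⟩

end Web

/-! ### Solutions of the Kuperberg relations obey the rules; uniqueness -/

open Web

theorem powA_mul (m n : ℤ) : powA m * powA n = powA (m + n) := by
  rw [powA, powA, powA, ← map_mul, LaurentPolynomial.T_add]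

theorem powA_zero : powA 0 = 1 := by
  rw [powA, LaurentPolynomial.T_zero, map_one]

/-- The value of a bigon. -/
noncomputable def bigonValue : GraphPoly := powA 3 + powA (-3)

/-- The value of a circle. -/
noncomputable def circleValue : GraphPoly := powA 6 + 1 + powA (-6)

/-- The only relation between the two parameters that confluence needs. -/
theorem bigonValue_mul_self : bigonValue * bigonValue = circleValue + 1 := by
  have h1 : powA 3 * powA 3 = powA 6 := powA_mul _ _
  have h2 : powA 3 * powA (-3) = 1 := (powA_mul _ _).trans powA_zero
  have h3 : powA (-3) * powA (-3) = powA (-6) := powA_mul _ _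
  unfold bigonValue circleValue
  linear_combination h1 + 2 * h2 + h3

open Classical in
/-- The value on words of a function on graphs. -/
noncomputable def wordValue (f : TriGraph → GraphPoly) (W : Multiset Atom) : GraphPoly :=
  -- The default is immaterial: the rules are only asserted for valid words.
  if h : Valid W then f (ofWord W h).toGraph else 0

theorem wordValue_word (f : TriGraph → GraphPoly) {G : Web} {ℓ : G.E → ℕ}
    (hℓ : Function.Injective ℓ) : wordValue f (G.word ℓ) = f G.toGraph := by
  rw [wordValue, dif_pos (valid_word hℓ)]
  congr 1
  exact toGraph_eq_of_word_eq (ofWordLabel_injective _ _) hℓ (word_ofWord _)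

theorem toGraph_subdivide (G : Web) (e : G.E) : (G.subdivide e).toGraph = G.toGraph :=
  (Quot.sound (.subdivide G e)).symm

namespace IsKuperberg

variable {f g : TriGraph → GraphPoly}

theorem wordValue_relabel (f : TriGraph → GraphPoly) {W : Multiset Atom} (h : Valid W)
    (σ : Equiv.Perm ℕ) : wordValue f (relabel σ W) = wordValue f W := by
  rw [← word_ofWord h, relabel_word, wordValue_word f (ofWordLabel_injective W h),
    wordValue_word f (σ.injective.comp (ofWordLabel_injective W h))]

/-- The longer word is that of the complex of the shorter one, subdivided at the edge `i`, with `o`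
as the label of the new edge. Subdivisions are identified in `TriGraph`, so no relation for `f` is
needed. -/
theorem wordValue_join (f : TriGraph → GraphPoly) {i o : ℕ} {I O : Multiset ℕ}
    {W : Multiset Atom} (h : Valid ({strand i o, (Atom.mk (o ::ₘ I) O)} + W)) :
    wordValue f ({strand i o, (Atom.mk (o ::ₘ I) O)} + W) =
      wordValue f ({Atom.mk (i ::ₘ I) O} + W) := by
  have h' := (Rule.join (δ₂ := bigonValue) (δ₃ := circleValue) i o I O).valid h
    (p := (1, {Atom.mk (i ::ₘ I) O})) (by simp)
  dsimp only at h'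
  set G := ofWord _ h'
  have hl := ofWordLabel_injective _ h'
  set l : G.E → ℕ := ofWordLabel _ h'
  have hw : G.word l = _ := word_ofWord h'
  obtain ⟨e, he⟩ : ∃ e, l e = i := exists_label_of_mem_ins (a := Atom.mk (i ::ₘ I) O)
    (by rw [hw]; simp) (by simp)
  let ℓ : (G.subdivide e).E → ℕ := fun x => x.elim o l
  have hℓ : Function.Injective ℓ := by
    have ho : ∀ x, l x ≠ o := by
      rintro x rfl
      have h1 : l x ∈ ins ({Atom.mk (i ::ₘ I) O} + W) := by
        rw [← hw, ins_word, label_mem_labels hl]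
        trivial
      have h2 := h.nodup
      simp only [strand, Multiset.insert_eq_cons, ins_cons, Multiset.singleton_add,
        Multiset.cons_add, Multiset.nodup_cons, Multiset.mem_cons, Multiset.mem_add] at h1 h2
      tauto
    rintro (_ | x) (_ | y) hxy
    · rfl
    · exact (ho y hxy.symm).elim
    · exact (ho x hxy).elim
    · exact congrArg some (hl hxy)
  obtain ⟨I', O', U, h1, h2⟩ := exists_word_subdivide e hℓ
  change G.word l = {Atom.mk (l e ::ₘ I') O'} + U at h1
  change _ = {strand (l e) o, Atom.mk (o ::ₘ I') O'} + U at h2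
  rw [he] at h1 h2
  have h3 : Atom.mk (i ::ₘ I') O' = Atom.mk (i ::ₘ I) O :=
    (valid_word hl).eq_of_mem_in (x := i) (by rw [h1]; simp) (by rw [hw]; simp) (by simp)
      (by simp)
  simp only [Atom.mk.injEq, Multiset.cons_inj_right] at h3
  obtain ⟨rfl, rfl⟩ := h3
  obtain rfl : U = W := add_left_cancel (h1.symm.trans hw)
  rw [← h2, ← h1, wordValue_word f hℓ, wordValue_word f hl, toGraph_subdivide]

/-- The labels of the two parts are disjoint because the sum is valid, so together they label the
disjoint union. -/
theorem wordValue_add (hf : IsKuperberg f) {V W : Multiset Atom} (h : Valid (V + W)) (hV : Valid V)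
    (hW : Valid W) : wordValue f (V + W) = wordValue f V * wordValue f W := by
  let ℓ : ((ofWord V hV).disjUnion (ofWord W hW)).E → ℕ :=
    Sum.elim (ofWordLabel V hV) (ofWordLabel W hW)
  have hd := h.nodup
  rw [ins_add, Multiset.nodup_add] at hd
  have hℓ : Function.Injective ℓ := by
    refine Function.Injective.sumElim (ofWordLabel_injective V hV) (ofWordLabel_injective W hW)
      fun x y hxy => ?_
    have : x.1 = y.1 := hxy
    exact Multiset.disjoint_left.1 hd.2.2 x.2 (this ▸ y.2)
  have hw : ((ofWord V hV).disjUnion (ofWord W hW)).word ℓ = V + W :=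
    (word_disjUnion hℓ).trans (congrArg₂ (· + ·) (word_ofWord hV) (word_ofWord hW))
  rw [← hw, wordValue_word f hℓ, hf.disjUnion, wordValue, dif_pos hV, wordValue, dif_pos hW]

theorem wordValue_zero (hf : IsKuperberg f) : wordValue f 0 = 1 := by
  have hℓ : Function.Injective (fun _ => 0 : Web.empty.E → ℕ) := fun x => x.elim
  rw [← word_empty (fun _ => 0), wordValue_word f hℓ, hf.empty]

theorem wordValue_circle (hf : IsKuperberg f) (i : ℕ) :
    wordValue f {strand i i} = circleValue := by
  have hℓ : Function.Injective (fun _ => i : Web.circle.E → ℕ) := fun _ _ _ => rfl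
  rw [← word_circle (fun _ => i), wordValue_word f hℓ, hf.circle, circleValue]

/-- Each relation for graphs, read through words, is one of the rules. Every later computation is
made on words with this property alone. -/
theorem skein (hf : IsKuperberg f) : Skein bigonValue circleValue ⊤ (wordValue f) := by
  refine ⟨fun W h σ => wordValue_relabel f h.1 σ, fun S L W hr h => ?_⟩
  replace h := h.1
  have hl := ofWordLabel_injective _ h
  have hw := word_ofWord h
  cases hr with
  | join i o I O => simpa [ev] using wordValue_join f h
  | circle i =>
    have hi : Valid {strand i i} := ⟨by simp [strand], by simp [strand], by simp [shape_strand]⟩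
    rw [hf.wordValue_add h hi (h.of_add_right hi), hf.wordValue_circle]
    simp [ev]
  | bigon x y o i =>
    obtain ⟨B, h1, h2⟩ := exists_bigon hl hw
    have h3 := B.word_resolve hl (by rw [h1, h2]; exact hw)
    rw [ev, List.map_singleton, List.sum_singleton, ← h3,
      wordValue_word f (B.resolveLabel_injective hl)]
    nth_rw 1 [← hw]
    rw [wordValue_word f hl, hf.bigon _ B, bigonValue]
  | quad x₁₁ x₁₂ x₂₁ x₂₂ o₁ o₂ i₁ i₂ =>
    obtain ⟨Q, h1, h2, h3, h4⟩ := exists_quad hl hw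
    have h5 := Q.word_resolve hl (by rw [h1, h2, h3, h4]; exact hw)
    -- The second resolution is the first one after renaming the sinks, so the incoming edges `i₁`
    -- and `i₂` change places.
    have h6 := Q.swap.word_resolve hl (o₁ := o₁) (o₂ := o₂) (i₁ := i₂) (i₂ := i₁) (U := W) (by
      simp only [Quad.swap]
      rw [h1, h2, h3, h4, hw]
      simp only [quadWord, Word.src, Word.snk, Multiset.insert_eq_cons, ← Multiset.singleton_add]
      ac_rfl)
    have h7 : ({strand i₂ o₁, strand i₁ o₂} : Multiset Atom) = {strand i₁ o₂, strand i₂ o₁} :=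
      Multiset.pair_comm _ _
    rw [h7] at h6
    simp only [ev, List.map_cons, List.map_nil, List.sum_cons, List.sum_nil, one_mul, add_zero]
    rw [← h5, ← h6, wordValue_word f (Q.resolveLabel_injective hl),
      wordValue_word f (Q.swap.resolveLabel_injective hl)]
    nth_rw 1 [← hw]
    rw [wordValue_word f hl, hf.quad _ Q]

/-- A map that satisfies the Kuperberg relations is determined by them. -/
theorem unique (hf : IsKuperberg f) (hg : IsKuperberg g) : f = g := by
  have key : ∀ n (W : Multiset Atom), W.card = n → Valid W → wordValue f W = wordValue g W := by
    intro n
    induction n using Nat.strong_induction_on with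
    | _ n ih =>
      rintro W rfl hv
      by_cases hW : Reducible bigonValue circleValue W
      · obtain ⟨S, L, U, hr, rfl⟩ := hW
        have hb : Below ⊤ (S + U) := ⟨hv, by simp⟩
        rw [hf.skein.rule _ _ _ hr hb, hg.skein.rule _ _ _ hr hb]
        refine ev_congr fun p hp => ih _ ?_ _ rfl (hr.valid hv hp)
        have := hr.card_lt hp
        simp only [Multiset.card_add]
        omega
      by_cases h0 : W = 0
      · rw [h0, hf.wordValue_zero, hg.wordValue_zero]
      -- No rule applies and the word is not empty: if it is connected, it is one of the variables;
      -- otherwise it splits into two smaller valid words.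
      by_cases hc : Connected W
      · have hl := ofWordLabel_injective _ hv
        have hw := word_ofWord hv
        have hi : (ofWord W hv).toGraph.IsIrreducible :=
          have := isTrivalent_of_word bigonValue circleValue hl (by rwa [hw])
          ⟨_, rfl, this.1, isConnected_of_word hl (by rwa [hw]), this.2⟩
        rw [wordValue, dif_pos hv, wordValue, dif_pos hv, hf.irreducible ⟨_, hi⟩,
          hg.irreducible ⟨_, hi⟩]
      · have : ∃ C ≤ W, Valid C ∧ C ≠ 0 ∧ C ≠ W := by
          by_contra! h
          exact hc ⟨h0, hv, fun C hC hCv => or_iff_not_imp_left.2 (h C hC hCv)⟩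
        obtain ⟨C, hC, hCv, hC0, hCW⟩ := this
        obtain ⟨D, rfl⟩ := Multiset.le_iff_exists_add.1 hC
        have hD := hv.of_add_right hCv
        have hD0 : D ≠ 0 := by
          rintro rfl
          simp at hCW
        have h1 := Multiset.card_pos.2 hC0
        have h2 := Multiset.card_pos.2 hD0
        rw [hf.wordValue_add hv hCv hD, hg.wordValue_add hv hCv hD, ih _ ?_ C rfl hCv,
          ih _ ?_ D rfl hD]
        · rw [Multiset.card_add]; omega
        · rw [Multiset.card_add]; omega
  funext t
  obtain ⟨G, rfl⟩ := Quot.exists_rep t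
  obtain ⟨ℓ, hℓ⟩ := exists_injective_label G.E
  have := key _ _ rfl (valid_word (G := G) hℓ)
  rwa [wordValue_word f hℓ, wordValue_word g hℓ] at this

end IsKuperberg

/-! ### Existence -/

open Classical in
/-- The variable of a connected word. -/
noncomputable def wordVar (C : Multiset Atom) : GraphPoly :=
  if h : ∃ hC : Valid C, (ofWord C hC).toGraph.IsIrreducible then MvPolynomial.X ⟨_, h.choose_spec⟩
  else 0

theorem wordVar_word {G : Web} {ℓ : G.E → ℕ} (hℓ : Function.Injective ℓ)
    (h : G.toGraph.IsIrreducible) : wordVar (G.word ℓ) = MvPolynomial.X ⟨_, h⟩ := by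
  have hv := valid_word (G := G) hℓ
  have he : (ofWord _ hv).toGraph = G.toGraph :=
    toGraph_eq_of_word_eq (ofWordLabel_injective _ _) hℓ (word_ofWord _)
  have h' : ∃ hC : Valid (G.word ℓ), (ofWord _ hC).toGraph.IsIrreducible := ⟨hv, by rwa [he]⟩
  rw [wordVar, dif_pos h']
  congr 1
  exact Subtype.ext he

theorem wordVar_relabel {C : Multiset Atom} (hC : Valid C) (σ : Equiv.Perm ℕ) :
    wordVar (relabel σ C) = wordVar C := by
  have he : (ofWord _ (hC.relabel σ.injective)).toGraph = (ofWord _ hC).toGraph := by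
    refine toGraph_eq_of_word_eq (ofWordLabel_injective _ _)
      (σ.injective.comp (ofWordLabel_injective _ hC)) ?_
    rw [← relabel_word, word_ofWord, word_ofWord]
  unfold wordVar
  by_cases h : (ofWord _ hC).toGraph.IsIrreducible
  · have h' := h
    rw [← he] at h'
    rw [dif_pos ⟨_, h'⟩, dif_pos ⟨_, h⟩]
    congr 1
    exact Subtype.ext he
  · rw [dif_neg, dif_neg]
    · exact fun h' => h h'.choose_spec
    · exact fun h' => h (he ▸ h'.choose_spec)

/-- The value of a word for the Kuperberg relations. -/
noncomputable def kuperbergValue (W : Multiset Atom) : GraphPoly :=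
  value bigonValue circleValue (componentProd wordVar) W

theorem skein_kuperbergValue : Skein bigonValue circleValue ⊤ kuperbergValue :=
  skein_value bigonValue_mul_self fun W _ σ =>
    componentProd_relabel (fun _ hW σ => wordVar_relabel hW σ) W σ

/-- Isomorphisms change only the labels, and a subdivision is undone by the rule `join`, so the
value descends to homeomorphism classes. -/
theorem kuperbergValue_eq {G H : Web} {ℓ : G.E → ℕ} {ℓ' : H.E → ℕ} (hℓ : Function.Injective ℓ)
    (hℓ' : Function.Injective ℓ') (h : G.toGraph = H.toGraph) :
    kuperbergValue (G.word ℓ) = kuperbergValue (H.word ℓ') := by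
  have S := skein_kuperbergValue
  have below : ∀ {G : Web} {ℓ : G.E → ℕ}, Function.Injective ℓ → Below ⊤ (G.word ℓ) :=
    fun hℓ => ⟨valid_word hℓ, by simp⟩
  have indep : ∀ {G : Web} {ℓ ℓ' : G.E → ℕ}, Function.Injective ℓ → Function.Injective ℓ' →
      kuperbergValue (G.word ℓ) = kuperbergValue (G.word ℓ') := by
    intro G ℓ ℓ' hℓ hℓ'
    obtain ⟨σ, rfl⟩ := exists_perm_comp_eq hℓ hℓ'
    rw [← relabel_word, S.relabel _ (below hℓ)]
  -- Labels chosen once for all complexes, in order to have a function on `Web` that can be lifted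
  -- to the quotient.
  let lab : ∀ G : Web, G.E → ℕ := fun G => (exists_injective_label G.E).choose
  have hlab : ∀ G : Web, Function.Injective (lab G) :=
    fun G => (exists_injective_label G.E).choose_spec
  let φ : TriGraph → GraphPoly := Quot.lift (fun G => kuperbergValue (G.word (lab G))) (by
    rintro G H (⟨i⟩ | e)
    · rw [← i.word_eq]
      exact indep (hlab _) ((hlab _).comp i.onE.injective)
    · have hs := hlab (G.subdivide e)
      obtain ⟨I, O, U, h1, h2⟩ := exists_word_subdivide e hs
      rw [indep (hlab G) (hs.comp (Option.some_injective _)), h1]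
      exact (S.join h2 (below hs)).1.symm)
  rw [indep hℓ (hlab G), indep hℓ' (hlab H)]
  exact congrArg φ h

/-- The evaluation of graphs. -/
noncomputable def kuperbergEval (t : TriGraph) : GraphPoly :=
  kuperbergValue (t.out.word (exists_injective_label t.out.E).choose)

theorem kuperbergEval_toGraph {G : Web} {ℓ : G.E → ℕ} (hℓ : Function.Injective ℓ) :
    kuperbergEval G.toGraph = kuperbergValue (G.word ℓ) :=
  kuperbergValue_eq (exists_injective_label _).choose_spec hℓ (Quot.out_eq _)

/-- The circle, bigon and quadrilateral relations are the rules, and unions are `value_add`. An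
irreducible graph has a word to which no rule applies and which is its own only component, so its
value is the variable. -/
theorem isKuperberg_kuperbergEval : IsKuperberg kuperbergEval := by
  have S := skein_kuperbergValue
  have below : ∀ {G : Web} {ℓ : G.E → ℕ}, Function.Injective ℓ → Below ⊤ (G.word ℓ) :=
    fun hℓ => ⟨valid_word hℓ, by simp⟩
  refine ⟨?_, ?_, fun G H => ?_, ?_, fun G B => ?_, fun G Q => ?_⟩
  · rintro ⟨_, ht⟩
    obtain ⟨G, rfl, h1, h2, h3, h4⟩ := id ht
    obtain ⟨ℓ, hℓ⟩ := exists_injective_label G.E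
    rw [kuperbergEval_toGraph hℓ, kuperbergValue,
      value_of_not_reducible (not_reducible_word _ _ hℓ h1 h3 h4), componentProd,
      (connected_word hℓ h2).components_eq, Finset.prod_singleton, wordVar_word hℓ ht]
  · have hℓ : Function.Injective (fun _ => 0 : Web.empty.E → ℕ) := fun x => x.elim
    rw [kuperbergEval_toGraph hℓ, word_empty, kuperbergValue,
      value_of_not_reducible (not_reducible_zero _ _), componentProd_zero]
  · obtain ⟨ℓ, hℓ⟩ := exists_injective_label (G.disjUnion H).E
    have h1 := hℓ.comp Sum.inl_injective
    have h2 := hℓ.comp Sum.inr_injective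
    rw [kuperbergEval_toGraph hℓ, kuperbergEval_toGraph h1, kuperbergEval_toGraph h2,
      word_disjUnion hℓ]
    exact value_add S (word_disjUnion hℓ ▸ valid_word hℓ) (valid_word h1) (valid_word h2)
  · have hℓ : Function.Injective (fun _ => 0 : Web.circle.E → ℕ) := fun _ _ _ => rfl
    have h1 := S.circle (W := 0) ((word_circle (fun _ => 0)).trans (add_zero _).symm) (below hℓ)
    rw [kuperbergEval_toGraph hℓ, h1.1, kuperbergValue,
      value_of_not_reducible (not_reducible_zero _ _), componentProd_zero, mul_one, circleValue]
  · obtain ⟨ℓ, hℓ⟩ := exists_injective_label G.E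
    obtain ⟨i, o, U, hU⟩ := B.exists_word hℓ
    have hs := B.resolveLabel_injective hℓ
    rw [kuperbergEval_toGraph hℓ, kuperbergEval_toGraph hs, B.word_resolve hℓ hU]
    exact (S.bigon hU (below hℓ)).1
  · obtain ⟨ℓ, hℓ⟩ := exists_injective_label G.E
    obtain ⟨o₁, o₂, i₁, i₂, U, hU⟩ := Q.exists_word hℓ
    have hs := Q.resolveLabel_injective hℓ
    have hs' := Q.swap.resolveLabel_injective hℓ
    have hU' : G.word ℓ = quadWord (ℓ Q.swap.e₁₁) (ℓ Q.swap.e₁₂) (ℓ Q.swap.e₂₁) (ℓ Q.swap.e₂₂)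
        o₁ o₂ i₂ i₁ + U := by
      simp only [Quad.swap]
      rw [hU]
      simp only [quadWord, Word.src, Word.snk, Multiset.insert_eq_cons, ← Multiset.singleton_add]
      ac_rfl
    rw [kuperbergEval_toGraph hℓ, kuperbergEval_toGraph hs, kuperbergEval_toGraph hs',
      Q.word_resolve hℓ hU, Q.swap.word_resolve hℓ hU',
      Multiset.pair_comm (strand i₂ o₁) (strand i₁ o₂)]
    have := (S.quad hU (below hℓ))
    exact this.1

theorem existsUnique_isKuperberg : ∃! f : TriGraph → GraphPoly, IsKuperberg f :=
  ⟨kuperbergEval, isKuperberg_kuperbergEval, fun _ hg => hg.unique isKuperberg_kuperbergEval⟩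

/-! ### Local computations for the first two Reidemeister moves -/

namespace Word

variable {R : Type*} [CommRing R] {δ₂ δ₃ : R} {n : ℕ∞} {F : Multiset Atom → R}

/-- The two local states of a crossing. The first strand arrives on `i₁` and leaves on `o₁`, the
second one arrives on `i₂` and leaves on `o₂`; the label of the new edge is `e`. -/
def crossWord (c : Bool) (i₁ o₁ i₂ o₂ e : ℕ) : Multiset Atom :=
  if c then {strand i₁ o₂, strand i₂ o₁} else {src o₁ o₂ e, snk i₁ i₂ e}

@[simp] theorem crossWord_true (i₁ o₁ i₂ o₂ e : ℕ) :
    crossWord true i₁ o₁ i₂ o₂ e = {strand i₁ o₂, strand i₂ o₁} := rfl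

@[simp] theorem crossWord_false (i₁ o₁ i₂ o₂ e : ℕ) :
    crossWord false i₁ o₁ i₂ o₂ e = {src o₁ o₂ e, snk i₁ i₂ e} := rfl

theorem crossWord_comm (c : Bool) (i₁ o₁ i₂ o₂ e : ℕ) :
    crossWord c i₁ o₁ i₂ o₂ e = crossWord c i₂ o₂ i₁ o₁ e := by
  cases c
  · simp only [crossWord_false]
    exact Word.perm
  · simp only [crossWord_true]
    exact Word.perm

namespace Skein

variable (S : Skein δ₂ δ₃ n F)
include S

/-- The label `m` is the small loop: it splits off as a circle in the oriented state and forms a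
bigon with the new edge in the other one. -/
theorem kink {a m c e : ℕ} {W : Multiset Atom}
    (h₀ : Below n ({strand a m, strand m c} + W))
    (h : ∀ s, Below n (crossWord s a m m c e + W)) :
    F (crossWord true a m m c e + W) = δ₃ * F ({strand a m, strand m c} + W) ∧
      F (crossWord false a m m c e + W) = δ₂ * F ({strand a m, strand m c} + W) := by
  obtain ⟨h1, -⟩ := S.join_strand (i := a) (o := m) (b := c) (W := W) rfl h₀
  have ht := h true
  have hf := h false
  simp only [crossWord_true, crossWord_false] at ht hf ⊢
  obtain ⟨h2, -⟩ := S.circle (i := m) (W := {strand a c} + W) Word.perm ht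
  obtain ⟨h3, -⟩ := S.bigon (x := m) (y := e) (i := a) (o := c) (W := W) Word.perm hf
  rw [h1, h2, h3]
  exact ⟨rfl, rfl⟩

/-- Two oriented smoothings restore the strands. Each of the other states becomes a source and a
sink joined by one edge, for two new edges after a bigon with factor δ₂; `hq` makes these terms
cancel. -/
theorem parallel {a₁ m₁ b₁ a₂ m₂ b₂ e₁ e₂ : ℕ} {W : Multiset Atom} {p₁ q₁ p₂ q₂ : R}
    (hp : p₁ * p₂ = 1) (hq : p₁ * q₂ + q₁ * p₂ + δ₂ * (q₁ * q₂) = 0)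
    (h₀ : Below n ({strand a₁ m₁, strand m₁ b₁, strand a₂ m₂, strand m₂ b₂} + W))
    (h : ∀ c d, Below n (crossWord c a₁ m₁ a₂ m₂ e₁ + (crossWord d m₁ b₁ m₂ b₂ e₂ + W))) :
    p₁ * p₂ * F (crossWord true a₁ m₁ a₂ m₂ e₁ + (crossWord true m₁ b₁ m₂ b₂ e₂ + W)) +
    p₁ * q₂ * F (crossWord true a₁ m₁ a₂ m₂ e₁ + (crossWord false m₁ b₁ m₂ b₂ e₂ + W)) +
    q₁ * p₂ * F (crossWord false a₁ m₁ a₂ m₂ e₁ + (crossWord true m₁ b₁ m₂ b₂ e₂ + W)) +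
    q₁ * q₂ * F (crossWord false a₁ m₁ a₂ m₂ e₁ + (crossWord false m₁ b₁ m₂ b₂ e₂ + W)) =
      F ({strand a₁ m₁, strand m₁ b₁, strand a₂ m₂, strand m₂ b₂} + W) := by
  obtain ⟨h1, h0'⟩ := S.join_strand (i := a₁) (o := m₁) (b := b₁)
    (W := {strand a₂ m₂, strand m₂ b₂} + W) Word.perm h₀
  obtain ⟨h2, -⟩ := S.join_strand (i := a₂) (o := m₂) (b := b₂) (W := {strand a₁ b₁} + W) Word.perm h0'
  have htt := h true true
  have htf := h true false
  have hft := h false true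
  have hff := h false false
  simp only [crossWord_true, crossWord_false] at htt htf hft hff ⊢
  obtain ⟨h3, htt⟩ := S.join_strand (i := a₁) (o := m₂) (b := b₁)
    (W := {strand a₂ m₁, strand m₁ b₂} + W) Word.perm htt
  obtain ⟨h4, -⟩ := S.join_strand (i := a₂) (o := m₁) (b := b₂) (W := {strand a₁ b₁} + W) Word.perm htt
  obtain ⟨h5, htf⟩ := S.join_snk (i := a₁) (o := m₂) (b := m₁) (c := e₂)
    (W := {strand a₂ m₁, src b₁ b₂ e₂} + W) Word.perm htf
  obtain ⟨h6, -⟩ := S.join_snk (i := a₂) (o := m₁) (b := a₁) (c := e₂)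
    (W := {src b₁ b₂ e₂} + W) Word.perm htf
  obtain ⟨h7, hft⟩ := S.join_src (i := m₁) (o := b₂) (b := m₂) (c := e₁)
    (W := {strand m₂ b₁, snk a₁ a₂ e₁} + W) Word.perm hft
  obtain ⟨h8, -⟩ := S.join_src (i := m₂) (o := b₁) (b := b₂) (c := e₁)
    (W := {snk a₁ a₂ e₁} + W) Word.perm hft
  obtain ⟨h9, hff⟩ := S.bigon (x := m₁) (y := m₂) (i := e₂) (o := e₁)
    (W := {src b₁ b₂ e₂, snk a₁ a₂ e₁} + W) Word.perm hff
  obtain ⟨h10, -⟩ := S.join_snk (i := e₂) (o := e₁) (b := a₁) (c := a₂)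
    (W := {src b₁ b₂ e₂} + W) Word.perm hff
  obtain ⟨h11, -⟩ := S.join_src (i := e₂) (o := e₁) (b := b₁) (c := b₂)
    (W := {snk a₁ a₂ e₁} + W) Word.perm hff
  have c1 : F ({strand a₂ b₂} + ({strand a₁ b₁} + W)) = F ({strand a₂ b₂, strand a₁ b₁} + W) :=
    congrArg F Word.perm
  have c2 : F ({snk a₂ a₁ e₂} + ({src b₁ b₂ e₂} + W)) = F ({snk e₂ a₁ a₂} + ({src b₁ b₂ e₂} + W)) :=
    congrArg F Word.perm
  have c3 : F ({src b₁ b₂ e₁} + ({snk a₁ a₂ e₁} + W)) = F ({src e₁ b₁ b₂} + ({snk a₁ a₂ e₁} + W)) :=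
    congrArg F Word.perm
  rw [h1, h2, h3, h4, h5, h6, h7, h8, h9, c2, ← h10, c3, ← h11]
  linear_combination F ({strand a₂ b₂} + ({strand a₁ b₁} + W)) * hp +
    F ({strand e₂ e₁} + ({src b₁ b₂ e₂, snk a₁ a₂ e₁} + W)) * hq

/-- Here the straight strands come from the quadrilateral with two new edges. Its other resolution
and the three remaining states are multiples, by 1, δ₃, δ₂, δ₂, of the word in which the strands
turn back; `hq` makes these cancel. -/
theorem antiparallel {a₁ m₁ b₁ a₂ m₂ b₂ e₁ e₂ : ℕ} {W : Multiset Atom} {p₁ q₁ p₂ q₂ : R}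
    (hq : p₁ * p₂ * δ₃ + (p₁ * q₂ + q₁ * p₂) * δ₂ + q₁ * q₂ = 0)
    (hqq : q₁ * q₂ = 1)
    (h₀ : Below n ({strand a₁ m₁, strand m₁ b₁, strand a₂ m₂, strand m₂ b₂} + W))
    (h : ∀ c d, Below n (crossWord c a₁ m₁ m₂ b₂ e₁ + (crossWord d m₁ b₁ a₂ m₂ e₂ + W))) :
    p₁ * p₂ * F (crossWord true a₁ m₁ m₂ b₂ e₁ + (crossWord true m₁ b₁ a₂ m₂ e₂ + W)) +
    p₁ * q₂ * F (crossWord true a₁ m₁ m₂ b₂ e₁ + (crossWord false m₁ b₁ a₂ m₂ e₂ + W)) +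
    q₁ * p₂ * F (crossWord false a₁ m₁ m₂ b₂ e₁ + (crossWord true m₁ b₁ a₂ m₂ e₂ + W)) +
    q₁ * q₂ * F (crossWord false a₁ m₁ m₂ b₂ e₁ + (crossWord false m₁ b₁ a₂ m₂ e₂ + W)) =
      F ({strand a₁ m₁, strand m₁ b₁, strand a₂ m₂, strand m₂ b₂} + W) := by
  obtain ⟨h1, h0'⟩ := S.join_strand (i := a₁) (o := m₁) (b := b₁)
    (W := {strand a₂ m₂, strand m₂ b₂} + W) Word.perm h₀
  obtain ⟨h2, -⟩ := S.join_strand (i := a₂) (o := m₂) (b := b₂) (W := {strand a₁ b₁} + W) Word.perm h0'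
  have htt := h true true
  have htf := h true false
  have hft := h false true
  have hff := h false false
  simp only [crossWord_true, crossWord_false] at htt htf hft hff ⊢
  obtain ⟨h3, htt⟩ := S.join_strand (i := m₂) (o := m₁) (b := m₂)
    (W := {strand a₁ b₂, strand a₂ b₁} + W) Word.perm htt
  obtain ⟨h4, -⟩ := S.circle (i := m₂) (W := {strand a₁ b₂, strand a₂ b₁} + W) Word.perm htt
  obtain ⟨h5, htf⟩ := S.join_snk (i := m₂) (o := m₁) (b := a₂) (c := e₂)
    (W := {strand a₁ b₂, src b₁ m₂ e₂} + W) Word.perm htf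
  obtain ⟨h6, -⟩ := S.bigon (x := m₂) (y := e₂) (i := a₂) (o := b₁)
    (W := {strand a₁ b₂} + W) Word.perm htf
  obtain ⟨h7, hft⟩ := S.join_src (i := m₁) (o := m₂) (b := b₂) (c := e₁)
    (W := {strand a₂ b₁, snk a₁ m₂ e₁} + W) Word.perm hft
  obtain ⟨h8, -⟩ := S.bigon (x := m₂) (y := e₁) (i := a₁) (o := b₂)
    (W := {strand a₂ b₁} + W) Word.perm hft
  obtain ⟨h9, -, -⟩ := S.quad (x₁₁ := m₁) (x₁₂ := e₁) (x₂₁ := e₂) (x₂₂ := m₂) (o₁ := b₂) (o₂ := b₁)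
    (i₁ := a₂) (i₂ := a₁) (W := W) Word.perm hff
  have c1 : F ({strand a₂ b₁} + ({strand a₁ b₂} + W)) = F ({strand a₁ b₂, strand a₂ b₁} + W) :=
    congrArg F Word.perm
  have c2 : F ({strand a₁ b₂} + ({strand a₂ b₁} + W)) = F ({strand a₁ b₂, strand a₂ b₁} + W) :=
    congrArg F Word.perm
  have c3 : F ({strand a₂ b₁, strand a₁ b₂} + W) = F ({strand a₁ b₂, strand a₂ b₁} + W) :=
    congrArg F Word.perm
  have c4 : F ({strand a₂ b₂} + ({strand a₁ b₁} + W)) = F ({strand a₂ b₂, strand a₁ b₁} + W) :=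
    congrArg F Word.perm
  rw [h1, h2, h3, h4, h5, h6, h7, h8, h9, c1, c2, c3, c4]
  linear_combination F ({strand a₂ b₂, strand a₁ b₁} + W) * hqq +
    F ({strand a₁ b₂, strand a₂ b₁} + W) * hq

/-- Inner edges may be renamed. -/
theorem rename_edge {a b c d e e' : ℕ} {V V' W : Multiset Atom}
    (hV : V = {src a b e, snk c d e} + W) (hV' : V' = {src a b e', snk c d e'} + W)
    (h : Below n V) (h' : Below n V') : F V = F V' := by
  have hi := h.1.nodup
  have hi' := h'.1.nodup
  have ho := h.1.nodup'
  have ho' := h'.1.nodup'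
  rw [← S.relabel V h (Equiv.swap e e')]
  congr 1
  subst hV hV'
  simp [src, snk] at hi ho hi' ho'
  have hW : Word.relabel (Equiv.swap e e') W = W := by
    apply relabel_swap_of_notMem (Or.inr ⟨?_, ?_⟩) <;> tauto
  have key : ∀ x, x ≠ e → x ≠ e' → Equiv.swap e e' x = x := fun x => Equiv.swap_apply_of_ne_of_ne
  rw [relabel_add, hW]
  simp only [Multiset.insert_eq_cons, relabel_cons, relabel_singleton, relabelAtom_src,
    relabelAtom_snk, Equiv.swap_apply_left]
  rw [key a (by tauto) (by tauto), key b (by tauto) (by tauto), key c (by tauto) (by tauto),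
    key d (by tauto) (by tauto)]

/-- The names of the first and the last inner edge of a path of three edges are exchanged; this
matches the states with two new edges on the two sides of the third move. -/
theorem swap_edges {a b c d g h m x y : ℕ} {V V' W : Multiset Atom}
    (hV : V = {snk a b x, src c m x, snk d m y, src g h y} + W)
    (hV' : V' = {snk a b y, src c m y, snk d m x, src g h x} + W)
    (hb : Below n V) : F V = F V' := by
  have hi := hb.1.nodup
  have ho := hb.1.nodup'
  rw [← S.relabel V hb (Equiv.swap x y)]
  congr 1
  subst hV hV'
  simp [src, snk] at hi ho
  have hW : Word.relabel (Equiv.swap x y) W = W := by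
    apply relabel_swap_of_notMem (Or.inr ⟨?_, ?_⟩) <;> tauto
  have key : ∀ z, z ≠ x → z ≠ y → Equiv.swap x y z = z := fun z => Equiv.swap_apply_of_ne_of_ne
  rw [relabel_add, hW]
  simp only [Multiset.insert_eq_cons, relabel_cons, relabel_singleton, relabelAtom_src,
    relabelAtom_snk, Equiv.swap_apply_left, Equiv.swap_apply_right]
  rw [key a (by tauto) (by tauto), key b (by tauto) (by tauto), key c (by tauto) (by tauto),
    key d (by tauto) (by tauto), key g (by tauto) (by tauto), key h (by tauto) (by tauto),
    key m (by tauto) (by tauto)]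

end Skein

end Word

/-! ### Local computations for the third Reidemeister move -/

namespace Word

variable {R : Type*} [CommRing R] {δ₂ δ₃ : R} {n : ℕ∞} {F : Multiset Atom → R}

/-- The weighted sum over the states of three crossings. -/
def tripleSum (p₁ q₁ p₂ q₂ p₃ q₃ : R) (g : Bool → Bool → Bool → R) : R :=
  p₁ * p₂ * p₃ * g true true true + p₁ * p₂ * q₃ * g true true false +
  p₁ * q₂ * p₃ * g true false true + p₁ * q₂ * q₃ * g true false false +
  q₁ * p₂ * p₃ * g false true true + q₁ * p₂ * q₃ * g false true false +
  q₁ * q₂ * p₃ * g false false true + q₁ * q₂ * q₃ * g false false false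

/-- A product of three disjoint transpositions, needed to exchange opposite sides of a hexagon. -/
theorem exists_triple_swap {a a' b b' c c' : ℕ} (h : [a, a', b, b', c, c'].Nodup) :
    ∃ σ : Equiv.Perm ℕ, σ a = a' ∧ σ a' = a ∧ σ b = b' ∧ σ b' = b ∧ σ c = c' ∧ σ c' = c ∧
      ∀ z, z ∉ [a, a', b, b', c, c'] → σ z = z := by
  simp only [List.nodup_cons, List.mem_cons, List.not_mem_nil, or_false, not_or] at h
  have key : ∀ {x y z : ℕ}, z ≠ x → z ≠ y → Equiv.swap x y z = z := Equiv.swap_apply_of_ne_of_ne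
  obtain ⟨⟨h1, h2, h3, h4, h5⟩, ⟨h6, h7, h8, h9⟩, ⟨h10, h11, h12⟩, ⟨h13, h14⟩, h15, -⟩ := h
  refine ⟨Equiv.swap a a' * (Equiv.swap b b' * Equiv.swap c c'), ?_, ?_, ?_, ?_, ?_, ?_, ?_⟩
  · rw [Equiv.Perm.mul_apply, Equiv.Perm.mul_apply, key h4 h5, key h2 h3, Equiv.swap_apply_left]
  · rw [Equiv.Perm.mul_apply, Equiv.Perm.mul_apply, key h8 h9, key h6 h7, Equiv.swap_apply_right]
  · rw [Equiv.Perm.mul_apply, Equiv.Perm.mul_apply, key h11 h12, Equiv.swap_apply_left,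
      key (Ne.symm h3) (Ne.symm h7)]
  · rw [Equiv.Perm.mul_apply, Equiv.Perm.mul_apply, key h13 h14, Equiv.swap_apply_right,
      key (Ne.symm h2) (Ne.symm h6)]
  · rw [Equiv.Perm.mul_apply, Equiv.Perm.mul_apply, Equiv.swap_apply_left,
      key (Ne.symm h12) (Ne.symm h14), key (Ne.symm h5) (Ne.symm h9)]
  · rw [Equiv.Perm.mul_apply, Equiv.Perm.mul_apply, Equiv.swap_apply_right,
      key (Ne.symm h11) (Ne.symm h13), key (Ne.symm h4) (Ne.symm h8)]
  · intro z hz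
    simp only [List.mem_cons, List.not_mem_nil, or_false, not_or] at hz
    obtain ⟨z1, z2, z3, z4, z5, z6⟩ := hz
    rw [Equiv.Perm.mul_apply, Equiv.Perm.mul_apply, key z5 z6, key z3 z4, key z1 z2]

namespace Skein

variable (S : Skein δ₂ δ₃ n F)
include S

/-- Three strands of which the first one meets the second one and then the third one, and the
third one meets the first one before the second one. -/
theorem braid {a₁ m₁ b₁ a₂ m₂ b₂ a₃ m₃ b₃ e₁ e₂ e₃ : ℕ} {W : Multiset Atom}
    {p₁ q₁ p₂ q₂ p₃ q₃ : R}
    (hq : q₁ * p₂ * p₃ + p₁ * p₂ * q₃ + δ₂ * (q₁ * p₂ * q₃) + q₁ * q₂ * q₃ = p₁ * q₂ * p₃)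
    (h : ∀ c₁ c₂ c₃, Below n (crossWord c₁ a₁ m₁ a₂ m₂ e₁ + (crossWord c₂ m₁ b₁ a₃ m₃ e₂ +
      (crossWord c₃ m₂ b₂ m₃ b₃ e₃ + W)))) :
    tripleSum p₁ q₁ p₂ q₂ p₃ q₃ (fun c₁ c₂ c₃ => F (crossWord c₁ a₁ m₁ a₂ m₂ e₁ +
      (crossWord c₂ m₁ b₁ a₃ m₃ e₂ + (crossWord c₃ m₂ b₂ m₃ b₃ e₃ + W)))) =
    p₁ * p₂ * p₃ * F ({strand a₁ b₃, strand a₂ b₂, strand a₃ b₁} + W) +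
    p₁ * q₂ * p₃ * (F ({src b₂ b₃ e₃, snk a₁ a₂ e₃} + ({strand a₃ b₁} + W)) +
      F ({src b₁ b₂ e₂, snk a₂ a₃ e₂} + ({strand a₁ b₃} + W))) +
    p₁ * q₂ * q₃ * F ({snk a₂ a₃ e₂, src b₁ m₃ e₂, snk a₁ m₃ e₃, src b₂ b₃ e₃} + W) +
    q₁ * q₂ * p₃ * F ({snk a₂ a₁ e₁, src b₃ m₁ e₁, snk a₃ m₁ e₂, src b₂ b₁ e₂} + W) +
    q₁ * q₂ * q₃ * F ({snk a₁ a₂ a₃, src b₁ b₂ b₃} + W) ∧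
    Below n ({src b₂ b₃ e₃, snk a₁ a₂ e₃} + ({strand a₃ b₁} + W)) ∧
    Below n ({src b₁ b₂ e₂, snk a₂ a₃ e₂} + ({strand a₁ b₃} + W)) ∧
    Below n ({snk a₂ a₃ e₂, src b₁ m₃ e₂, snk a₁ m₃ e₃, src b₂ b₃ e₃} + W) ∧
    Below n ({snk a₂ a₁ e₁, src b₃ m₁ e₁, snk a₃ m₁ e₂, src b₂ b₁ e₂} + W) := by
  have ttt := h true true true
  have ttf := h true true false
  have tft := h true false true
  have tff := h true false false
  have ftt := h false true true
  have ftf := h false true false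
  have fft := h false false true
  have fff := h false false false
  simp only [crossWord_true, crossWord_false] at ttt ttf tft tff ftt ftf fft fff
  -- The state without new edges.
  obtain ⟨x1, ttt⟩ := S.join_strand (i := a₁) (o := m₂) (b := b₃)
    (W := {strand a₂ m₁, strand m₁ m₃, strand a₃ b₁, strand m₃ b₂} + W) Word.perm ttt
  obtain ⟨x2, ttt⟩ := S.join_strand (i := a₂) (o := m₁) (b := m₃)
    (W := {strand a₁ b₃, strand a₃ b₁, strand m₃ b₂} + W) Word.perm ttt
  obtain ⟨x3, -⟩ := S.join_strand (i := a₂) (o := m₃) (b := b₂)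
    (W := {strand a₁ b₃, strand a₃ b₁} + W) Word.perm ttt
  have x4 : F ({strand a₂ b₂} + ({strand a₁ b₃, strand a₃ b₁} + W)) =
      F ({strand a₁ b₃, strand a₂ b₂, strand a₃ b₁} + W) := congrArg F Word.perm
  -- The states with one new edge.
  obtain ⟨y1, ttf⟩ := S.join_strand (i := a₂) (o := m₁) (b := m₃)
    (W := {strand a₁ m₂, strand a₃ b₁, src b₂ b₃ e₃, snk m₂ m₃ e₃} + W) Word.perm ttf
  obtain ⟨y2, ttf⟩ := S.join_snk (i := a₁) (o := m₂) (b := m₃) (c := e₃)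
    (W := {strand a₂ m₃, strand a₃ b₁, src b₂ b₃ e₃} + W) Word.perm ttf
  obtain ⟨y3, ttf⟩ := S.join_snk (i := a₂) (o := m₃) (b := a₁) (c := e₃)
    (W := {strand a₃ b₁, src b₂ b₃ e₃} + W) Word.perm ttf
  have yW : {snk a₂ a₁ e₃} + ({strand a₃ b₁, src b₂ b₃ e₃} + W) =
      {src b₂ b₃ e₃, snk a₁ a₂ e₃} + ({strand a₃ b₁} + W) := Word.perm
  rw [yW] at y3 ttf
  obtain ⟨z1, tft⟩ := S.join_strand (i := a₁) (o := m₂) (b := b₃)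
    (W := {strand a₂ m₁, strand m₃ b₂, src b₁ m₃ e₂, snk m₁ a₃ e₂} + W) Word.perm tft
  obtain ⟨z2, tft⟩ := S.join_snk (i := a₂) (o := m₁) (b := a₃) (c := e₂)
    (W := {strand a₁ b₃, strand m₃ b₂, src b₁ m₃ e₂} + W) Word.perm tft
  obtain ⟨z3, tft⟩ := S.join_src (i := m₃) (o := b₂) (b := b₁) (c := e₂)
    (W := {strand a₁ b₃, snk a₂ a₃ e₂} + W) Word.perm tft
  have zW : {src b₂ b₁ e₂} + ({strand a₁ b₃, snk a₂ a₃ e₂} + W) =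
      {src b₁ b₂ e₂, snk a₂ a₃ e₂} + ({strand a₁ b₃} + W) := Word.perm
  rw [zW] at z3 tft
  obtain ⟨u1, ftt⟩ := S.join_strand (i := m₁) (o := m₃) (b := b₂)
    (W := {strand a₃ b₁, strand m₂ b₃, src m₁ m₂ e₁, snk a₁ a₂ e₁} + W) Word.perm ftt
  obtain ⟨u2, ftt⟩ := S.join_src (i := m₁) (o := b₂) (b := m₂) (c := e₁)
    (W := {strand a₃ b₁, strand m₂ b₃, snk a₁ a₂ e₁} + W) Word.perm ftt
  obtain ⟨u3, ftt⟩ := S.join_src (i := m₂) (o := b₃) (b := b₂) (c := e₁)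
    (W := {strand a₃ b₁, snk a₁ a₂ e₁} + W) Word.perm ftt
  have uW : {src b₃ b₂ e₁} + ({strand a₃ b₁, snk a₁ a₂ e₁} + W) =
      {src b₂ b₃ e₁, snk a₁ a₂ e₁} + ({strand a₃ b₁} + W) := Word.perm
  rw [uW] at u3 ftt
  have u4 := S.rename_edge rfl rfl ftt ttf
  -- The states with two new edges.
  obtain ⟨v1, ftf⟩ := S.join_snk (i := m₁) (o := m₃) (b := m₂) (c := e₃)
    (W := {strand a₃ b₁, src m₁ m₂ e₁, snk a₁ a₂ e₁, src b₂ b₃ e₃} + W) Word.perm ftf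
  obtain ⟨v2, ftf⟩ := S.bigon (x := m₁) (y := m₂) (i := e₃) (o := e₁)
    (W := {strand a₃ b₁, snk a₁ a₂ e₁, src b₂ b₃ e₃} + W) Word.perm ftf
  obtain ⟨v3, ftf⟩ := S.join_snk (i := e₃) (o := e₁) (b := a₁) (c := a₂)
    (W := {strand a₃ b₁, src b₂ b₃ e₃} + W) Word.perm ftf
  have v4 : F ({snk e₃ a₁ a₂} + ({strand a₃ b₁, src b₂ b₃ e₃} + W)) =
      F ({src b₂ b₃ e₃, snk a₁ a₂ e₃} + ({strand a₃ b₁} + W)) := congrArg F Word.perm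
  obtain ⟨w1, tff⟩ := S.join_snk (i := a₁) (o := m₂) (b := m₃) (c := e₃)
    (W := {strand a₂ m₁, src b₁ m₃ e₂, snk m₁ a₃ e₂, src b₂ b₃ e₃} + W) Word.perm tff
  obtain ⟨w2, tff⟩ := S.join_snk (i := a₂) (o := m₁) (b := a₃) (c := e₂)
    (W := {src b₁ m₃ e₂, snk a₁ m₃ e₃, src b₂ b₃ e₃} + W) Word.perm tff
  have wW : {snk a₂ a₃ e₂} + ({src b₁ m₃ e₂, snk a₁ m₃ e₃, src b₂ b₃ e₃} + W) =
      {snk a₂ a₃ e₂, src b₁ m₃ e₂, snk a₁ m₃ e₃, src b₂ b₃ e₃} + W := Word.perm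
  rw [wW] at w2 tff
  obtain ⟨s1, fft⟩ := S.join_src (i := m₂) (o := b₃) (b := m₁) (c := e₁)
    (W := {strand m₃ b₂, snk a₁ a₂ e₁, src b₁ m₃ e₂, snk m₁ a₃ e₂} + W) Word.perm fft
  obtain ⟨s2, fft⟩ := S.join_src (i := m₃) (o := b₂) (b := b₁) (c := e₂)
    (W := {src b₃ m₁ e₁, snk a₁ a₂ e₁, snk m₁ a₃ e₂} + W) Word.perm fft
  have sW : {src b₂ b₁ e₂} + ({src b₃ m₁ e₁, snk a₁ a₂ e₁, snk m₁ a₃ e₂} + W) =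
      {snk a₂ a₁ e₁, src b₃ m₁ e₁, snk a₃ m₁ e₂, src b₂ b₁ e₂} + W := Word.perm
  rw [sW] at s2 fft
  -- The state with three new edges.
  obtain ⟨t1, h1, h2⟩ := S.quad (x₁₁ := m₁) (x₁₂ := m₂) (x₂₁ := e₂) (x₂₂ := m₃) (o₁ := e₁)
    (o₂ := b₁) (i₁ := a₃) (i₂ := e₃) (W := {snk a₁ a₂ e₁, src b₂ b₃ e₃} + W) Word.perm fff
  obtain ⟨t2, h1⟩ := S.join_snk (i := a₃) (o := e₁) (b := a₁) (c := a₂)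
    (W := {strand e₃ b₁, src b₂ b₃ e₃} + W) Word.perm h1
  obtain ⟨t3, -⟩ := S.join_src (i := e₃) (o := b₁) (b := b₂) (c := b₃)
    (W := {snk a₃ a₁ a₂} + W) Word.perm h1
  have t4 : F ({src b₁ b₂ b₃} + ({snk a₃ a₁ a₂} + W)) =
      F ({snk a₁ a₂ a₃, src b₁ b₂ b₃} + W) := congrArg F Word.perm
  obtain ⟨t5, h2⟩ := S.join_snk (i := e₃) (o := e₁) (b := a₁) (c := a₂)
    (W := {strand a₃ b₁, src b₂ b₃ e₃} + W) Word.perm h2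
  refine ⟨?_, ttf, tft, tff, fft⟩
  simp only [tripleSum, crossWord_true, crossWord_false]
  rw [x1, x2, x3, x4, y1, y2, y3, z1, z2, z3, u1, u2, u3, u4, v1, v2, v3, v4, w1, w2, s1, s2,
    t1, t2, t3, t4, t5, v4]
  -- Four contributions reduce to this word: the states `ttf`, `ftt`, `ftf`, and one term of `fff`.
  -- By `hq` their total coefficient is that of its mirror image, which comes from the state `tft`
  -- alone.
  linear_combination F ({src b₂ b₃ e₃, snk a₁ a₂ e₃} + ({strand a₃ b₁} + W)) * hq

/-- The expansion in `braid` is invariant under the simultaneous exchange of strands 1 and 3 and of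
crossings 1 and 3, up to names of inner edges. The same exchange carries one side of the move to the
other. -/
theorem braid_move {a₁ m₁ b₁ a₂ m₂ b₂ a₃ m₃ b₃ e₁ e₂ e₃ : ℕ} {W : Multiset Atom}
    {p₁ q₁ p₂ q₂ p₃ q₃ : R}
    (hq : q₁ * p₂ * p₃ + p₁ * p₂ * q₃ + δ₂ * (q₁ * p₂ * q₃) + q₁ * q₂ * q₃ = p₁ * q₂ * p₃)
    (h : ∀ c₁ c₂ c₃, Below n (crossWord c₁ a₁ m₁ a₂ m₂ e₁ + (crossWord c₂ m₁ b₁ a₃ m₃ e₂ +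
      (crossWord c₃ m₂ b₂ m₃ b₃ e₃ + W))))
    (h' : ∀ c₁ c₂ c₃, Below n (crossWord c₁ m₁ b₁ m₂ b₂ e₁ + (crossWord c₂ a₁ m₁ m₃ b₃ e₂ +
      (crossWord c₃ a₂ m₂ a₃ m₃ e₃ + W)))) :
    tripleSum p₁ q₁ p₂ q₂ p₃ q₃ (fun c₁ c₂ c₃ => F (crossWord c₁ a₁ m₁ a₂ m₂ e₁ +
      (crossWord c₂ m₁ b₁ a₃ m₃ e₂ + (crossWord c₃ m₂ b₂ m₃ b₃ e₃ + W)))) =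
    tripleSum p₁ q₁ p₂ q₂ p₃ q₃ (fun c₁ c₂ c₃ => F (crossWord c₁ m₁ b₁ m₂ b₂ e₁ +
      (crossWord c₂ a₁ m₁ m₃ b₃ e₂ + (crossWord c₃ a₂ m₂ a₃ m₃ e₃ + W)))) := by
  -- The other side in the form required by `braid`, with the indices 1 and 3 exchanged.
  have hw : ∀ c₁ c₂ c₃, crossWord c₁ m₁ b₁ m₂ b₂ e₁ + (crossWord c₂ a₁ m₁ m₃ b₃ e₂ +
      (crossWord c₃ a₂ m₂ a₃ m₃ e₃ + W)) = crossWord c₃ a₃ m₃ a₂ m₂ e₃ +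
      (crossWord c₂ m₃ b₃ a₁ m₁ e₂ + (crossWord c₁ m₂ b₂ m₁ b₁ e₁ + W)) := fun c₁ c₂ c₃ => by
    rw [crossWord_comm c₁, crossWord_comm c₂, crossWord_comm c₃]
    ac_rfl
  simp only [hw] at h' ⊢
  obtain ⟨k, y, z, u, v⟩ := S.braid hq h
  obtain ⟨k', y', z', u', v'⟩ := S.braid (p₁ := p₃) (q₁ := q₃) (p₂ := p₂) (q₂ := q₂) (p₃ := p₁)
    (q₃ := q₁) (by linear_combination hq) fun c₁ c₂ c₃ => h' c₃ c₂ c₁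
  have r1 := S.rename_edge (a := b₂) (b := b₃) (c := a₁) (d := a₂) (e := e₃) (e' := e₂)
    (W := {strand a₃ b₁} + W) rfl Word.perm y z'
  have r2 := S.rename_edge (a := b₁) (b := b₂) (c := a₂) (d := a₃) (e := e₂) (e' := e₁)
    (W := {strand a₁ b₃} + W) rfl Word.perm z y'
  have r3 := S.swap_edges (V' := {snk a₂ a₃ e₃, src b₁ m₃ e₃, snk a₁ m₃ e₂, src b₂ b₃ e₂} + W)
    rfl rfl u
  have r4 := S.swap_edges (V' := {snk a₂ a₁ e₂, src b₃ m₁ e₂, snk a₃ m₁ e₁, src b₂ b₁ e₁} + W)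
    rfl rfl v
  have r5 : F ({strand a₃ b₁, strand a₂ b₂, strand a₁ b₃} + W) =
      F ({strand a₁ b₃, strand a₂ b₂, strand a₃ b₁} + W) := congrArg F Word.perm
  have r6 : F ({snk a₃ a₂ a₁, src b₃ b₂ b₁} + W) = F ({snk a₁ a₂ a₃, src b₁ b₂ b₃} + W) :=
    congrArg F Word.perm
  rw [k, r1, r2, r3, r4, ← r5, ← r6]
  simp only [tripleSum] at k' ⊢
  linear_combination -k'

/-- The inner arcs close up to a circle in the oriented state. The states with one new edge have a
bigon and those with two have a quadrilateral; all of them, and the circle, contribute to the word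
`{strand a₁ b₂, strand a₃ b₁, strand a₂ b₃}`. `hq` says that its coefficient vanishes. The state
with three new edges is a hexagon, which stays as it is. -/
theorem cyclic {a₁ m₁ b₁ a₂ m₂ b₂ a₃ m₃ b₃ e₁ e₂ e₃ : ℕ} {W : Multiset Atom}
    {p₁ q₁ p₂ q₂ p₃ q₃ : R}
    (hq : p₁ * p₂ * p₃ * δ₃ + δ₂ * (q₁ * p₂ * p₃ + p₁ * q₂ * p₃ + p₁ * p₂ * q₃) +
      (p₁ * q₂ * q₃ + q₁ * p₂ * q₃ + q₁ * q₂ * p₃) = 0)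
    (h : ∀ c₁ c₂ c₃, Below n (crossWord c₁ a₁ m₁ m₂ b₂ e₁ + (crossWord c₂ m₁ b₁ a₃ m₃ e₂ +
      (crossWord c₃ a₂ m₂ m₃ b₃ e₃ + W)))) :
    tripleSum p₁ q₁ p₂ q₂ p₃ q₃ (fun c₁ c₂ c₃ => F (crossWord c₁ a₁ m₁ m₂ b₂ e₁ +
      (crossWord c₂ m₁ b₁ a₃ m₃ e₂ + (crossWord c₃ a₂ m₂ m₃ b₃ e₃ + W)))) =
    p₁ * q₂ * q₃ * F ({strand a₁ b₂, strand a₃ b₃, strand a₂ b₁} + W) +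
    q₁ * p₂ * q₃ * F ({strand a₁ b₃, strand a₃ b₁, strand a₂ b₂} + W) +
    q₁ * q₂ * p₃ * F ({strand a₁ b₁, strand a₃ b₂, strand a₂ b₃} + W) +
    q₁ * q₂ * q₃ * F ({src m₁ b₂ e₁, snk a₁ m₂ e₁, src b₁ m₃ e₂, snk m₁ a₃ e₂, src m₂ b₃ e₃,
      snk a₂ m₃ e₃} + W) := by
  have ttt := h true true true
  have ttf := h true true false
  have tft := h true false true
  have tff := h true false false
  have ftt := h false true true
  have ftf := h false true false
  have fft := h false false true
  simp only [crossWord_true, crossWord_false] at ttt ttf tft tff ftt ftf fft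
  obtain ⟨x1, ttt⟩ := S.join_strand (i := m₂) (o := m₁) (b := m₃)
    (W := {strand a₁ b₂, strand a₃ b₁, strand a₂ b₃, strand m₃ m₂} + W) Word.perm ttt
  obtain ⟨x2, ttt⟩ := S.join_strand (i := m₂) (o := m₃) (b := m₂)
    (W := {strand a₁ b₂, strand a₃ b₁, strand a₂ b₃} + W) Word.perm ttt
  obtain ⟨x3, -⟩ := S.circle (i := m₂)
    (W := {strand a₁ b₂, strand a₃ b₁, strand a₂ b₃} + W) Word.perm ttt
  -- The states with one new edge.
  obtain ⟨y1, ttf⟩ := S.join_strand (i := m₂) (o := m₁) (b := m₃)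
    (W := {strand a₁ b₂, strand a₃ b₁, src m₂ b₃ e₃, snk a₂ m₃ e₃} + W) Word.perm ttf
  obtain ⟨y2, ttf⟩ := S.join_snk (i := m₂) (o := m₃) (b := a₂) (c := e₃)
    (W := {strand a₁ b₂, strand a₃ b₁, src m₂ b₃ e₃} + W) Word.perm ttf
  obtain ⟨y3, -⟩ := S.bigon (x := m₂) (y := e₃) (i := a₂) (o := b₃)
    (W := {strand a₁ b₂, strand a₃ b₁} + W) Word.perm ttf
  have y4 : F ({strand a₂ b₃} + ({strand a₁ b₂, strand a₃ b₁} + W)) =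
      F ({strand a₁ b₂, strand a₃ b₁, strand a₂ b₃} + W) := congrArg F Word.perm
  obtain ⟨z1, tft⟩ := S.join_strand (i := m₃) (o := m₂) (b := m₁)
    (W := {strand a₁ b₂, strand a₂ b₃, src b₁ m₃ e₂, snk m₁ a₃ e₂} + W) Word.perm tft
  obtain ⟨z2, tft⟩ := S.join_snk (i := m₃) (o := m₁) (b := a₃) (c := e₂)
    (W := {strand a₁ b₂, strand a₂ b₃, src b₁ m₃ e₂} + W) Word.perm tft
  obtain ⟨z3, -⟩ := S.bigon (x := m₃) (y := e₂) (i := a₃) (o := b₁)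
    (W := {strand a₁ b₂, strand a₂ b₃} + W) Word.perm tft
  have z4 : F ({strand a₃ b₁} + ({strand a₁ b₂, strand a₂ b₃} + W)) =
      F ({strand a₁ b₂, strand a₃ b₁, strand a₂ b₃} + W) := congrArg F Word.perm
  obtain ⟨u1, ftt⟩ := S.join_strand (i := m₁) (o := m₃) (b := m₂)
    (W := {strand a₃ b₁, strand a₂ b₃, src m₁ b₂ e₁, snk a₁ m₂ e₁} + W) Word.perm ftt
  obtain ⟨u2, ftt⟩ := S.join_snk (i := m₁) (o := m₂) (b := a₁) (c := e₁)
    (W := {strand a₃ b₁, strand a₂ b₃, src m₁ b₂ e₁} + W) Word.perm ftt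
  obtain ⟨u3, -⟩ := S.bigon (x := m₁) (y := e₁) (i := a₁) (o := b₂)
    (W := {strand a₃ b₁, strand a₂ b₃} + W) Word.perm ftt
  have u4 : F ({strand a₁ b₂} + ({strand a₃ b₁, strand a₂ b₃} + W)) =
      F ({strand a₁ b₂, strand a₃ b₁, strand a₂ b₃} + W) := congrArg F Word.perm
  -- The states with two new edges.
  obtain ⟨v1, tff⟩ := S.join_snk (i := m₂) (o := m₁) (b := a₃) (c := e₂)
    (W := {strand a₁ b₂, src b₁ m₃ e₂, src m₂ b₃ e₃, snk a₂ m₃ e₃} + W) Word.perm tff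
  obtain ⟨v2, -, -⟩ := S.quad (x₁₁ := m₂) (x₁₂ := e₃) (x₂₁ := e₂) (x₂₂ := m₃) (o₁ := b₃) (o₂ := b₁)
    (i₁ := a₃) (i₂ := a₂) (W := {strand a₁ b₂} + W) Word.perm tff
  have v3 : F ({strand a₃ b₃, strand a₂ b₁} + ({strand a₁ b₂} + W)) =
      F ({strand a₁ b₂, strand a₃ b₃, strand a₂ b₁} + W) := congrArg F Word.perm
  have v4 : F ({strand a₃ b₁, strand a₂ b₃} + ({strand a₁ b₂} + W)) =
      F ({strand a₁ b₂, strand a₃ b₁, strand a₂ b₃} + W) := congrArg F Word.perm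
  obtain ⟨w1, ftf⟩ := S.join_snk (i := m₁) (o := m₃) (b := a₂) (c := e₃)
    (W := {strand a₃ b₁, src m₁ b₂ e₁, snk a₁ m₂ e₁, src m₂ b₃ e₃} + W) Word.perm ftf
  obtain ⟨w2, -, -⟩ := S.quad (x₁₁ := m₁) (x₁₂ := e₁) (x₂₁ := e₃) (x₂₂ := m₂) (o₁ := b₂) (o₂ := b₃)
    (i₁ := a₂) (i₂ := a₁) (W := {strand a₃ b₁} + W) Word.perm ftf
  have w3 : F ({strand a₂ b₂, strand a₁ b₃} + ({strand a₃ b₁} + W)) =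
      F ({strand a₁ b₃, strand a₃ b₁, strand a₂ b₂} + W) := congrArg F Word.perm
  have w4 : F ({strand a₂ b₃, strand a₁ b₂} + ({strand a₃ b₁} + W)) =
      F ({strand a₁ b₂, strand a₃ b₁, strand a₂ b₃} + W) := congrArg F Word.perm
  obtain ⟨s1, fft⟩ := S.join_snk (i := m₃) (o := m₂) (b := a₁) (c := e₁)
    (W := {strand a₂ b₃, src m₁ b₂ e₁, src b₁ m₃ e₂, snk m₁ a₃ e₂} + W) Word.perm fft
  obtain ⟨s2, -, -⟩ := S.quad (x₁₁ := m₁) (x₁₂ := e₁) (x₂₁ := e₂) (x₂₂ := m₃) (o₁ := b₂) (o₂ := b₁)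
    (i₁ := a₃) (i₂ := a₁) (W := {strand a₂ b₃} + W) Word.perm fft
  have s3 : F ({strand a₃ b₂, strand a₁ b₁} + ({strand a₂ b₃} + W)) =
      F ({strand a₁ b₁, strand a₃ b₂, strand a₂ b₃} + W) := congrArg F Word.perm
  have s4 : F ({strand a₃ b₁, strand a₁ b₂} + ({strand a₂ b₃} + W)) =
      F ({strand a₁ b₂, strand a₃ b₁, strand a₂ b₃} + W) := congrArg F Word.perm
  have t1 : F ({src m₁ b₂ e₁, snk a₁ m₂ e₁} + ({src b₁ m₃ e₂, snk m₁ a₃ e₂} +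
      ({src m₂ b₃ e₃, snk a₂ m₃ e₃} + W))) =
      F ({src m₁ b₂ e₁, snk a₁ m₂ e₁, src b₁ m₃ e₂, snk m₁ a₃ e₂, src m₂ b₃ e₃,
        snk a₂ m₃ e₃} + W) := congrArg F Word.perm
  simp only [tripleSum, crossWord_true, crossWord_false]
  rw [x1, x2, x3, y1, y2, y3, y4, z1, z2, z3, z4, u1, u2, u3, u4, v1, v2, v3, v4, w1, w2, w3, w4,
    s1, s2, s3, s4, t1]
  linear_combination F ({strand a₁ b₂, strand a₃ b₁, strand a₂ b₃} + W) * hq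

/-- Exchanging the names of opposite sides turns the hexagon of one side of the move into that of
the other: the same cycle with the same outer edges, but the arcs and the new edges play each
other's role. -/
theorem swap_hexagon {a₁ m₁ b₁ a₂ m₂ b₂ a₃ m₃ b₃ e₁ e₂ e₃ : ℕ} {V V' W : Multiset Atom}
    (hV : V = {src m₁ b₂ e₁, snk a₁ m₂ e₁, src b₁ m₃ e₂, snk m₁ a₃ e₂, src m₂ b₃ e₃,
      snk a₂ m₃ e₃} + W)
    (hV' : V' = {src e₃ b₂ m₃, snk a₁ e₂ m₃, src b₁ e₁ m₂, snk e₃ a₃ m₂, src e₂ b₃ m₁,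
      snk a₂ e₁ m₁} + W) (hb : Below n V) : F V = F V' := by
  have hi := hb.1.nodup
  have ho := hb.1.nodup'
  subst hV hV'
  simp [src, snk] at hi ho
  have hd : [m₁, e₃, e₁, m₃, e₂, m₂].Nodup := by
    clear hb ho
    simp only [List.nodup_cons, List.mem_cons, List.not_mem_nil, or_false, not_or]
    refine ⟨⟨?_, ?_, ?_, ?_, ?_⟩, ⟨?_, ?_, ?_, ?_⟩, ⟨?_, ?_, ?_⟩, ⟨?_, ?_⟩, ?_, by simp⟩ <;>
      (rintro rfl; simp at hi)
  obtain ⟨σ, k1, k2, k3, k4, k5, k6, k⟩ := exists_triple_swap hd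
  have kz : ∀ z, z ≠ m₁ → z ≠ e₃ → z ≠ e₁ → z ≠ m₃ → z ≠ e₂ → z ≠ m₂ → σ z = z :=
    fun z h1 h2 h3 h4 h5 h6 => k z (by simp [h1, h2, h3, h4, h5, h6])
  have ka₁ : σ a₁ = a₁ := by apply kz <;> (clear hb ho; rintro rfl; simp at hi)
  have ka₂ : σ a₂ = a₂ := by apply kz <;> (clear hb ho; rintro rfl; simp at hi)
  have ka₃ : σ a₃ = a₃ := by apply kz <;> (clear hb ho; rintro rfl; simp at hi)
  have kb₁ : σ b₁ = b₁ := by apply kz <;> (clear hb hi; rintro rfl; simp at ho)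
  have kb₂ : σ b₂ = b₂ := by apply kz <;> (clear hb hi; rintro rfl; simp at ho)
  have kb₃ : σ b₃ = b₃ := by apply kz <;> (clear hb hi; rintro rfl; simp at ho)
  have hW : Word.relabel σ W = W := by
    conv_rhs => rw [← relabel_id W]
    refine relabel_congr fun z hz => ?_
    rcases hz with hz | hz
    · apply kz <;> (clear hb ho; rintro rfl; simp [hz] at hi)
    · apply kz <;> (clear hb hi; rintro rfl; simp [hz] at ho)
  rw [← S.relabel _ hb σ, relabel_add, hW]
  simp only [Multiset.insert_eq_cons, relabel_cons, relabel_singleton, relabelAtom_src,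
    relabelAtom_snk, ka₁, ka₂, ka₃, kb₁, kb₂, kb₃, k1, k2, k3, k4, k5, k6]

/-- The other side is again of the form of `cyclic`, with strands 2 and 3 and crossings 1 and 2
exchanged. The three surviving smoothings are permuted with their coefficients, and the hexagons
agree. -/
theorem cyclic_move {a₁ m₁ b₁ a₂ m₂ b₂ a₃ m₃ b₃ e₁ e₂ e₃ : ℕ} {W : Multiset Atom}
    {p₁ q₁ p₂ q₂ p₃ q₃ : R}
    (hq : p₁ * p₂ * p₃ * δ₃ + δ₂ * (q₁ * p₂ * p₃ + p₁ * q₂ * p₃ + p₁ * p₂ * q₃) +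
      (p₁ * q₂ * q₃ + q₁ * p₂ * q₃ + q₁ * q₂ * p₃) = 0)
    (h : ∀ c₁ c₂ c₃, Below n (crossWord c₁ a₁ m₁ m₂ b₂ e₁ + (crossWord c₂ m₁ b₁ a₃ m₃ e₂ +
      (crossWord c₃ a₂ m₂ m₃ b₃ e₃ + W))))
    (h' : ∀ c₁ c₂ c₃, Below n (crossWord c₁ m₁ b₁ a₂ m₂ e₁ + (crossWord c₂ a₁ m₁ m₃ b₃ e₂ +
      (crossWord c₃ m₂ b₂ a₃ m₃ e₃ + W)))) :
    tripleSum p₁ q₁ p₂ q₂ p₃ q₃ (fun c₁ c₂ c₃ => F (crossWord c₁ a₁ m₁ m₂ b₂ e₁ +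
      (crossWord c₂ m₁ b₁ a₃ m₃ e₂ + (crossWord c₃ a₂ m₂ m₃ b₃ e₃ + W)))) =
    tripleSum p₁ q₁ p₂ q₂ p₃ q₃ (fun c₁ c₂ c₃ => F (crossWord c₁ m₁ b₁ a₂ m₂ e₁ +
      (crossWord c₂ a₁ m₁ m₃ b₃ e₂ + (crossWord c₃ m₂ b₂ a₃ m₃ e₃ + W)))) := by
  have hw : ∀ c₁ c₂ c₃, crossWord c₁ m₁ b₁ a₂ m₂ e₁ + (crossWord c₂ a₁ m₁ m₃ b₃ e₂ +
      (crossWord c₃ m₂ b₂ a₃ m₃ e₃ + W)) = crossWord c₂ a₁ m₁ m₃ b₃ e₂ +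
      (crossWord c₁ m₁ b₁ a₂ m₂ e₁ + (crossWord c₃ a₃ m₃ m₂ b₂ e₃ + W)) := fun c₁ c₂ c₃ => by
    rw [crossWord_comm c₃]
    ac_rfl
  simp only [hw] at h' ⊢
  have k := S.cyclic hq h
  have k' := S.cyclic (p₁ := p₂) (q₁ := q₂) (p₂ := p₁) (q₂ := q₁) (p₃ := p₃) (q₃ := q₃)
    (by linear_combination hq) fun c₁ c₂ c₃ => h' c₂ c₁ c₃
  have hf := h false false false
  simp only [crossWord_false] at hf
  have r1 : F ({src m₁ b₂ e₁, snk a₁ m₂ e₁, src b₁ m₃ e₂, snk m₁ a₃ e₂, src m₂ b₃ e₃,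
      snk a₂ m₃ e₃} + W) = F ({src m₁ b₃ e₂, snk a₁ m₃ e₂, src b₁ m₂ e₁, snk m₁ a₂ e₁, src m₃ b₂ e₃,
      snk a₃ m₂ e₃} + W) := by
    refine Eq.trans (congrArg F ?_) ((S.swap_hexagon (a₁ := a₁) (m₁ := m₁) (b₁ := b₁) (a₂ := a₂)
      (m₂ := m₂) (b₂ := b₂) (a₃ := a₃) (m₃ := m₃) (b₃ := b₃) (e₁ := e₁) (e₂ := e₂) (e₃ := e₃) (W := W)
      Word.perm rfl hf).trans (congrArg F ?_))
    · exact Word.perm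
    · exact Word.perm
  have r2 : F ({strand a₁ b₃, strand a₂ b₂, strand a₃ b₁} + W) =
      F ({strand a₁ b₃, strand a₃ b₁, strand a₂ b₂} + W) := congrArg F Word.perm
  have r3 : F ({strand a₁ b₂, strand a₂ b₁, strand a₃ b₃} + W) =
      F ({strand a₁ b₂, strand a₃ b₃, strand a₂ b₁} + W) := congrArg F Word.perm
  have r4 : F ({strand a₁ b₁, strand a₂ b₃, strand a₃ b₂} + W) =
      F ({strand a₁ b₁, strand a₃ b₂, strand a₂ b₃} + W) := congrArg F Word.perm
  rw [k, r1, ← r2, ← r3, ← r4]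
  simp only [tripleSum] at k' ⊢
  linear_combination -k'

end Skein

end Word

/-! ### Weights of the crossings -/

/-- The weight of a crossing of sign `ε` in a local state. -/
noncomputable def crossWeight (ε : ℤˣ) (c : Bool) : GraphPoly :=
  if c then powA (2 * ε) else -powA (-(ε : ℤ))

theorem powA_mul_neg (k : ℤ) : powA k * powA (-k) = 1 := by
  rw [powA_mul, add_neg_cancel, powA_zero]

/-- The values are invariant under A ↦ A⁻¹. Written in B = A^ε and C = A^(-ε), all weight identities
below follow from BC = 1 for both signs at once. -/
theorem bigonValue_eq (ε : ℤˣ) : bigonValue = powA ε ^ 3 + powA (-(ε : ℤ)) ^ 3 := by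
  have h : ∀ k : ℤ, powA k ^ 3 = powA (3 * k) := fun k => by
    rw [pow_succ, pow_two, powA_mul, powA_mul]
    ring_nf
  rw [h, h, bigonValue]
  rcases Int.units_eq_one_or ε with rfl | rfl
  · simp
  · simp [add_comm]

theorem circleValue_eq (ε : ℤˣ) : circleValue = powA ε ^ 6 + 1 + powA (-(ε : ℤ)) ^ 6 := by
  have h := bigonValue_mul_self
  rw [bigonValue_eq ε] at h
  linear_combination -h + 2 * (powA ε ^ 2 * powA (-(ε : ℤ)) ^ 2 + powA ε * powA (-(ε : ℤ)) + 1) *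
    powA_mul_neg ε

theorem crossWeight_true (ε : ℤˣ) : crossWeight ε true = powA ε ^ 2 := by
  rw [crossWeight, if_pos rfl, pow_two, powA_mul, two_mul]

theorem crossWeight_false (ε : ℤˣ) : crossWeight ε false = -powA (-(ε : ℤ)) := rfl

theorem crossWeight_neg_true (ε : ℤˣ) : crossWeight (-ε) true = powA (-(ε : ℤ)) ^ 2 := by
  rw [crossWeight_true, Units.val_neg]

theorem crossWeight_neg_false (ε : ℤˣ) : crossWeight (-ε) false = -powA ε := by
  rw [crossWeight_false, Units.val_neg, neg_neg]

/-- B²(B⁶ + 1 + C⁶) - C(B³ + C³) = B⁸ when BC = 1; this is the origin of the exponent -8 in the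
normalization. -/
theorem kink_weight (ε : ℤˣ) :
    crossWeight ε true * circleValue + crossWeight ε false * bigonValue = powA (8 * ε) := by
  have h8 : powA (8 * ε) = powA ε ^ 8 := by
    have : ∀ n : ℕ, powA ε ^ n = powA (n * ε) := fun n => by
      induction n with
      | zero => simp [powA_zero]
      | succ n ih =>
        rw [pow_succ, ih, powA_mul]
        congr 1
        push_cast
        ring
    rw [this]
    rfl
  rw [h8, crossWeight_true, crossWeight_false, bigonValue_eq ε, circleValue_eq ε]
  have h := powA_mul_neg ε
  generalize powA ε = B at *
  generalize powA (-(ε : ℤ)) = C at *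
  linear_combination (C ^ 4 * (B * C + 1) - B ^ 2) * h

section

variable (o : ℤˣ)

/-- This identity and the next two are the hypothesis of `Word.Skein.braid` for the sign patterns
(o, o, o), (o, -o, -o), (-o, -o, o), in the order in which that lemma reads the crossings. -/
theorem braid_weight_one :
    crossWeight o false * crossWeight o true * crossWeight o true +
      crossWeight o true * crossWeight o true * crossWeight o false +
      bigonValue * (crossWeight o false * crossWeight o true * crossWeight o false) +
      crossWeight o false * crossWeight o false * crossWeight o false =
      crossWeight o true * crossWeight o false * crossWeight o true := by
  rw [crossWeight_true, crossWeight_false, bigonValue_eq o]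
  have h := powA_mul_neg o
  generalize powA o = B at *
  generalize powA (-(o : ℤ)) = C at *
  linear_combination (B ^ 4 * C + C ^ 3 * (B * C + 1)) * h

theorem braid_weight_two :
    crossWeight o false * crossWeight (-o) true * crossWeight (-o) true +
      crossWeight o true * crossWeight (-o) true * crossWeight (-o) false +
      bigonValue * (crossWeight o false * crossWeight (-o) true * crossWeight (-o) false) +
      crossWeight o false * crossWeight (-o) false * crossWeight (-o) false =
      crossWeight o true * crossWeight (-o) false * crossWeight (-o) true := by
  rw [crossWeight_neg_true, crossWeight_neg_false, crossWeight_true, crossWeight_false,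
    bigonValue_eq o]
  have h := powA_mul_neg o
  generalize powA o = B at *
  generalize powA (-(o : ℤ)) = C at *
  grind

theorem braid_weight_three :
    crossWeight (-o) false * crossWeight (-o) true * crossWeight o true +
      crossWeight (-o) true * crossWeight (-o) true * crossWeight o false +
      bigonValue * (crossWeight (-o) false * crossWeight (-o) true * crossWeight o false) +
      crossWeight (-o) false * crossWeight (-o) false * crossWeight o false =
      crossWeight (-o) true * crossWeight (-o) false * crossWeight o true := by
  rw [crossWeight_neg_true, crossWeight_neg_false, crossWeight_true, crossWeight_false,
    bigonValue_eq o]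
  have h := powA_mul_neg o
  generalize powA o = B at *
  generalize powA (-(o : ℤ)) = C at *
  grind

theorem cyclic_weight :
    crossWeight (-o) true * crossWeight o true * crossWeight (-o) true * circleValue +
      bigonValue * (crossWeight (-o) false * crossWeight o true * crossWeight (-o) true +
        crossWeight (-o) true * crossWeight o false * crossWeight (-o) true +
        crossWeight (-o) true * crossWeight o true * crossWeight (-o) false) +
      (crossWeight (-o) true * crossWeight o false * crossWeight (-o) false +
        crossWeight (-o) false * crossWeight o true * crossWeight (-o) false +
        crossWeight (-o) false * crossWeight o false * crossWeight (-o) true) = 0 := by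
  rw [crossWeight_neg_true, crossWeight_neg_false, crossWeight_true, crossWeight_false,
    bigonValue_eq o, circleValue_eq o]
  have h := powA_mul_neg o
  generalize powA o = B at *
  generalize powA (-(o : ℤ)) = C at *
  grind

theorem parallel_weight : crossWeight o true * crossWeight (-o) false +
    crossWeight o false * crossWeight (-o) true +
    bigonValue * (crossWeight o false * crossWeight (-o) false) = 0 := by
  rw [crossWeight_neg_true, crossWeight_neg_false, crossWeight_true, crossWeight_false,
    bigonValue_eq o]
  have h := powA_mul_neg o
  generalize powA o = B at *
  generalize powA (-(o : ℤ)) = C at *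
  linear_combination (B ^ 3 + C ^ 3) * h

theorem crossWeight_true_mul_neg : crossWeight o true * crossWeight (-o) true = 1 := by
  rw [crossWeight_neg_true, crossWeight_true, ← mul_pow, powA_mul_neg, one_pow]

theorem crossWeight_false_mul_neg : crossWeight o false * crossWeight (-o) false = 1 := by
  rw [crossWeight_neg_false, crossWeight_false]
  linear_combination powA_mul_neg o

/-- By `parallel_weight` the mixed products add up to -δ₂, so the claim is δ₃ - δ₂² + 1 = 0, the
relation already used for confluence. -/
theorem antiparallel_weight : crossWeight o true * crossWeight (-o) true * circleValue +
    (crossWeight o true * crossWeight (-o) false + crossWeight o false * crossWeight (-o) true) *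
      bigonValue + crossWeight o false * crossWeight (-o) false = 0 := by
  have h := parallel_weight o
  rw [crossWeight_false_mul_neg] at *
  rw [crossWeight_true_mul_neg]
  linear_combination bigonValue * h - bigonValue_mul_self

end

/-- The third Reidemeister move on words. Each of the three strands passes two consecutive points
`pᵢ` and `qᵢ`, in this order or in the opposite one; the label of the arc that arrives there is `i`,
and the label of the arc that leaves is `o`. -/
theorem Word.Skein.triple_move {F : Multiset Atom → GraphPoly}
    (S : Skein bigonValue circleValue ⊤ F) {ip₁ op₁ iq₁ oq₁ ip₂ op₂ iq₂ oq₂ ip₃ op₃ iq₃ oq₃ e₁ e₂ e₃ : ℕ}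
    {W : Multiset Atom} {t m b o : ℤˣ}
    (ht : t = 1 ∧ op₁ = iq₁ ∨ t = -1 ∧ oq₁ = ip₁) (hm : m = 1 ∧ op₂ = iq₂ ∨ m = -1 ∧ oq₂ = ip₂)
    (hb : b = 1 ∧ op₃ = iq₃ ∨ b = -1 ∧ oq₃ = ip₃)
    (h : ∀ c₁ c₂ c₃, Below ⊤ (crossWord c₁ ip₁ op₁ ip₂ op₂ e₁ + (crossWord c₂ iq₁ oq₁ ip₃ op₃ e₂ +
      (crossWord c₃ iq₂ oq₂ iq₃ oq₃ e₃ + W))))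
    (h' : ∀ c₁ c₂ c₃, Below ⊤ (crossWord c₁ iq₁ oq₁ iq₂ oq₂ e₁ + (crossWord c₂ ip₁ op₁ iq₃ oq₃ e₂ +
      (crossWord c₃ ip₂ op₂ ip₃ op₃ e₃ + W)))) :
    tripleSum (crossWeight (o * t * m) true) (crossWeight (o * t * m) false)
      (crossWeight (o * t * b) true) (crossWeight (o * t * b) false)
      (crossWeight (o * m * b) true) (crossWeight (o * m * b) false)
      (fun c₁ c₂ c₃ => F (crossWord c₁ ip₁ op₁ ip₂ op₂ e₁ + (crossWord c₂ iq₁ oq₁ ip₃ op₃ e₂ +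
        (crossWord c₃ iq₂ oq₂ iq₃ oq₃ e₃ + W)))) =
    tripleSum (crossWeight (o * t * m) true) (crossWeight (o * t * m) false)
      (crossWeight (o * t * b) true) (crossWeight (o * t * b) false)
      (crossWeight (o * m * b) true) (crossWeight (o * m * b) false)
      (fun c₁ c₂ c₃ => F (crossWord c₁ iq₁ oq₁ iq₂ oq₂ e₁ + (crossWord c₂ ip₁ op₁ iq₃ oq₃ e₂ +
        (crossWord c₃ ip₂ op₂ ip₃ op₃ e₃ + W)))) := by
  -- The three letters of the names `ppp`, `ppn`, `npp`, `pnp` are the signs of `t`, `m`, `b`. The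
  -- first three are braid-like after reordering strands and crossings; `pnp` is the cyclic
  -- triangle.
  have ppp : ∀ {a₁ m₁ b₁ a₂ m₂ b₂ a₃ m₃ b₃ e₁ e₂ e₃ : ℕ},
      (∀ c₁ c₂ c₃, Below ⊤ (crossWord c₁ a₁ m₁ a₂ m₂ e₁ + (crossWord c₂ m₁ b₁ a₃ m₃ e₂ +
        (crossWord c₃ m₂ b₂ m₃ b₃ e₃ + W)))) →
      (∀ c₁ c₂ c₃, Below ⊤ (crossWord c₁ m₁ b₁ m₂ b₂ e₁ + (crossWord c₂ a₁ m₁ m₃ b₃ e₂ +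
        (crossWord c₃ a₂ m₂ a₃ m₃ e₃ + W)))) →
      tripleSum (crossWeight o true) (crossWeight o false) (crossWeight o true)
        (crossWeight o false) (crossWeight o true) (crossWeight o false)
        (fun c₁ c₂ c₃ => F (crossWord c₁ a₁ m₁ a₂ m₂ e₁ + (crossWord c₂ m₁ b₁ a₃ m₃ e₂ +
        (crossWord c₃ m₂ b₂ m₃ b₃ e₃ + W)))) =
      tripleSum (crossWeight o true) (crossWeight o false) (crossWeight o true)
        (crossWeight o false) (crossWeight o true) (crossWeight o false)
        (fun c₁ c₂ c₃ => F (crossWord c₁ m₁ b₁ m₂ b₂ e₁ + (crossWord c₂ a₁ m₁ m₃ b₃ e₂ +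
        (crossWord c₃ a₂ m₂ a₃ m₃ e₃ + W)))) := fun h h' =>
    S.braid_move (braid_weight_one o) h h'
  have ppn : ∀ {a₁ m₁ b₁ a₂ m₂ b₂ a₃ m₃ b₃ e₁ e₂ e₃ : ℕ},
      (∀ c₁ c₂ c₃, Below ⊤ (crossWord c₁ a₁ m₁ a₂ m₂ e₁ + (crossWord c₂ m₁ b₁ m₃ b₃ e₂ +
        (crossWord c₃ m₂ b₂ a₃ m₃ e₃ + W)))) →
      (∀ c₁ c₂ c₃, Below ⊤ (crossWord c₁ m₁ b₁ m₂ b₂ e₁ + (crossWord c₂ a₁ m₁ a₃ m₃ e₂ +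
        (crossWord c₃ a₂ m₂ m₃ b₃ e₃ + W)))) →
      tripleSum (crossWeight o true) (crossWeight o false) (crossWeight (-o) true)
        (crossWeight (-o) false) (crossWeight (-o) true) (crossWeight (-o) false)
        (fun c₁ c₂ c₃ => F (crossWord c₁ a₁ m₁ a₂ m₂ e₁ + (crossWord c₂ m₁ b₁ m₃ b₃ e₂ +
        (crossWord c₃ m₂ b₂ a₃ m₃ e₃ + W)))) =
      tripleSum (crossWeight o true) (crossWeight o false) (crossWeight (-o) true)
        (crossWeight (-o) false) (crossWeight (-o) true) (crossWeight (-o) false)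
        (fun c₁ c₂ c₃ => F (crossWord c₁ m₁ b₁ m₂ b₂ e₁ + (crossWord c₂ a₁ m₁ a₃ m₃ e₂ +
        (crossWord c₃ a₂ m₂ m₃ b₃ e₃ + W)))) := by
    intro a₁ m₁ b₁ a₂ m₂ b₂ a₃ m₃ b₃ e₁ e₂ e₃ h h'
    -- Strands 1 and 2 change places, and the crossings are read in the order 1, 3, 2.
    have hw : ∀ c₁ c₂ c₃, crossWord c₁ a₁ m₁ a₂ m₂ e₁ + (crossWord c₂ m₁ b₁ m₃ b₃ e₂ +
        (crossWord c₃ m₂ b₂ a₃ m₃ e₃ + W)) = crossWord c₁ a₂ m₂ a₁ m₁ e₁ +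
        (crossWord c₃ m₂ b₂ a₃ m₃ e₃ + (crossWord c₂ m₁ b₁ m₃ b₃ e₂ + W)) := fun c₁ c₂ c₃ => by
      rw [crossWord_comm c₁]
      ac_rfl
    have hw' : ∀ c₁ c₂ c₃, crossWord c₁ m₁ b₁ m₂ b₂ e₁ + (crossWord c₂ a₁ m₁ a₃ m₃ e₂ +
        (crossWord c₃ a₂ m₂ m₃ b₃ e₃ + W)) = crossWord c₁ m₂ b₂ m₁ b₁ e₁ +
        (crossWord c₃ a₂ m₂ m₃ b₃ e₃ + (crossWord c₂ a₁ m₁ a₃ m₃ e₂ + W)) := fun c₁ c₂ c₃ => by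
      rw [crossWord_comm c₁]
      ac_rfl
    simp only [hw, hw'] at h h' ⊢
    have k := S.braid_move (braid_weight_two o) (fun c₁ c₂ c₃ => h c₁ c₃ c₂)
      fun c₁ c₂ c₃ => h' c₁ c₃ c₂
    simp only [tripleSum] at k ⊢
    linear_combination k
  have npp : ∀ {a₁ m₁ b₁ a₂ m₂ b₂ a₃ m₃ b₃ e₁ e₂ e₃ : ℕ},
      (∀ c₁ c₂ c₃, Below ⊤ (crossWord c₁ m₁ b₁ a₂ m₂ e₁ + (crossWord c₂ a₁ m₁ a₃ m₃ e₂ +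
        (crossWord c₃ m₂ b₂ m₃ b₃ e₃ + W)))) →
      (∀ c₁ c₂ c₃, Below ⊤ (crossWord c₁ a₁ m₁ m₂ b₂ e₁ + (crossWord c₂ m₁ b₁ m₃ b₃ e₂ +
        (crossWord c₃ a₂ m₂ a₃ m₃ e₃ + W)))) →
      tripleSum (crossWeight (-o) true) (crossWeight (-o) false) (crossWeight (-o) true)
        (crossWeight (-o) false) (crossWeight o true) (crossWeight o false)
        (fun c₁ c₂ c₃ => F (crossWord c₁ m₁ b₁ a₂ m₂ e₁ + (crossWord c₂ a₁ m₁ a₃ m₃ e₂ +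
        (crossWord c₃ m₂ b₂ m₃ b₃ e₃ + W)))) =
      tripleSum (crossWeight (-o) true) (crossWeight (-o) false) (crossWeight (-o) true)
        (crossWeight (-o) false) (crossWeight o true) (crossWeight o false)
        (fun c₁ c₂ c₃ => F (crossWord c₁ a₁ m₁ m₂ b₂ e₁ + (crossWord c₂ m₁ b₁ m₃ b₃ e₂ +
        (crossWord c₃ a₂ m₂ a₃ m₃ e₃ + W)))) := by
    intro a₁ m₁ b₁ a₂ m₂ b₂ a₃ m₃ b₃ e₁ e₂ e₃ h h'
    -- Strands 2 and 3 change places, and the crossings are read in the order 2, 1, 3.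
    have hw : ∀ c₁ c₂ c₃, crossWord c₁ m₁ b₁ a₂ m₂ e₁ + (crossWord c₂ a₁ m₁ a₃ m₃ e₂ +
        (crossWord c₃ m₂ b₂ m₃ b₃ e₃ + W)) = crossWord c₂ a₁ m₁ a₃ m₃ e₂ +
        (crossWord c₁ m₁ b₁ a₂ m₂ e₁ + (crossWord c₃ m₃ b₃ m₂ b₂ e₃ + W)) := fun c₁ c₂ c₃ => by
      rw [crossWord_comm c₃]
      ac_rfl
    have hw' : ∀ c₁ c₂ c₃, crossWord c₁ a₁ m₁ m₂ b₂ e₁ + (crossWord c₂ m₁ b₁ m₃ b₃ e₂ +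
        (crossWord c₃ a₂ m₂ a₃ m₃ e₃ + W)) = crossWord c₂ m₁ b₁ m₃ b₃ e₂ +
        (crossWord c₁ a₁ m₁ m₂ b₂ e₁ + (crossWord c₃ a₃ m₃ a₂ m₂ e₃ + W)) := fun c₁ c₂ c₃ => by
      rw [crossWord_comm c₃]
      ac_rfl
    simp only [hw, hw'] at h h' ⊢
    have k := S.braid_move (braid_weight_three o) (fun c₁ c₂ c₃ => h c₂ c₁ c₃)
      fun c₁ c₂ c₃ => h' c₂ c₁ c₃
    simp only [tripleSum] at k ⊢
    linear_combination k
  have pnp : ∀ {a₁ m₁ b₁ a₂ m₂ b₂ a₃ m₃ b₃ e₁ e₂ e₃ : ℕ},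
      (∀ c₁ c₂ c₃, Below ⊤ (crossWord c₁ a₁ m₁ m₂ b₂ e₁ + (crossWord c₂ m₁ b₁ a₃ m₃ e₂ +
        (crossWord c₃ a₂ m₂ m₃ b₃ e₃ + W)))) →
      (∀ c₁ c₂ c₃, Below ⊤ (crossWord c₁ m₁ b₁ a₂ m₂ e₁ + (crossWord c₂ a₁ m₁ m₃ b₃ e₂ +
        (crossWord c₃ m₂ b₂ a₃ m₃ e₃ + W)))) →
      tripleSum (crossWeight (-o) true) (crossWeight (-o) false) (crossWeight o true)
        (crossWeight o false) (crossWeight (-o) true) (crossWeight (-o) false)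
        (fun c₁ c₂ c₃ => F (crossWord c₁ a₁ m₁ m₂ b₂ e₁ + (crossWord c₂ m₁ b₁ a₃ m₃ e₂ +
        (crossWord c₃ a₂ m₂ m₃ b₃ e₃ + W)))) =
      tripleSum (crossWeight (-o) true) (crossWeight (-o) false) (crossWeight o true)
        (crossWeight o false) (crossWeight (-o) true) (crossWeight (-o) false)
        (fun c₁ c₂ c₃ => F (crossWord c₁ m₁ b₁ a₂ m₂ e₁ + (crossWord c₂ a₁ m₁ m₃ b₃ e₂ +
        (crossWord c₃ m₂ b₂ a₃ m₃ e₃ + W)))) := fun h h' =>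
    S.cyclic_move (cyclic_weight o) h h'
  -- Changing all of `t`, `m`, `b` leaves the signs of the crossings and exchanges the two sides of
  -- the move, so four patterns settle all eight.
  rcases ht with ⟨rfl, rfl⟩ | ⟨rfl, rfl⟩ <;> rcases hm with ⟨rfl, rfl⟩ | ⟨rfl, rfl⟩ <;>
    rcases hb with ⟨rfl, rfl⟩ | ⟨rfl, rfl⟩ <;> simp only [mul_one, mul_neg, neg_neg]
  · exact ppp h h'
  · exact ppn h h'
  · exact pnp h h'
  · exact (npp h' h).symm
  · exact npp h h'
  · exact (pnp h' h).symm
  · exact (ppn h' h).symm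
  · exact (ppp h' h).symm

/-! ### State graphs as words -/

namespace GaussDiagram

variable (K : GaussDiagram) (a : K.P → ℕ) (e : K.X → ℕ) (s : K.X → Bool)

theorem exit_eq_pt_iff {q : K.P} {x : K.X} {b : Bool} : K.exit s q = K.pt (x, b) ↔
    ∃ c, q = K.pt (x, c) ∧ (if s x then !c else true) = b := by
  constructor
  · intro h
    by_cases hq : q ∈ Set.range K.pt
    · obtain ⟨⟨y, c⟩, rfl⟩ := hq
      rw [exit_pt, K.pt_inj.eq_iff, Prod.mk.injEq] at h
      obtain ⟨rfl, h⟩ := h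
      exact ⟨c, rfl, h⟩
    · rw [K.exit_mark s hq] at h
      exact absurd ⟨_, h.symm⟩ hq
  · rintro ⟨c, rfl, rfl⟩
    exact K.exit_pt s x c

theorem entry_eq_pt_iff {q : K.P} {x : K.X} {b : Bool} : K.entry s q = K.pt (x, b) ↔
    ∃ c, q = K.pt (x, c) ∧ (if s x then c else false) = b := by
  constructor
  · intro h
    by_cases hq : q ∈ Set.range K.pt
    · obtain ⟨⟨y, c⟩, rfl⟩ := hq
      rw [entry_pt, K.pt_inj.eq_iff, Prod.mk.injEq] at h
      obtain ⟨rfl, h⟩ := h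
      exact ⟨c, rfl, h⟩
    · rw [K.entry_mark s hq] at h
      exact absurd ⟨_, h.symm⟩ hq
  · rintro ⟨c, rfl, rfl⟩
    exact K.entry_pt s x c

theorem exit_eq_mark_iff {p q : K.P} (hp : K.IsMark p) : K.exit s q = p ↔ q = p := by
  constructor
  · intro h
    by_cases hq : q ∈ Set.range K.pt
    · obtain ⟨⟨y, c⟩, rfl⟩ := hq
      rw [exit_pt] at h
      exact absurd ⟨_, h⟩ hp
    · rwa [K.exit_mark s hq] at h
  · rintro rfl
    exact K.exit_mark s hp

theorem entry_eq_mark_iff {p q : K.P} (hp : K.IsMark p) : K.entry s q = p ↔ q = p := by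
  constructor
  · intro h
    by_cases hq : q ∈ Set.range K.pt
    · obtain ⟨⟨y, c⟩, rfl⟩ := hq
      rw [entry_pt] at h
      exact absurd ⟨_, h⟩ hp
    · rwa [K.entry_mark s hq] at h
  · rintro rfl
    exact K.entry_mark s hp

/-! ### The word of a state graph -/

/-- The label of the arc that arrives at the point `p`. -/
def inLabel (p : K.P) : ℕ := a (K.next.symm p)

/-- The points that are not passes of crossings. -/
noncomputable def marks : Finset K.P := (Set.toFinite {p | K.IsMark p}).toFinset

@[simp]
theorem mem_marks {p : K.P} : p ∈ K.marks ↔ K.IsMark p := by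
  simp [marks]

/-- The local word of the crossing `x` in the local state `c`. -/
def crossAt (c : Bool) (x : K.X) : Multiset Atom :=
  crossWord c (K.inLabel a (K.pt (x, true))) (a (K.pt (x, true)))
    (K.inLabel a (K.pt (x, false))) (a (K.pt (x, false))) (e x)

/-- The word of the subdivision points. -/
noncomputable def markWord : Multiset Atom := ∑ p ∈ K.marks, {strand (K.inLabel a p) (a p)}

/-- The word of the graph of the state `s`. -/
noncomputable def stateWord : Multiset Atom := ∑ x, K.crossAt a e (s x) x + K.markWord a

theorem sum_points [Fintype K.P] {M : Type*} [AddCommMonoid M] (g : K.P → M) :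
    ∑ p, g p = ∑ x, (g (K.pt (x, true)) + g (K.pt (x, false))) + ∑ p ∈ K.marks, g p := by
  classical
  have h1 : ∑ x, (g (K.pt (x, true)) + g (K.pt (x, false))) =
      ∑ p with p ∈ Set.range K.pt, g p := by
    rw [show Finset.univ.filter (fun p => p ∈ Set.range K.pt) = Finset.univ.image K.pt by
      ext p; simp, Finset.sum_image K.pt_inj.injOn, Fintype.sum_prod_type]
    simp
  have h2 : K.marks = Finset.univ.filter fun p => p ∉ Set.range K.pt := by
    ext p
    simp [IsMark]
  rw [h1, h2, Finset.sum_filter_add_sum_filter_not]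

/-- The labels of the edges of a state graph. -/
def stateLabel : (K.stateGraph s).E → ℕ := Sum.elim a fun x => e x.1

variable {K a e}

theorem stateLabel_injective (h : Function.Injective (Sum.elim a e)) :
    Function.Injective (K.stateLabel a e s) := by
  have : Function.Injective
      (Sum.map id Subtype.val : K.P ⊕ {x : K.X // s x = false} → K.P ⊕ K.X) :=
    Function.Injective.sumMap Function.injective_id Subtype.val_injective
  rintro (x | x) (y | y) hxy <;> exact this (h hxy)

theorem exists_stateGraph_tgt_iff {v : K.P} {n : ℕ} :
    (∃ x, (K.stateGraph s).tgt x = v ∧ K.stateLabel a e s x = n) ↔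
      (∃ p, K.entry s p = v ∧ K.inLabel a p = n) ∨
        ∃ x, s x = false ∧ K.pt (x, false) = v ∧ e x = n := by
  constructor
  · rintro ⟨p | ⟨x, hx⟩, h1, h2⟩
    · exact Or.inl ⟨K.next p, h1, (congrArg a (K.next.symm_apply_apply p)).trans h2⟩
    · exact Or.inr ⟨x, hx, h1, h2⟩
  · rintro (⟨p, h1, h2⟩ | ⟨x, hx, h1, h2⟩)
    · exact ⟨Sum.inl (K.next.symm p), by simpa [stateGraph] using h1, h2⟩
    · exact ⟨Sum.inr ⟨x, hx⟩, h1, h2⟩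

theorem exists_stateGraph_src_iff {v : K.P} {n : ℕ} :
    (∃ x, (K.stateGraph s).src x = v ∧ K.stateLabel a e s x = n) ↔
      (∃ p, K.exit s p = v ∧ a p = n) ∨ ∃ x, s x = false ∧ K.pt (x, true) = v ∧ e x = n := by
  constructor
  · rintro ⟨p | ⟨x, hx⟩, h1, h2⟩
    · exact Or.inl ⟨p, h1, h2⟩
    · exact Or.inr ⟨x, hx, h1, h2⟩
  · rintro (⟨p, h1, h2⟩ | ⟨x, hx, h1, h2⟩)
    · exact ⟨Sum.inl p, h1, h2⟩
    · exact ⟨Sum.inr ⟨x, hx⟩, h1, h2⟩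

section

variable (h : Function.Injective (Sum.elim a e))
include h

theorem vertexAtom_mark {p : K.P} (hp : K.IsMark p) :
    (K.stateGraph s).vertexAtom (K.stateLabel a e s) p = strand (K.inLabel a p) (a p) := by
  have hp' : ∀ y, K.pt y ≠ p := fun y hy => hp ⟨y, hy⟩
  refine Atom.ext (labels_setOf_eq (stateLabel_injective s h) (by simp [strand]) fun n => ?_)
    (labels_setOf_eq (stateLabel_injective s h) (by simp [strand]) fun n => ?_)
  · rw [exists_stateGraph_tgt_iff]
    simp only [K.entry_eq_mark_iff s hp, hp', strand, Multiset.mem_singleton]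
    simp [eq_comm (a := n)]
  · rw [exists_stateGraph_src_iff]
    simp only [K.exit_eq_mark_iff s hp, hp', strand, Multiset.mem_singleton]
    simp [eq_comm (a := n)]

/-- In the unoriented state the overpass point is the source and the underpass point the sink. In
the oriented one each point keeps its incoming arc and receives the outgoing arc of the other
strand. -/
theorem vertexAtom_pt_add (x : K.X) :
    ({(K.stateGraph s).vertexAtom (K.stateLabel a e s) (K.pt (x, true))} +
      {(K.stateGraph s).vertexAtom (K.stateLabel a e s) (K.pt (x, false))} : Multiset Atom) =
      K.crossAt a e (s x) x := by
  have hs := stateLabel_injective (K := K) s h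
  have ha : Function.Injective a := h.comp Sum.inl_injective
  have hi : Function.Injective (K.inLabel a) := ha.comp K.next.symm.injective
  have hae : ∀ p y, a p ≠ e y := fun p y hpy => by
    have := @h (Sum.inl p) (Sum.inr y) hpy
    cases this
  have hpt : ∀ b c, K.pt (x, b) = K.pt (x, c) ↔ b = c := fun b c => by
    simp [K.pt_inj.eq_iff]
  have key : ∀ b I O, I.Nodup → O.Nodup →
      (∀ n, (∃ p, K.entry s p = K.pt (x, b) ∧ K.inLabel a p = n) ∨
        (∃ y, s y = false ∧ K.pt (y, false) = K.pt (x, b) ∧ e y = n) ↔ n ∈ I) →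
      (∀ n, (∃ p, K.exit s p = K.pt (x, b) ∧ a p = n) ∨
        (∃ y, s y = false ∧ K.pt (y, true) = K.pt (x, b) ∧ e y = n) ↔ n ∈ O) →
      (K.stateGraph s).vertexAtom (K.stateLabel a e s) (K.pt (x, b)) = ⟨I, O⟩ :=
    fun b I O hI hO h1 h2 => Atom.ext
      (labels_setOf_eq hs hI fun n => (exists_stateGraph_tgt_iff s).trans (h1 n))
      (labels_setOf_eq hs hO fun n => (exists_stateGraph_src_iff s).trans (h2 n))
  rcases hx : s x with _ | _
  · rw [crossAt, crossWord_false, key true 0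
      {a (K.pt (x, true)), a (K.pt (x, false)), e x} (by simp) (by simp [hae, ha.eq_iff, hpt])
      (fun n => ?_) (fun n => ?_), key false
      {K.inLabel a (K.pt (x, true)), K.inLabel a (K.pt (x, false)), e x} 0
      (by simp [hi.eq_iff, hpt]; simp [inLabel, hae]) (by simp)
      (fun n => ?_) (fun n => ?_)]
    · rfl
    all_goals simp [entry_eq_pt_iff, exit_eq_pt_iff, hx, K.pt_inj.eq_iff]
    all_goals grind
  · rw [crossAt, crossWord_true, key true {K.inLabel a (K.pt (x, true))}
      {a (K.pt (x, false))} (by simp) (by simp) (fun n => ?_) (fun n => ?_),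
      key false {K.inLabel a (K.pt (x, false))} {a (K.pt (x, true))} (by simp) (by simp)
      (fun n => ?_) (fun n => ?_)]
    · rfl
    all_goals simp [entry_eq_pt_iff, exit_eq_pt_iff, hx, K.pt_inj.eq_iff]
    all_goals grind

theorem word_stateGraph : (K.stateGraph s).word (K.stateLabel a e s) = K.stateWord a e s := by
  have := Fintype.ofFinite K.P
  let _ : Fintype (K.stateGraph s).V := inferInstanceAs (Fintype K.P)
  rw [word_eq_sum]
  refine (K.sum_points fun p =>
    {(K.stateGraph s).vertexAtom (K.stateLabel a e s) p}).trans ?_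
  exact congrArg₂ (· + ·) (Finset.sum_congr rfl fun x _ => vertexAtom_pt_add s h x)
    (Finset.sum_congr rfl fun p hp => by rw [vertexAtom_mark s h (K.mem_marks.1 hp)])

theorem below_stateWord : Below ⊤ (K.stateWord a e s) :=
  ⟨word_stateGraph s h ▸ valid_word (stateLabel_injective s h), by simp⟩

-- One labelling of the arcs and of the possible new edges serves for all states, so the states
-- differ only in the local words of their crossings.
open Classical in
theorem bracket_eq (f : TriGraph → GraphPoly) : K.bracket f =
    ∑ s : K.X → Bool, (∏ x, crossWeight (K.sign x) (s x)) * wordValue f (K.stateWord a e s) := by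
  unfold bracket
  refine Fintype.sum_equiv (Equiv.refl _) _ _ fun s => ?_
  rw [Equiv.refl_apply, ← word_stateGraph s h, wordValue_word f (stateLabel_injective s h)]
  rfl

end

/-! ### Isomorphisms and subdivisions -/

/-- The isomorphism of state graphs that is induced by an isomorphism of Gauss diagrams. -/
def Iso.stateGraph {L : GaussDiagram} (φ : Iso K L) (s : L.X → Bool) :
    Web.Iso (K.stateGraph (s ∘ φ.onX)) (L.stateGraph s) where
  onV := φ.onP
  onE := Equiv.sumCongr φ.onP (φ.onX.subtypeEquiv fun _ => Iff.rfl)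
  src_comm := by
    rintro (p | x)
    · change L.exit s (φ.onP p) = φ.onP (K.exit (s ∘ φ.onX) p)
      by_cases hp : p ∈ Set.range K.pt
      · obtain ⟨⟨x, b⟩, rfl⟩ := hp
        rw [exit_pt, ← φ.pt_comm, exit_pt, ← φ.pt_comm]
        rfl
      · rw [K.exit_mark _ hp, L.exit_mark]
        rintro ⟨⟨x, b⟩, hx⟩
        refine hp ⟨(φ.onX.symm x, b), φ.onP.injective ?_⟩
        rw [← φ.pt_comm, Equiv.apply_symm_apply, hx]
    · exact φ.pt_comm x.1 true
  tgt_comm := by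
    rintro (p | x)
    · change L.entry s (L.next (φ.onP p)) = φ.onP (K.entry (s ∘ φ.onX) (K.next p))
      rw [φ.next_comm]
      generalize K.next p = p
      by_cases hp : p ∈ Set.range K.pt
      · obtain ⟨⟨x, b⟩, rfl⟩ := hp
        rw [entry_pt, ← φ.pt_comm, entry_pt, ← φ.pt_comm]
        rfl
      · rw [K.entry_mark _ hp, L.entry_mark]
        rintro ⟨⟨x, b⟩, hx⟩
        refine hp ⟨(φ.onX.symm x, b), φ.onP.injective ?_⟩
        rw [← φ.pt_comm, Equiv.apply_symm_apply, hx]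
    · exact φ.pt_comm x.1 false

theorem Iso.normBracket_eq {L : GaussDiagram} (φ : Iso K L) (f : TriGraph → GraphPoly) :
    K.normBracket f = L.normBracket f := by
  classical
  have hw : K.writhe = L.writhe :=
    Fintype.sum_equiv φ.onX _ _ fun x => by rw [φ.sign_comm]
  rw [normBracket, normBracket, hw, bracket, bracket]
  congr 1
  refine (Fintype.sum_equiv (φ.onX.arrowCongr (Equiv.refl _)).symm _ _ fun s => ?_).symm
  congr 1
  · refine (Fintype.prod_equiv φ.onX _ _ fun x => ?_).symm
    rw [φ.sign_comm]
    rfl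
  · exact congrArg f (Quot.sound (.iso (φ.stateGraph s))).symm

theorem isMark_none (p : K.P) : (K.subdivide p).IsMark none := by
  rintro ⟨y, hy⟩
  cases hy

theorem next_subdivide_none (p : K.P) : (K.subdivide p).next none = some (K.next p) := by
  classical
  change Equiv.optionCongr K.next (Equiv.swap none (some p) none) = _
  rw [Equiv.swap_apply_left]
  rfl

theorem next_subdivide_self (p : K.P) : (K.subdivide p).next (some p) = none := by
  classical
  change Equiv.optionCongr K.next (Equiv.swap none (some p) (some p)) = _
  rw [Equiv.swap_apply_right]
  rfl

theorem next_subdivide_of_ne {p q : K.P} (hq : q ≠ p) :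
    (K.subdivide p).next (some q) = some (K.next q) := by
  classical
  change Equiv.optionCongr K.next (Equiv.swap none (some p) (some q)) = _
  rw [Equiv.swap_apply_of_ne_of_ne (by simp) (by simpa using hq)]
  rfl

theorem exit_subdivide (p q : K.P) :
    (K.subdivide p).exit s (some q) = some (K.exit s q) := by
  by_cases hq : q ∈ Set.range K.pt
  · obtain ⟨⟨x, b⟩, rfl⟩ := hq
    rw [exit_pt]
    exact (K.subdivide p).exit_pt s x b
  · rw [K.exit_mark s hq]
    exact (K.subdivide p).exit_mark s fun ⟨y, hy⟩ => hq ⟨y, Option.some_injective _ hy⟩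

theorem entry_subdivide (p q : K.P) :
    (K.subdivide p).entry s (some q) = some (K.entry s q) := by
  by_cases hq : q ∈ Set.range K.pt
  · obtain ⟨⟨x, b⟩, rfl⟩ := hq
    rw [entry_pt]
    exact (K.subdivide p).entry_pt s x b
  · rw [K.entry_mark s hq]
    exact (K.subdivide p).entry_mark s fun ⟨y, hy⟩ => hq ⟨y, Option.some_injective _ hy⟩

/-- A subdivision point on an arc of a diagram is a subdivision point on an edge of the
state graphs. -/
noncomputable def subdivideStateGraph (p : K.P) :
    Web.Iso ((K.subdivide p).stateGraph s) ((K.stateGraph s).subdivide (Sum.inl p)) where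
  onV := Equiv.refl _
  onE :=
    { toFun := Sum.elim (fun q : Option K.P => q.map Sum.inl) fun x => some (Sum.inr x)
      invFun := fun q => q.elim (Sum.inl none) (Sum.elim (fun q => Sum.inl (some q)) Sum.inr)
      left_inv := by rintro ((_ | q) | x) <;> rfl
      right_inv := by rintro (_ | q | x) <;> rfl }
  src_comm := by
    rintro ((_ | q) | x)
    · exact ((K.subdivide p).exit_mark s (isMark_none p)).symm
    · exact (exit_subdivide s p q).symm
    · rfl
  tgt_comm := by
    rintro ((_ | q) | x)
    · refine (entry_subdivide s p (K.next p)).symm.trans ?_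
      exact congrArg ((K.subdivide p).entry s) (next_subdivide_none p).symm
    · by_cases hq : q = p
      · subst hq
        refine (if_pos rfl).trans ?_
        change none = (K.subdivide q).entry s ((K.subdivide q).next (some q))
        rw [next_subdivide_self]
        exact ((K.subdivide q).entry_mark s (isMark_none q)).symm
      · refine (if_neg fun h => hq (Sum.inl_injective h)).trans ?_
        change some (K.entry s (K.next q)) =
          (K.subdivide p).entry s ((K.subdivide p).next (some q))
        rw [next_subdivide_of_ne hq, entry_subdivide]
    · exact if_neg (by simp)

theorem normBracket_subdivide (p : K.P) (f : TriGraph → GraphPoly) :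
    (K.subdivide p).normBracket f = K.normBracket f := by
  have hw : (K.subdivide p).writhe = K.writhe := rfl
  rw [normBracket, normBracket, hw, bracket, bracket]
  congr 1
  refine Finset.sum_congr rfl fun s _ => ?_
  congr 1
  exact congrArg f ((Quot.sound (.iso (subdivideStateGraph (K := K) s p))).trans
    (toGraph_subdivide (K.stateGraph s) (Sum.inl p)))

end GaussDiagram

/-! ### The first and the second Reidemeister move -/

/-- A state of a diagram with a new crossing is a state of the old diagram together with a local
state `c`. -/
theorem sum_option_bool {X M : Type*} [AddCommMonoid M] {i : Fintype (Option X → Bool)}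
    {j : Fintype (X → Bool)} (g : (Option X → Bool) → M) :
    ∑ s, g s = ∑ s : X → Bool, ∑ c, g fun x => x.elim c s := by
  rw [← Fintype.sum_prod_type']
  refine Fintype.sum_equiv ⟨fun s => (s ∘ some, s none), fun p x => x.elim p.2 p.1,
    fun s => ?_, fun p => rfl⟩ _ _ fun s => ?_
  · funext x
    rcases x with _ | x <;> rfl
  · congr 1
    funext x
    rcases x with _ | x <;> rfl

namespace GaussDiagram

section

variable {K : GaussDiagram} {a : K.P → ℕ} {f : TriGraph → GraphPoly} {o u : K.P} (ho : K.IsMark o)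
  (hu : K.IsMark u) (hne : o ≠ u) (ε : ℤˣ)

theorem isMark_addCrossing_iff {p : K.P} :
    (K.addCrossing o u ho hu hne ε).IsMark p ↔ K.IsMark p ∧ p ≠ o ∧ p ≠ u := by
  refine ⟨fun h => ⟨fun ⟨y, hy⟩ => h ⟨(some y.1, y.2), hy⟩, ?_, ?_⟩,
    fun h => K.isMark_addCrossing h.1 h.2.1 h.2.2⟩
  · rintro rfl
    exact h ⟨(none, true), rfl⟩
  · rintro rfl
    exact h ⟨(none, false), rfl⟩

/-- Before the move the two points contribute a strand each. As a new crossing changes neither `P`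
nor `next`, the same labels `a` are used before and after it. -/
theorem markWord_addCrossing : K.markWord a = {strand (K.inLabel a o) (a o),
    strand (K.inLabel a u) (a u)} + (K.addCrossing o u ho hu hne ε).markWord a := by
  classical
  let m : Finset K.P := (K.addCrossing o u ho hu hne ε).marks
  have hm : ∀ p, p ∈ m ↔ K.IsMark p ∧ p ≠ o ∧ p ≠ u := fun p =>
    (mem_marks _).trans (isMark_addCrossing_iff ho hu hne ε)
  have h : K.marks = insert o (insert u m) := by
    ext p
    simp only [Finset.mem_insert, mem_marks, hm]
    grind
  rw [markWord, h, Finset.sum_insert (by simp [hne, hm]), Finset.sum_insert (by simp [hm]),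
    ← add_assoc]
  rfl

theorem stateWord_addCrossing (e : Option K.X → ℕ) (c : Bool) (s : K.X → Bool) :
    (K.addCrossing o u ho hu hne ε).stateWord a e (fun x : Option K.X => x.elim c s) =
      crossWord c (K.inLabel a o) (a o) (K.inLabel a u) (a u) (e none) +
      (∑ x, K.crossAt a (e ∘ some) (s x) x + (K.addCrossing o u ho hu hne ε).markWord a) := by
  rw [← add_assoc]
  refine congrArg (· + _) ?_
  exact Fintype.sum_option _

theorem prod_crossWeight_addCrossing (c : Bool) (s : K.X → Bool) :
    ∏ x, crossWeight ((K.addCrossing o u ho hu hne ε).sign x)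
      ((fun x : Option K.X => x.elim c s : (K.addCrossing o u ho hu hne ε).X → Bool) x) =
      crossWeight ε c * ∏ x, crossWeight (K.sign x) (s x) :=
  Fintype.prod_option _

theorem writhe_addCrossing : (K.addCrossing o u ho hu hne ε).writhe = ε + K.writhe :=
  Fintype.sum_option _

theorem exists_injective_sumElim (P X : Type) [Finite P] [Finite X] :
    ∃ (a : P → ℕ) (e : X → ℕ), Function.Injective (Sum.elim a e) := by
  obtain ⟨ℓ, hℓ⟩ := exists_injective_label (P ⊕ X)
  exact ⟨ℓ ∘ Sum.inl, ℓ ∘ Sum.inr, by rwa [Sum.elim_comp_inl_inr]⟩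

theorem injective_sumElim_some {P X : Type} {a : P → ℕ} {e : Option X → ℕ}
    (h : Function.Injective (Sum.elim a e)) : Function.Injective (Sum.elim a (e ∘ some)) := by
  have := h.comp (Function.Injective.sumMap Function.injective_id (Option.some_injective X))
  rintro (x | x) (y | y) hxy <;> exact this hxy

/-- For each state of the other crossings, `kink` produces the factor A^(8ε), and the writhe grows
by ε. -/
theorem normBracket_addCrossing_adjacent (hf : IsKuperberg f)
    (h : K.next o = u ∨ K.next u = o) :
    K.normBracket f = (K.addCrossing o u ho hu hne ε).normBracket f := by
  classical
  let L := K.addCrossing o u ho hu hne ε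
  obtain ⟨a, e, hae⟩ := exists_injective_sumElim K.P (Option K.X)
  have hae' := injective_sumElim_some hae
  have hb : L.bracket f = powA (8 * ε) * K.bracket f := by
    rw [bracket_eq (K := L) (e := e) hae f, bracket_eq hae' f, Finset.mul_sum]
    refine (sum_option_bool _).trans (Finset.sum_congr rfl fun s _ => ?_)
    have h0 : K.stateWord a (e ∘ some) s = {strand (K.inLabel a o) (a o),
        strand (K.inLabel a u) (a u)} + (∑ x, K.crossAt a (e ∘ some) (s x) x +
          L.markWord a) := by
      rw [stateWord, markWord_addCrossing ho hu hne ε, add_left_comm]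
    have hB := below_stateWord s hae'
    have hB' : ∀ c, Below ⊤ (L.stateWord a e fun x : Option K.X => x.elim c s) := fun c =>
      below_stateWord (K := L) _ hae
    rw [Fintype.sum_bool, prod_crossWeight_addCrossing, prod_crossWeight_addCrossing]
    rw [h0] at hB ⊢
    simp only [L, stateWord_addCrossing] at hB' ⊢
    change Below ⊤ (_ + (_ + L.markWord a)) at hB
    generalize ∑ x, K.crossAt a (e ∘ some) (s x) x +
      (K.addCrossing o u ho hu hne ε).markWord a = W at *
    rcases h with rfl | rfl
    · have hi : K.inLabel a (K.next o) = a o := by simp [inLabel]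
      rw [hi] at hB hB' ⊢
      have k := hf.skein.kink hB hB'
      rw [k.1, k.2, ← kink_weight]
      ring
    · have hi : K.inLabel a (K.next u) = a u := by simp [inLabel]
      -- The underpass comes first: the symmetry of `crossWord` in its two strands reduces this to
      -- the other order.
      rw [Multiset.pair_comm, hi] at hB ⊢
      simp only [crossWord_comm _ _ _ (K.inLabel a u), hi] at hB' ⊢
      have k := hf.skein.kink hB hB'
      rw [k.1, k.2, ← kink_weight]
      ring
  change _ = L.normBracket f
  rw [normBracket, normBracket, hb, writhe_addCrossing, ← mul_assoc, powA_mul]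
  congr 2
  ring

/-- The signs cancel in the writhe, and for fixed states of the other crossings the four local
states sum up to the bare strands. The two alternatives in `hu_next` are the parallel and the
antiparallel move. -/
theorem normBracket_addCrossing_addCrossing (hf : IsKuperberg f) {o' u' : K.P}
    (ho' : K.IsMark o') (hu' : K.IsMark u') (hne' : o' ≠ u') (h₁ : o' ≠ o) (h₂ : o' ≠ u)
    (h₃ : u' ≠ o) (h₄ : u' ≠ u) (ho_next : K.next o = o')
    (hu_next : K.next u = u' ∨ K.next u' = u) :
    K.normBracket f = ((K.addCrossing o u ho hu hne ε).addCrossing o' u'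
      (K.isMark_addCrossing ho' h₁ h₂) (K.isMark_addCrossing hu' h₃ h₄) hne' (-ε)).normBracket
        f := by
  classical
  let L := K.addCrossing o u ho hu hne ε
  have hoL : L.IsMark o' := K.isMark_addCrossing ho' h₁ h₂
  have huL : L.IsMark u' := K.isMark_addCrossing hu' h₃ h₄
  let M := L.addCrossing o' u' hoL huL hne' (-ε)
  obtain ⟨a, e, hae⟩ := exists_injective_sumElim K.P (Option (Option K.X))
  have hae' := injective_sumElim_some hae
  have hae'' := injective_sumElim_some hae'
  have hb : M.bracket f = K.bracket f := by
    rw [bracket_eq (K := M) (e := e) hae f, bracket_eq hae'' f]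
    refine (sum_option_bool (j := (inferInstance : Fintype (Option K.X → Bool))) _).trans
      ((sum_option_bool _).trans (Finset.sum_congr rfl fun s _ => ?_))
    have h0 : K.stateWord a ((e ∘ some) ∘ some) s = {strand (K.inLabel a o) (a o),
        strand (K.inLabel a o') (a o'), strand (K.inLabel a u) (a u),
        strand (K.inLabel a u') (a u')} +
          (∑ x, K.crossAt a ((e ∘ some) ∘ some) (s x) x + M.markWord a) := by
      have h1 : L.markWord a = {strand (K.inLabel a o') (a o'), strand (K.inLabel a u') (a u')} +
        M.markWord a := markWord_addCrossing hoL huL hne' (-ε)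
      rw [stateWord, markWord_addCrossing ho hu hne ε]
      change _ + (_ + L.markWord a) = _
      rw [h1]
      simp only [Multiset.insert_eq_cons, ← Multiset.singleton_add]
      ac_rfl
    have hB := below_stateWord s hae''
    have hW : ∀ c d, M.stateWord a e (fun x : Option (Option K.X) =>
        x.elim d fun y => y.elim c s) =
        crossWord c (K.inLabel a o) (a o) (K.inLabel a u) (a u) (e (some none)) +
        (crossWord d (K.inLabel a o') (a o') (K.inLabel a u') (a u') (e none) +
          (∑ x, K.crossAt a ((e ∘ some) ∘ some) (s x) x + M.markWord a)) := fun c d => by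
      refine (stateWord_addCrossing hoL huL hne' (-ε) e d _).trans ?_
      have h1 : ∑ x : L.X, L.crossAt a (e ∘ some) ((fun y : Option K.X => y.elim c s) x) x =
          crossWord c (K.inLabel a o) (a o) (K.inLabel a u) (a u) (e (some none)) +
            ∑ x, K.crossAt a ((e ∘ some) ∘ some) (s x) x := Fintype.sum_option _
      change _ + (∑ x : L.X, L.crossAt a (e ∘ some) ((fun y : Option K.X => y.elim c s) x) x +
        M.markWord a) = _
      rw [h1, add_assoc, add_left_comm]
      rfl
    have hB' : ∀ c d, Below ⊤ (M.stateWord a e (fun x : Option (Option K.X) =>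
        x.elim d fun y => y.elim c s)) := fun c d => below_stateWord (K := M) _ hae
    have hc : ∀ c d, ∏ x, crossWeight (M.sign x) ((fun x : Option (Option K.X) =>
        x.elim d fun y => y.elim c s : M.X → Bool) x) =
        crossWeight (-ε) d * (crossWeight ε c * ∏ x, crossWeight (K.sign x) (s x)) := fun c d =>
      (prod_crossWeight_addCrossing hoL huL hne' (-ε) d _).trans
        (congrArg (_ * ·) (prod_crossWeight_addCrossing ho hu hne ε c s))
    rw [Fintype.sum_bool, Fintype.sum_bool, Fintype.sum_bool, hc, hc, hc, hc]
    simp only [hW] at hB' ⊢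
    rw [h0] at hB ⊢
    generalize ∑ x, K.crossAt a ((e ∘ some) ∘ some) (s x) x + M.markWord a = W at *
    generalize ∏ x, crossWeight (K.sign x) (s x) = w
    subst ho_next
    have hi : K.inLabel a (K.next o) = a o := by simp [inLabel]
    rw [hi] at hB hB' ⊢
    rcases hu_next with rfl | rfl
    · have hi' : K.inLabel a (K.next u) = a u := by simp [inLabel]
      rw [hi'] at hB hB' ⊢
      have k := hf.skein.parallel (crossWeight_true_mul_neg ε) (parallel_weight ε) hB hB'
      linear_combination w * k
    · have hi' : K.inLabel a (K.next u') = a u' := by simp [inLabel]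
      rw [Multiset.pair_comm, hi'] at hB ⊢
      rw [hi'] at hB'
      have k := hf.skein.antiparallel (antiparallel_weight ε) (crossWeight_false_mul_neg ε) hB hB'
      linear_combination w * k
  have hw : M.writhe = K.writhe := by
    refine (writhe_addCrossing hoL huL hne' (-ε)).trans ?_
    rw [writhe_addCrossing ho hu hne ε, Units.val_neg]
    ring
  change _ = M.normBracket f
  rw [normBracket, normBracket, hb, hw]

end

end GaussDiagram

/-! ### The third Reidemeister move -/

/-- States that differ only at `x` form pairs; the sum over a pair is booked at its member with
value `false`. -/
theorem sum_eq_sum_ite_update {X M : Type*} [DecidableEq X] [AddCommMonoid M]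
    [Fintype (X → Bool)] (g : (X → Bool) → M) (x : X) :
    ∑ s, g s = ∑ s, if s x = false then
      g (Function.update s x true) + g (Function.update s x false) else 0 := by
  have h : ∑ s, g s = ∑ s with s x = true, g s + ∑ s with s x = false, g s := by
    rw [← Finset.sum_filter_add_sum_filter_not Finset.univ (fun s : X → Bool => s x = true)]
    simp
  rw [← Finset.sum_filter, Finset.sum_add_distrib, h]
  congr 1
  · refine Finset.sum_nbij' (fun s => Function.update s x false)
      (fun s => Function.update s x true) ?_ ?_ ?_ ?_ ?_
    · simp
    · simp
    · intro s hs
      simp only [Finset.mem_filter, Finset.mem_univ, true_and] at hs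
      rw [Function.update_idem, ← hs, Function.update_eq_self]
    · intro s hs
      simp only [Finset.mem_filter, Finset.mem_univ, true_and] at hs
      rw [Function.update_idem, ← hs, Function.update_eq_self]
    · intro s hs
      simp only [Finset.mem_filter, Finset.mem_univ, true_and] at hs
      rw [Function.update_idem, ← hs, Function.update_eq_self]
  · refine Finset.sum_congr rfl fun s hs => ?_
    simp only [Finset.mem_filter, Finset.mem_univ, true_and] at hs
    rw [← hs, Function.update_eq_self]

/-- Pairing the states at three crossings leaves a sum over the states of the others, so it is
enough to compare the eight local states while the rest is fixed. -/
theorem sum_eq_of_update_three {X M : Type*} [DecidableEq X] [AddCommMonoid M]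
    {_ : Fintype (X → Bool)} {g h : (X → Bool) → M} {x y z : X} (hxy : x ≠ y) (hxz : x ≠ z)
    (hyz : y ≠ z)
    (H : ∀ s, ∑ c₁, ∑ c₂, ∑ c₃,
      g (Function.update (Function.update (Function.update s x c₁) y c₂) z c₃) =
      ∑ c₁, ∑ c₂, ∑ c₃,
      h (Function.update (Function.update (Function.update s x c₁) y c₂) z c₃)) :
    ∑ s, g s = ∑ s, h s := by
  have key : ∀ g : (X → Bool) → M, ∑ s, g s = ∑ s, if s x = false ∧ s y = false ∧ s z = false then
      ∑ c₁, ∑ c₂, ∑ c₃,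
      g (Function.update (Function.update (Function.update s x c₁) y c₂) z c₃) else 0 := fun g => by
    rw [sum_eq_sum_ite_update g z, sum_eq_sum_ite_update _ y, sum_eq_sum_ite_update _ x]
    refine Finset.sum_congr rfl fun s _ => ?_
    simp only [Fintype.sum_bool, Function.update_of_ne hxy.symm, Function.update_of_ne hxz.symm,
      Function.update_of_ne hyz.symm]
    by_cases h1 : s x = false <;> by_cases h2 : s y = false <;> by_cases h3 : s z = false <;>
      simp [h1, h2, h3]
  rw [key g, key h]
  exact Finset.sum_congr rfl fun s _ => by rw [H s]

theorem Finset.mul_mul_prod_erase_three {X M : Type*} [DecidableEq X] [CommMonoid M] [Fintype X]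
    {x y z : X} (hxy : x ≠ y) (hxz : x ≠ z) (hyz : y ≠ z) (g : X → M) :
    ∏ w, g w = g x * (g y * (g z * ∏ w ∈ ((Finset.univ.erase x).erase y).erase z, g w)) := by
  rw [Finset.mul_prod_erase _ _ (by simp [hxz.symm, hyz.symm]),
    Finset.mul_prod_erase _ _ (by simp [hxy.symm]), Finset.mul_prod_erase _ _ (by simp)]

theorem Finset.add_add_sum_erase_three {X M : Type*} [DecidableEq X] [AddCommMonoid M] [Fintype X]
    {x y z : X} (hxy : x ≠ y) (hxz : x ≠ z) (hyz : y ≠ z) (g : X → M) :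
    ∑ w, g w = g x + (g y + (g z + ∑ w ∈ ((Finset.univ.erase x).erase y).erase z, g w)) := by
  rw [Finset.add_sum_erase _ _ (by simp [hxz.symm, hyz.symm]),
    Finset.add_sum_erase _ _ (by simp [hxy.symm]), Finset.add_sum_erase _ _ (by simp)]

namespace GaussDiagram

variable {K : GaussDiagram} {a : K.P → ℕ}

theorem Follows.labels {ε : ℤˣ} {p q : K.P} (h : K.Follows ε p q) :
    ε = 1 ∧ a p = K.inLabel a q ∨ ε = -1 ∧ a q = K.inLabel a p := by
  rcases h with ⟨rfl, rfl⟩ | ⟨rfl, rfl⟩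
  · exact Or.inl ⟨rfl, by simp [inLabel]⟩
  · exact Or.inr ⟨rfl, by simp [inLabel]⟩

/-- The exchange leaves the signs alone, and hence the writhe and the weights. With suitable labels
it only redistributes the six label pairs among the three crossings, which is the situation of
`triple_move`. -/
theorem normBracket_exchange {f : TriGraph → GraphPoly} (hf : IsKuperberg f) {x y z : K.X}
    (hxy : x ≠ y) (hxz : x ≠ z) (hyz : y ≠ z) {t m b o : ℤˣ}
    (top : K.Follows t (K.pt (x, true)) (K.pt (y, true)))
    (mid : K.Follows m (K.pt (x, false)) (K.pt (z, true)))
    (bot : K.Follows b (K.pt (y, false)) (K.pt (z, false)))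
    (sign_x : K.sign x = o * t * m) (sign_y : K.sign y = o * t * b)
    (sign_z : K.sign z = o * m * b) :
    K.normBracket f = (K.exchange (K.pt (x, true)) (K.pt (y, true)) (K.pt (x, false))
      (K.pt (z, true)) (K.pt (y, false)) (K.pt (z, false))).normBracket f := by
  classical
  set L := K.exchange (K.pt (x, true)) (K.pt (y, true)) (K.pt (x, false))
      (K.pt (z, true)) (K.pt (y, false)) (K.pt (z, false)) with hL
  let π : Equiv.Perm K.P := Equiv.swap (K.pt (x, true)) (K.pt (y, true)) *
    Equiv.swap (K.pt (x, false)) (K.pt (z, true)) * Equiv.swap (K.pt (y, false)) (K.pt (z, false))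
  have hπ : ∀ {p q : K.P}, π p = q → π.symm q = p := fun h => π.symm_apply_eq.2 h.symm
  obtain ⟨a, e, hae⟩ := exists_injective_sumElim K.P K.X
  -- With these labels, the arriving and the leaving label at a point `p` of the new diagram are
  -- those at the point `π.symm p` of the old one. So nothing changes at the other crossings and at
  -- the marks.
  let a' : K.P → ℕ := a ∘ π.symm
  have hae' : Function.Injective (Sum.elim a' e) := by
    have := hae.comp (Function.Injective.sumMap π.symm.injective Function.injective_id)
    rintro (x | x) (y | y) hxy <;> exact this hxy
  have hin : ∀ p : K.P, L.inLabel a' p = K.inLabel a (π.symm p) := fun p =>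
    congrArg a (π.symm_apply_apply (K.next.symm (π.symm p)))
  have hd : (x ≠ y ∧ y ≠ x) ∧ (x ≠ z ∧ z ≠ x) ∧ y ≠ z ∧ z ≠ y :=
    ⟨⟨hxy, hxy.symm⟩, ⟨hxz, hxz.symm⟩, hyz, hyz.symm⟩
  have hx₁ : π.symm (K.pt (x, true)) = K.pt (y, true) := hπ (by
    simp [π, Equiv.swap_apply_def, K.pt_inj.eq_iff, hd])
  have hx₂ : π.symm (K.pt (x, false)) = K.pt (z, true) := hπ (by
    simp [π, Equiv.swap_apply_def, K.pt_inj.eq_iff, hd])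
  have hy₁ : π.symm (K.pt (y, true)) = K.pt (x, true) := hπ (by
    simp [π, Equiv.swap_apply_def, K.pt_inj.eq_iff, hd])
  have hy₂ : π.symm (K.pt (y, false)) = K.pt (z, false) := hπ (by
    simp [π, Equiv.swap_apply_def, K.pt_inj.eq_iff, hd])
  have hz₁ : π.symm (K.pt (z, true)) = K.pt (x, false) := hπ (by
    simp [π, Equiv.swap_apply_def, K.pt_inj.eq_iff, hd])
  have hz₂ : π.symm (K.pt (z, false)) = K.pt (y, false) := hπ (by
    simp [π, Equiv.swap_apply_def, K.pt_inj.eq_iff, hd])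
  have hw : ∀ w c, w ≠ x → w ≠ y → w ≠ z → π.symm (K.pt (w, c)) = K.pt (w, c) :=
    fun w c h1 h2 h3 => hπ (by simp [π, Equiv.swap_apply_def, K.pt_inj.eq_iff, h1, h2, h3])
  have hm : ∀ p, K.IsMark p → π.symm p = p := fun p hp => hπ (by
    have : ∀ y, p ≠ K.pt y := fun y hy => hp ⟨y, hy.symm⟩
    simp [π, Equiv.swap_apply_def, this])
  let r : Finset K.X := ((Finset.univ.erase x).erase y).erase z
  have hr : ∀ w ∈ r, w ≠ x ∧ w ≠ y ∧ w ≠ z := fun w hw => by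
    simp only [r, Finset.mem_erase] at hw
    tauto
  let u : (K.X → Bool) → Bool → Bool → Bool → K.X → Bool := fun s c₁ c₂ c₃ =>
    Function.update (Function.update (Function.update s x c₁) y c₂) z c₃
  have hux : ∀ s c₁ c₂ c₃, u s c₁ c₂ c₃ x = c₁ := by simp [u, hxy, hxz]
  have huy : ∀ s c₁ c₂ c₃, u s c₁ c₂ c₃ y = c₂ := by simp [u, hyz]
  have huz : ∀ s c₁ c₂ c₃, u s c₁ c₂ c₃ z = c₃ := by simp [u]
  have hur : ∀ s c₁ c₂ c₃, ∀ w ∈ r, u s c₁ c₂ c₃ w = s w := fun s c₁ c₂ c₃ w hw => by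
    simp [u, hr w hw]
  let W : (K.X → Bool) → Multiset Atom := fun s =>
    ∑ w ∈ r, K.crossAt a e (s w) w + K.markWord a
  have hK : ∀ s c₁ c₂ c₃, K.stateWord a e (u s c₁ c₂ c₃) =
      crossWord c₁ (K.inLabel a (K.pt (x, true))) (a (K.pt (x, true)))
        (K.inLabel a (K.pt (x, false))) (a (K.pt (x, false))) (e x) +
      (crossWord c₂ (K.inLabel a (K.pt (y, true))) (a (K.pt (y, true)))
        (K.inLabel a (K.pt (y, false))) (a (K.pt (y, false))) (e y) +
      (crossWord c₃ (K.inLabel a (K.pt (z, true))) (a (K.pt (z, true)))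
        (K.inLabel a (K.pt (z, false))) (a (K.pt (z, false))) (e z) + W s)) := by
    intro s c₁ c₂ c₃
    rw [stateWord, Finset.add_add_sum_erase_three hxy hxz hyz, hux, huy, huz,
      Finset.sum_congr rfl fun w hw => by rw [hur s c₁ c₂ c₃ w hw], add_assoc, add_assoc, add_assoc]
    rfl
  have hL : ∀ s c₁ c₂ c₃, L.stateWord a' e (u s c₁ c₂ c₃) =
      crossWord c₁ (K.inLabel a (K.pt (y, true))) (a (K.pt (y, true)))
        (K.inLabel a (K.pt (z, true))) (a (K.pt (z, true))) (e x) +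
      (crossWord c₂ (K.inLabel a (K.pt (x, true))) (a (K.pt (x, true)))
        (K.inLabel a (K.pt (z, false))) (a (K.pt (z, false))) (e y) +
      (crossWord c₃ (K.inLabel a (K.pt (x, false))) (a (K.pt (x, false)))
        (K.inLabel a (K.pt (y, false))) (a (K.pt (y, false))) (e z) + W s)) := by
    intro s c₁ c₂ c₃
    have h1 : ∀ c (w : K.X), L.crossAt a' e c w =
        crossWord c (K.inLabel a (π.symm (K.pt (w, true)))) (a (π.symm (K.pt (w, true))))
          (K.inLabel a (π.symm (K.pt (w, false)))) (a (π.symm (K.pt (w, false)))) (e w) :=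
      fun c w => congrArg₂ (fun i j => crossWord c i (a (π.symm (K.pt (w, true)))) j
        (a (π.symm (K.pt (w, false)))) (e w)) (hin _) (hin _)
    have h2 : L.markWord a' = K.markWord a := Finset.sum_congr rfl fun p hp => by
      have hp' := hm p (K.mem_marks.1 hp)
      refine (congrArg (fun i => ({strand i (a (π.symm p))} : Multiset Atom)) (hin p)).trans ?_
      rw [hp']
    have h3 : ∑ w, L.crossAt a' e (u s c₁ c₂ c₃ w) w =
        crossWord c₁ (K.inLabel a (K.pt (y, true))) (a (K.pt (y, true)))
          (K.inLabel a (K.pt (z, true))) (a (K.pt (z, true))) (e x) +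
        (crossWord c₂ (K.inLabel a (K.pt (x, true))) (a (K.pt (x, true)))
          (K.inLabel a (K.pt (z, false))) (a (K.pt (z, false))) (e y) +
        (crossWord c₃ (K.inLabel a (K.pt (x, false))) (a (K.pt (x, false)))
          (K.inLabel a (K.pt (y, false))) (a (K.pt (y, false))) (e z) +
        ∑ w ∈ r, K.crossAt a e (s w) w)) := by
      refine (Finset.add_add_sum_erase_three (X := K.X) hxy hxz hyz _).trans
        (congrArg₂ (· + ·) ?_ (congrArg₂ (· + ·) ?_ (congrArg₂ (· + ·) ?_
          (Finset.sum_congr rfl fun w hw' => ?_))))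
      · refine (h1 _ x).trans ?_
        rw [hux, hx₁, hx₂]
      · refine (h1 _ y).trans ?_
        rw [huy, hy₁, hy₂]
      · refine (h1 _ z).trans ?_
        rw [huz, hz₁, hz₂]
      · obtain ⟨h4, h5, h6⟩ := hr w hw'
        refine (h1 _ w).trans ?_
        rw [hur s c₁ c₂ c₃ w hw', hw w _ h4 h5 h6, hw w _ h4 h5 h6]
        rfl
    refine (congrArg₂ (· + ·) h3 h2).trans ?_
    rw [add_assoc, add_assoc, add_assoc]
  have hc : ∀ s c₁ c₂ c₃, ∏ w, crossWeight (K.sign w) (u s c₁ c₂ c₃ w) =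
      crossWeight (o * t * m) c₁ * (crossWeight (o * t * b) c₂ * (crossWeight (o * m * b) c₃ *
        ∏ w ∈ r, crossWeight (K.sign w) (s w))) := by
    intro s c₁ c₂ c₃
    rw [Finset.mul_mul_prod_erase_three hxy hxz hyz, hux, huy, huz, sign_x, sign_y, sign_z,
      Finset.prod_congr rfl fun w hw => by rw [hur s c₁ c₂ c₃ w hw]]
  have hb : K.bracket f = L.bracket f := by
    rw [bracket_eq hae f, bracket_eq (K := L) hae' f]
    refine sum_eq_of_update_three (X := K.X) hxy hxz hyz fun s => ?_
    have hB := fun c₁ c₂ c₃ => below_stateWord (u s c₁ c₂ c₃) hae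
    have hB' := fun c₁ c₂ c₃ => below_stateWord (K := L) (u s c₁ c₂ c₃) hae'
    simp only [hK] at hB
    simp only [hL] at hB'
    change ∑ c₁, ∑ c₂, ∑ c₃, (∏ w, crossWeight (K.sign w) (u s c₁ c₂ c₃ w)) *
        wordValue f (K.stateWord a e (u s c₁ c₂ c₃)) =
      ∑ c₁, ∑ c₂, ∑ c₃, (∏ w, crossWeight (K.sign w) (u s c₁ c₂ c₃ w)) *
        wordValue f (L.stateWord a' e (u s c₁ c₂ c₃))
    simp only [hK, hL, hc, Fintype.sum_bool]
    -- Consecutive points share an arc; `Follows.labels` expresses this by the equality of a leaving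
    -- and an arriving label.
    have k := hf.skein.triple_move (o := o) top.labels mid.labels bot.labels hB hB'
    simp only [tripleSum] at k
    linear_combination (∏ w ∈ r, crossWeight (K.sign w) (s w)) * k
  rw [normBracket, normBracket, hb]
  rfl

/-- The normalized bracket is invariant under the Reidemeister moves. -/
theorem Move.normBracket_eq {K L : GaussDiagram} (h : Move K L) {f : TriGraph → GraphPoly}
    (hf : IsKuperberg f) : K.normBracket f = L.normBracket f := by
  cases h with
  | iso φ => exact φ.normBracket_eq f
  | subdivide p => exact (normBracket_subdivide p f).symm
  | reid1 o u ho hu hne ε h => exact normBracket_addCrossing_adjacent ho hu hne ε hf h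
  | reid2 o u o' u' ho hu ho' hu' hne hne' h₁ h₂ h₃ h₄ ε ho_next hu_next =>
    exact normBracket_addCrossing_addCrossing ho hu hne ε hf ho' hu' hne' h₁ h₂ h₃ h₄ ho_next
      hu_next
  | reid3 x y z hxy hxz hyz t m b o top mid bot sign_x sign_y sign_z =>
    exact normBracket_exchange hf hxy hxz hyz top mid bot sign_x sign_y sign_z

theorem VirtuallyIsotopic.normBracket_eq {K L : GaussDiagram} (h : K.VirtuallyIsotopic L)
    {f : TriGraph → GraphPoly} (hf : IsKuperberg f) : K.normBracket f = L.normBracket f := by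
  induction h with
  | rel _ _ h => exact h.normBracket_eq hf
  | refl _ => rfl
  | symm _ _ _ ih => exact ih.symm
  | trans _ _ _ _ _ ih₁ ih₂ => exact ih₁.trans ih₂

end GaussDiagram

theorem mainTheorem1 :
    (∃! f : TriGraph → GraphPoly, IsKuperberg f) ∧
    ∀ f : TriGraph → GraphPoly, IsKuperberg f →
      ∀ K L : GaussDiagram, K.VirtuallyIsotopic L → K.normBracket f = L.normBracket f :=
  ⟨existsUnique_isKuperberg, fun _ hf _ _ h => h.normBracket_eq hf⟩
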